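/- **Theorem.** Let $r \ge 2$. For a connected graph $G$, a set $D \subseteq V(G)$ is a *distance-$r$ dominating set* (D$r$DS) of $G$ if every vertex of $G$ is within distance $r$ of some member of $D$. A *$\mathsf{TJ}$-sequence* between two D$r$DSs $D_s, D_t$ of $G$ is a sequence $D_s = D_0, D_1, \dots, D_q = D_t$ of D$r$DSs of $G$ such that for every $i < q$ there are vertices $x_i, y_i$ with $D_i \setminus D_{i+1} = \{x_i\}$ and $D_{i+1} \setminus D_i = \{y_i\}$ (the token on $x_i$ jumps to $y_i$). If such a sequence exists, $D_s$ and $D_t$ are *$\mathsf{TJ}$-reconfigurable*. The problem D$r$DSR under $\mathsf{TJ}$ asks whether two given D$r$DSs $D_s, D_t$ of a given graph are $\mathsf{TJ}$-reconfigurable. For a finite tree $T$, a *canonical* minimum D$r$DS is a minimum D$r$DS $D^\star$ of $T$ together with a partition of $V(T)$ into sets $C_x$ $(x \in D^\star)$ such that $x \in C_x$, each $C_x$ induces a subtree of $T$, and every D$r$DS of $T$ meets each $C_x$. 1. Every finite tree has a canonical minimum D$r$DS. 2. Two D$r$DSs $D_s, D_t$ of a finite tree are $\mathsf{TJ}$-reconfigurable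 if and only if $|D_s| = |D_t|$. 3. D$r$DSR under $\mathsf{TJ}$ on trees can be solved in linear time. More precisely, there is a constant $c$, independent of $r$, such that for every $r \ge 2$ there is a program for a unit-cost random access machine (finitely many registers and arrays holding natural numbers; the steps are loading a literal, copying a register, adding or subtracting $1$, reading or writing an array cell addressed by a register, and comparing two registers) with the following property. Given a tree $T$ on the vertices $0, \dots, n-1$ by adjacency lists, and two D$r$DSs $D_s, D_t$ of $T$ as lists of vertices, the program halts after at most $c\,n$ steps. It outputs a bit that tells whether $D_s$ and $D_t$ are $\mathsf{TJ}$-reconfigurable, the partition $(C_x)_{x \in D^\star}$ of a canonical minimum D$r$DS $D^\star$ of $T$ (as the list of the vertices $x$ with $v \in C_x$, for $v = 0, \dots, n-1$), which depends on the representation of $T$ but not on $D_s, D_t$, and, if the answer is yes, the token moves $x_0, y_0, x_1, y_1, \dots$ of a $\mathsf{TJ}$-sequence between $D_s$ and $D_t$. -/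

import Mathlib

namespace DrDSR

/-! ### Distance-`r` dominating sets and token jumping -/

/-- `D` is a distance-`r` dominating set of `G`: every vertex is within distance `r` of some member
of `D`. (`edist` is the extended distance, infinite between different components.) -/
def IsDrDS {V : Type*} (G : SimpleGraph V) (r : ℕ) (D : Finset V) : Prop :=
  ∀ u : V, ∃ v ∈ D, G.edist u v ≤ (r : ℕ∞)

/-- `D` is a minimum distance-`r` dominating set of `G`. -/
def IsMinDrDS {V : Type*} (G : SimpleGraph V) (r : ℕ) (D : Finset V) : Prop :=
  IsDrDS G r D ∧ ∀ D' : Finset V, IsDrDS G r D' → D.card ≤ D'.card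

/-- `TJSequence G r Ds moves Dt`: there are distance-`r` dominating sets `Ds = D₀, D₁, …, D_q = Dt`
such that `moves = [(x₀, y₀), …, (x_{q-1}, y_{q-1})]`, where `Dᵢ \ Dᵢ₊₁ = {xᵢ}` and
`Dᵢ₊₁ \ Dᵢ = {yᵢ}`: the token on `xᵢ` jumps to `yᵢ`. -/
inductive TJSequence {V : Type*} [DecidableEq V] (G : SimpleGraph V) (r : ℕ) :
    Finset V → List (V × V) → Finset V → Prop
  | nil {D : Finset V} : IsDrDS G r D → TJSequence G r D [] D
  | cons {D D' Dt : Finset V} {x y : V} {moves : List (V × V)} :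
      IsDrDS G r D → D \ D' = {x} → D' \ D = {y} → TJSequence G r D' moves Dt →
      TJSequence G r D ((x, y) :: moves) Dt

/-- `Ds` can be reconfigured into `Dt` under token jumping. -/
def TJReconfigurable {V : Type*} [DecidableEq V] (G : SimpleGraph V) (r : ℕ)
    (Ds Dt : Finset V) : Prop :=
  ∃ moves : List (V × V), TJSequence G r Ds moves Dt

/-- `Dstar` is a canonical minimum distance-`r` dominating set of the tree `T`, witnessed by the
partition of the vertices into the classes `C_x = {v | rep v = x}`, `x ∈ Dstar`. -/
structure IsCanonicalPartition {V : Type*} (T : SimpleGraph V) (r : ℕ)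
    (Dstar : Finset V) (rep : V → V) : Prop where
  /-- `Dstar` is a minimum distance-`r` dominating set. -/
  minimum : IsMinDrDS T r Dstar
  /-- Every vertex lies in the class of some member of `Dstar`. -/
  rep_mem : ∀ v : V, rep v ∈ Dstar
  /-- Every `x ∈ Dstar` lies in its own class `C_x`, which thus has no other member of `Dstar`. -/
  rep_self : ∀ x ∈ Dstar, rep x = x
  /-- Every class induces a subtree. -/
  subtree : ∀ x ∈ Dstar, (T.induce {v | rep v = x}).IsTree
  /-- Every distance-`r` dominating set meets every class. -/
  meets : ∀ D : Finset V, IsDrDS T r D → ∀ x ∈ Dstar, ∃ v ∈ D, rep v = x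

/-! ### A random access machine with unit costs

A program uses finitely many registers and finitely many arrays, all holding natural numbers and
all addressed by literals in the program; a cell of an array is addressed by the content of a
register. The only arithmetic operations are successor and predecessor. Therefore a number present
after `t` steps exceeds the largest number in the input and in the program by at most `t`, so
that a computation with linearly many steps on numbers that are linearly bounded uses only words of
logarithmic length, as in the word RAM model. -/

/-- Tests on two registers. -/
inductive Test
  | eq (x y : ℕ)
  | ne (x y : ℕ)
  | lt (x y : ℕ)
  | le (x y : ℕ)

/-- Programs. -/
inductive Prog
  /-- do nothing -/
  | skip
  /-- `R x := k` for a literal `k` -/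
  | const (x k : ℕ)
  /-- `R x := R y` -/
  | copy (x y : ℕ)
  /-- `R x := R x + 1` -/
  | succ (x : ℕ)
  /-- `R x := R x - 1` (and `0` stays `0`) -/
  | pred (x : ℕ)
  /-- `R x := A a [R i]` -/
  | load (x a i : ℕ)
  /-- `A a [R i] := R x` -/
  | store (a i x : ℕ)
  /-- first `p`, then `q` -/
  | seq (p q : Prog)
  /-- if `b` then `p` else `q` -/
  | ite (b : Test) (p q : Prog)
  /-- while `b` do `p` -/
  | loop (b : Test) (p : Prog)

/-- A state of the machine: the contents of the registers and of the arrays. -/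
structure State where
  /-- `reg x` is the content of register `x`. -/
  reg : ℕ → ℕ
  /-- `arr a i` is the content of cell `i` of array `a`. -/
  arr : ℕ → ℕ → ℕ

/-- The state with register `x` set to `v`. -/
def State.setReg (s : State) (x v : ℕ) : State :=
  { s with reg := Function.update s.reg x v }

/-- The state with cell `i` of array `a` set to `v`. -/
def State.setArr (s : State) (a i v : ℕ) : State :=
  { s with arr := Function.update s.arr a (Function.update (s.arr a) i v) }

/-- The test succeeds in the state `s`. -/
def Test.Holds (s : State) : Test → Prop
  | .eq x y => s.reg x = s.reg y
  | .ne x y => s.reg x ≠ s.reg y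
  | .lt x y => s.reg x < s.reg y
  | .le x y => s.reg x ≤ s.reg y

/-- `Exec p s t s'`: the program `p`, started in the state `s`, halts after exactly `t` steps in the
state `s'`. Each elementary instruction and each evaluation of a test is one step. -/
inductive Exec : Prog → State → ℕ → State → Prop
  | skip {s} : Exec .skip s 1 s
  | const {s x k} : Exec (.const x k) s 1 (s.setReg x k)
  | copy {s x y} : Exec (.copy x y) s 1 (s.setReg x (s.reg y))
  | succ {s x} : Exec (.succ x) s 1 (s.setReg x (s.reg x + 1))
  | pred {s x} : Exec (.pred x) s 1 (s.setReg x (s.reg x - 1))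
  | load {s x a i} : Exec (.load x a i) s 1 (s.setReg x (s.arr a (s.reg i)))
  | store {s a i x} : Exec (.store a i x) s 1 (s.setArr a (s.reg i) (s.reg x))
  | seq {p q s₁ s₂ s₃ t₁ t₂} : Exec p s₁ t₁ s₂ → Exec q s₂ t₂ s₃ →
      Exec (.seq p q) s₁ (t₁ + t₂) s₃
  | iteTrue {b p q s s' t} : b.Holds s → Exec p s t s' → Exec (.ite b p q) s (1 + t) s'
  | iteFalse {b p q s s' t} : ¬ b.Holds s → Exec q s t s' → Exec (.ite b p q) s (1 + t) s'
  | loopFalse {b p s} : ¬ b.Holds s → Exec (.loop b p) s 1 s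
  | loopTrue {b p s₁ s₂ s₃ t₁ t₂} : b.Holds s₁ → Exec p s₁ t₁ s₂ → Exec (.loop b p) s₂ t₂ s₃ →
      Exec (.loop b p) s₁ (1 + t₁ + t₂) s₃

/-- The initial state: array `0` starts with the input, everything else is `0`. -/
def State.init (input : List ℕ) : State where
  reg := fun _ => 0
  arr := fun a i => if a = 0 then input.getD i 0 else 0

/-- The output of a halted machine: the first `R 0` cells of array `1`. -/
def State.output (s : State) : List ℕ :=
  (List.range (s.reg 0)).map (s.arr 1)

/-- On the given input, the program halts within `t` steps with the given output. -/
def Prog.Computes (p : Prog) (input output : List ℕ) (t : ℕ) : Prop :=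
  ∃ (t' : ℕ) (s : State), t' ≤ t ∧ Exec p (State.init input) t' s ∧ s.output = output

/-! ### Encodings -/

/-- `adj` is an adjacency list representation of `G`: `adj v` lists the neighbours of `v`, each one
once, in an arbitrary order. -/
def IsAdjacencyList {n : ℕ} (G : SimpleGraph (Fin n)) (adj : Fin n → List (Fin n)) : Prop :=
  ∀ v : Fin n, (adj v).Nodup ∧ ∀ w : Fin n, w ∈ adj v ↔ G.Adj v w

/-- A list of vertices, preceded by its length. -/
def encodeList {n : ℕ} (l : List (Fin n)) : List ℕ :=
  l.length :: l.map (fun v => (v : ℕ))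

/-- The encoding of an instance: `n`, the adjacency lists of the vertices `0, …, n - 1`, and the
lists of the vertices of the two distance-`r` dominating sets. -/
def encodeInstance {n : ℕ} (adj : Fin n → List (Fin n)) (ls lt : List (Fin n)) : List ℕ :=
  n :: ((List.ofFn fun v => encodeList (adj v)).flatten ++ encodeList ls ++ encodeList lt)

/-- A vertex map, written as the list of its values at `0, …, n - 1`. -/
def encodeMap {n : ℕ} (f : Fin n → Fin n) : List ℕ :=
  List.ofFn fun v => (f v : ℕ)

/-- A list of token moves `(x₀, y₀), (x₁, y₁), …`, written as `x₀, y₀, x₁, y₁, …`. -/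
def encodeMoves {n : ℕ} (moves : List (Fin n × Fin n)) : List ℕ :=
  moves.flatMap fun m => [(m.1 : ℕ), (m.2 : ℕ)]

end DrDSR

/-! Root the tree and choose centers greedily from the leaves upwards. `A v` is one more than the
distance from `v` to the farthest vertex below it that a child still reports as undominated (or `1`,
for `v` itself). `B v` is what is left at `v` of the radius `r + 1` of the nearest center strictly
below `v`. If `A v ≤ B v`, that center serves all these vertices. Otherwise the demand passes to the
parent, until `A v = r + 1` or the root is reached; then `v` becomes a center. A vertex belongs to
the class of the nearest center above it (or equal to it); vertices without one join the class of
the center `x₀` of least rank.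

Two facts carry the proof. Everything below a center is dominated by centers below that center
(`IsGreedy.covered_of_mem`). And every center owns a vertex whose ball of radius `r` stays inside
the class (`IsRep.exists_ball`, from `IsGreedy.exists_witness`). By the second, every dominating set
meets every class, so the centers form a minimum dominating set and the partition is canonical.

A jump preserves the number of tokens, so equal sizes are necessary. Conversely, treat the centers
`x` by decreasing rank and let one token of the class of `x` jump to `x` (`IsRep.isDrDS_move`):
vertices below `x` are served by centers already occupied, and any other vertex was reached by a
token below `x` only through `x`. Once all centers carry tokens, the other tokens jump freely
(`TJSequence.zip`). The journey to the target is completed by reversing the same process for the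
target (`tjSequence_allMoves`).

For the running time, a breadth-first search yields parents and an order in which parents come
first. Every later stage is one pass over this order, over the vertices or over the token lists.
Each loop of the program has a loop-free body, and `runs_loop` bounds its iterations by a fuel;
since a tree has `n - 1` edges, every fuel is linear in `n`. The radius enters the program only as
the literal `r + 1`, so the constant does not depend on `r`. -/

namespace DrDSR

/-! ### Symbolic evaluation of programs and the cost of loops -/

instance Test.decidableHolds (s : State) : (b : Test) → Decidable (b.Holds s)
  | .eq x y => inferInstanceAs (Decidable (s.reg x = s.reg y))
  | .ne x y => inferInstanceAs (Decidable (s.reg x ≠ s.reg y))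
  | .lt x y => inferInstanceAs (Decidable (s.reg x < s.reg y))
  | .le x y => inferInstanceAs (Decidable (s.reg x ≤ s.reg y))

/-- The program contains no loop. -/
def Prog.loopFree : Prog → Bool
  | .seq p q => p.loopFree && q.loopFree
  | .ite _ p q => p.loopFree && q.loopFree
  | .loop _ _ => false
  | _ => true

/-- The number of instructions and tests in a program. -/
def Prog.size : Prog → ℕ
  | .seq p q => p.size + q.size
  | .ite _ p q => 1 + p.size + q.size
  | .loop _ p => 1 + p.size
  | _ => 1

/-- The effect of a loop-free program. -/
def Prog.eval : Prog → State → State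
  | .skip, s => s
  | .const x k, s => s.setReg x k
  | .copy x y, s => s.setReg x (s.reg y)
  | .succ x, s => s.setReg x (s.reg x + 1)
  | .pred x, s => s.setReg x (s.reg x - 1)
  | .load x a i, s => s.setReg x (s.arr a (s.reg i))
  | .store a i x, s => s.setArr a (s.reg i) (s.reg x)
  | .seq p q, s => q.eval (p.eval s)
  | .ite b p q, s => if b.Holds s then p.eval s else q.eval s
  | .loop _ _, s => s

/-- The registers a program writes to. -/
def Prog.regs : Prog → List ℕ
  | .const x _ => [x]
  | .copy x _ => [x]
  | .succ x => [x]
  | .pred x => [x]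
  | .load x _ _ => [x]
  | .seq p q => p.regs ++ q.regs
  | .ite _ p q => p.regs ++ q.regs
  | .loop _ p => p.regs
  | _ => []

/-- The arrays a program writes to. -/
def Prog.arrs : Prog → List ℕ
  | .store a _ _ => [a]
  | .seq p q => p.arrs ++ q.arrs
  | .ite _ p q => p.arrs ++ q.arrs
  | .loop _ p => p.arrs
  | _ => []

/-- `s` and `s'` agree on everything that `p` does not write to. -/
structure Frame (p : Prog) (s s' : State) : Prop where
  reg : ∀ x, x ∉ p.regs → s'.reg x = s.reg x
  arr : ∀ a, a ∉ p.arrs → s'.arr a = s.arr a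

/-- The sets of written registers and arrays are syntactic, so `decide` can check that a stage
leaves the data of the other stages alone. This is how facts travel between the stages of the
program. -/
theorem Exec.frame {p : Prog} {s s' : State} {t : ℕ} (h : Exec p s t s') : Frame p s s' := by
  induction h with
  | skip => exact ⟨fun _ _ => rfl, fun _ _ => rfl⟩
  | const | copy | succ | pred | load =>
    refine ⟨fun x hx => ?_, fun _ _ => rfl⟩
    simp only [Prog.regs, List.mem_singleton] at hx
    simp [State.setReg, hx]
  | store =>
    refine ⟨fun _ _ => rfl, fun x hx => ?_⟩
    simp only [Prog.arrs, List.mem_singleton] at hx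
    simp [State.setArr, hx]
  | seq _ _ ih₁ ih₂ =>
    refine ⟨fun x hx => ?_, fun x hx => ?_⟩
    · simp only [Prog.regs, List.mem_append, not_or] at hx
      rw [ih₂.reg x hx.2, ih₁.reg x hx.1]
    · simp only [Prog.arrs, List.mem_append, not_or] at hx
      rw [ih₂.arr x hx.2, ih₁.arr x hx.1]
  | iteTrue _ _ ih =>
    refine ⟨fun x hx => ih.reg x fun h => hx ?_, fun x hx => ih.arr x fun h => hx ?_⟩ <;>
    simp [Prog.regs, Prog.arrs, h]
  | iteFalse _ _ ih =>
    refine ⟨fun x hx => ih.reg x fun h => hx ?_, fun x hx => ih.arr x fun h => hx ?_⟩ <;>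
    simp [Prog.regs, Prog.arrs, h]
  | loopFalse => exact ⟨fun _ _ => rfl, fun _ _ => rfl⟩
  | loopTrue _ _ _ ih₁ ih₂ =>
    exact ⟨fun x hx => (ih₂.reg x hx).trans (ih₁.reg x hx),
      fun x hx => (ih₂.arr x hx).trans (ih₁.arr x hx)⟩

/-- `p`, started in `s`, halts in `s'` after at most `t` steps. -/
def Runs (p : Prog) (s : State) (t : ℕ) (s' : State) : Prop :=
  ∃ t' ≤ t, Exec p s t' s'

theorem Runs.frame {p : Prog} {s s' : State} {t : ℕ} (h : Runs p s t s') : Frame p s s' :=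
  let ⟨_, _, h⟩ := h
  h.frame

theorem Runs.mono {p : Prog} {s s' : State} {t t' : ℕ} (h : Runs p s t s') (htt : t ≤ t') :
    Runs p s t' s' :=
  let ⟨u, hu, h⟩ := h
  ⟨u, hu.trans htt, h⟩

theorem Runs.seq {p q : Prog} {s₁ s₂ s₃ : State} {t₁ t₂ : ℕ} (h₁ : Runs p s₁ t₁ s₂)
    (h₂ : Runs q s₂ t₂ s₃) : Runs (.seq p q) s₁ (t₁ + t₂) s₃ :=
  let ⟨u₁, hu₁, h₁⟩ := h₁
  let ⟨u₂, hu₂, h₂⟩ := h₂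
  ⟨u₁ + u₂, add_le_add hu₁ hu₂, .seq h₁ h₂⟩

/-- Reduces the execution of straight-line code to computing `eval` by `simp`. `size` adds up both
branches of a conditional, so it only bounds the time from above. -/
theorem runs_eval (p : Prog) (hp : p.loopFree = true) (s : State) :
    Runs p s p.size (p.eval s) := by
  induction p generalizing s with
  | skip => exact ⟨1, le_rfl, .skip⟩
  | const => exact ⟨1, le_rfl, .const⟩
  | copy => exact ⟨1, le_rfl, .copy⟩
  | succ => exact ⟨1, le_rfl, .succ⟩
  | pred => exact ⟨1, le_rfl, .pred⟩
  | load => exact ⟨1, le_rfl, .load⟩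
  | store => exact ⟨1, le_rfl, .store⟩
  | seq p q ihp ihq =>
    simp only [Prog.loopFree, Bool.and_eq_true] at hp
    exact (ihp hp.1 s).seq (ihq hp.2 _)
  | ite b p q ihp ihq =>
    simp only [Prog.loopFree, Bool.and_eq_true] at hp
    by_cases hb : b.Holds s
    · obtain ⟨t, ht, h⟩ := ihp hp.1 s
      refine ⟨1 + t, by simp only [Prog.size]; omega, ?_⟩
      simpa [Prog.eval, hb] using Exec.iteTrue (q := q) hb h
    · obtain ⟨t, ht, h⟩ := ihq hp.2 s
      refine ⟨1 + t, by simp only [Prog.size]; omega, ?_⟩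
      simpa [Prog.eval, hb] using Exec.iteFalse (p := p) hb h
  | loop => simp [Prog.loopFree] at hp

theorem Frame.trans {p : Prog} {s₁ s₂ s₃ : State} (h₁ : Frame p s₁ s₂) (h₂ : Frame p s₂ s₃) :
    Frame p s₁ s₃ :=
  ⟨fun x hx => (h₂.reg x hx).trans (h₁.reg x hx), fun x hx => (h₂.arr x hx).trans (h₁.arr x hx)⟩

/-- A loop with a loop-free body terminates in linear time in the fuel `m`, which the body has to
decrease while it preserves the invariant. -/
theorem runs_loop (b : Test) (p : Prog) (hp : p.loopFree = true) (I : ℕ → State → Prop)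
    (s₀ : State)
    (step : ∀ m s, Frame p s₀ s → I m s → b.Holds s → ∃ m' < m, I m' (p.eval s)) (m : ℕ)
    (h₀ : I m s₀) :
    ∃ s', Runs (.loop b p) s₀ (m * (p.size + 1) + 1) s' ∧ ¬ b.Holds s' ∧ Frame p s₀ s' ∧
      ∃ m', I m' s' := by
  -- The frame relative to the first state `s₀` is carried through the induction, so that an
  -- invariant only has to mention what the body changes.
  suffices key : ∀ m s, Frame p s₀ s → I m s →
      ∃ s', Runs (.loop b p) s (m * (p.size + 1) + 1) s' ∧ ¬ b.Holds s' ∧ Frame p s₀ s' ∧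
        ∃ m', I m' s' from key m s₀ ⟨fun _ _ => rfl, fun _ _ => rfl⟩ h₀
  intro m
  induction m using Nat.strong_induction_on with
  | _ m ih =>
    intro s hf hI
    by_cases hb : b.Holds s
    · obtain ⟨m', hm', hI'⟩ := step m s hf hI hb
      obtain ⟨t, ht, he⟩ := runs_eval p hp s
      obtain ⟨s', ⟨t', ht', he'⟩, h1, h2, h3⟩ := ih m' hm' _ (hf.trans he.frame) hI'
      refine ⟨s', ⟨1 + t + t', ?_, .loopTrue hb he he'⟩, h1, h2, h3⟩
      have : (m' + 1) * (p.size + 1) ≤ m * (p.size + 1) := Nat.mul_le_mul_right _ hm'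
      rw [Nat.succ_mul] at this
      omega
    · exact ⟨s, ⟨1, by omega, .loopFalse hb⟩, hb, hf, m, hI⟩

@[simp] theorem State.reg_setReg (s : State) (x v y : ℕ) :
    (s.setReg x v).reg y = if y = x then v else s.reg y := by
  simp [State.setReg, Function.update_apply]

@[simp] theorem State.arr_setReg (s : State) (x v : ℕ) : (s.setReg x v).arr = s.arr := rfl

@[simp] theorem State.reg_setArr (s : State) (a i v : ℕ) : (s.setArr a i v).reg = s.reg := rfl

@[simp] theorem State.arr_setArr (s : State) (a i v b j : ℕ) :
    (s.setArr a i v).arr b j = if b = a ∧ j = i then v else s.arr b j := by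
  by_cases h : b = a
  · subst h; simp [State.setArr, Function.update_apply]
  · simp [State.setArr, h]

/-! ### Distances in rooted trees -/

/-- `T` is the tree with root `root`, parent map `par` and depth function `dep`, and `rk` numbers
the vertices such that parents come before their children. -/
structure IsRooted {V : Type*} (T : SimpleGraph V) (root : V) (par : V → V) (dep rk : V → ℕ) :
    Prop where
  par_root : par root = root
  dep_par : ∀ v, v ≠ root → dep v = dep (par v) + 1
  rk_par : ∀ v, v ≠ root → rk (par v) < rk v
  adj_iff : ∀ u v, T.Adj u v ↔ u ≠ v ∧ (par u = v ∨ par v = u)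

/-- `Below root par v x`: the vertex `v` lies in the subtree with root `x`. -/
def Below {V : Type*} (root : V) (par : V → V) : V → V → Prop :=
  Relation.ReflTransGen fun c p => c ≠ root ∧ par c = p

section Rooted

variable {V : Type*} {T : SimpleGraph V} {root : V} {par : V → V} {dep rk : V → ℕ}

theorem Below.refl (v : V) : Below root par v v := Relation.ReflTransGen.refl

theorem Below.trans {u v w : V} (h₁ : Below root par u v) (h₂ : Below root par v w) :
    Below root par u w := Relation.ReflTransGen.trans h₁ h₂

theorem below_par {v : V} (hv : v ≠ root) : Below root par v (par v) :=
  Relation.ReflTransGen.single ⟨hv, rfl⟩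

theorem Below.par_below {u x : V} (h : Below root par u x) (hne : u ≠ x) :
    u ≠ root ∧ Below root par (par u) x := by
  rcases Relation.ReflTransGen.cases_head h with h | ⟨c, ⟨h1, rfl⟩, h2⟩
  · exact absurd h hne
  · exact ⟨h1, h2⟩

namespace IsRooted

variable (hT : IsRooted T root par dep rk)
include hT

theorem below_root (v : V) : Below root par v root := by
  induction h : dep v using Nat.strong_induction_on generalizing v with
  | _ n ih =>
    by_cases hv : v = root
    · subst hv; exact .refl _
    · exact (below_par hv).trans (ih _ (by have := hT.dep_par v hv; omega) _ rfl)

theorem par_ne {v : V} (hv : v ≠ root) : par v ≠ v := fun h => by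
  have := hT.rk_par v hv; rw [h] at this; omega

theorem adj_par {v : V} (hv : v ≠ root) : T.Adj v (par v) :=
  (hT.adj_iff _ _).2 ⟨(hT.par_ne hv).symm, Or.inl rfl⟩

theorem dep_le_of_below {u x : V} (h : Below root par u x) : dep x ≤ dep u := by
  induction h with
  | refl => exact le_rfl
  | tail _ h ih => have := hT.dep_par _ h.1; rw [h.2] at this; omega

theorem rk_le_of_below {u x : V} (h : Below root par u x) : rk x ≤ rk u := by
  induction h with
  | refl => exact le_rfl
  | tail _ h ih => have := hT.rk_par _ h.1; rw [h.2] at this; omega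

/-- The path of parents from `u` to `x` has length `dep u - dep x`. The additive form avoids
truncated subtraction and also shows that the distance is finite. -/
theorem edist_add_dep {u x : V} (h : Below root par u x) :
    T.edist u x + dep x ≤ dep u := by
  induction h with
  | refl => simp
  | @tail b c _ h ih =>
    have h1 : T.edist b c = 1 :=
      SimpleGraph.edist_eq_one_iff_adj.2 (h.2 ▸ hT.adj_par h.1)
    have h2 := hT.dep_par _ h.1
    rw [h.2] at h2
    calc T.edist u c + dep c ≤ (T.edist u b + T.edist b c) + dep c := by
          gcongr; exact SimpleGraph.edist_triangle
      _ = T.edist u b + dep b := by rw [h1, h2]; push_cast; ring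
      _ ≤ _ := ih

/-- Along an edge the depth changes by one. This is the only source of lower bounds for distances.
-/
theorem dep_le_add_length {u w : V} (p : T.Walk u w) : dep u ≤ dep w + p.length := by
  induction p with
  | nil => simp
  | @cons u v w h p ih =>
    rw [SimpleGraph.Walk.length_cons]
    obtain ⟨hne, h | h⟩ := (hT.adj_iff _ _).1 h
    · by_cases hu : u = root
      · exact absurd (by rw [← h, hu, hT.par_root]) hne
      · have := hT.dep_par u hu
        rw [h] at this
        omega
    · by_cases hv : v = root
      · exact absurd (by rw [← h, hv, hT.par_root]) hne
      · have := hT.dep_par v hv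
        rw [h] at this
        omega

theorem dep_le_add_edist (u w : V) : (dep u : ℕ∞) ≤ dep w + T.edist u w := by
  by_cases h : T.edist u w = ⊤
  · simp [h]
  · obtain ⟨p, hp⟩ := SimpleGraph.exists_walk_of_edist_ne_top h
    rw [← hp]
    exact_mod_cast hT.dep_le_add_length p

/-- The edge between `c` and its parent is the only one that leaves the subtree of `c`. -/
theorem mem_support_of_not_below {c u z : V} (p : T.Walk u z) (hu : Below root par u c)
    (hz : ¬ Below root par z c) : c ∈ p.support ∧ par c ∈ p.support := by
  induction p with
  | nil => exact absurd hu hz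
  | @cons u v w h p ih =>
    rw [SimpleGraph.Walk.support_cons]
    by_cases hv : Below root par v c
    · exact ⟨List.mem_cons_of_mem _ (ih hv hz).1, List.mem_cons_of_mem _ (ih hv hz).2⟩
    · obtain ⟨hne, h | h⟩ := (hT.adj_iff _ _).1 h
      · by_cases huc : u = c
        · subst huc
          exact ⟨List.mem_cons_self, List.mem_cons_of_mem _ (h ▸ p.start_mem_support)⟩
        · exact absurd (h ▸ (hu.par_below huc).2) hv
      · by_cases hvr : v = root
        · exact absurd (by rw [← h, hvr, hT.par_root]) hne
        · have hvu := below_par (par := par) hvr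
          rw [h] at hvu
          exact absurd (hvu.trans hu) hv

/-- A shortest walk out of the subtree of `c` uses both ends of the edge above `c`, so the distance
splits at either of them. -/
theorem edist_split {c u z : V} (hu : Below root par u c) (hz : ¬ Below root par z c) :
    T.edist u c + T.edist c z ≤ T.edist u z ∧
      T.edist u (par c) + T.edist (par c) z ≤ T.edist u z := by
  classical
  by_cases h : T.edist u z = ⊤
  · simp [h]
  · obtain ⟨p, hp⟩ := SimpleGraph.exists_walk_of_edist_ne_top h
    have key : ∀ m ∈ p.support, T.edist u m + T.edist m z ≤ T.edist u z := by
      intro m hm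
      rw [← hp]
      have := congrArg SimpleGraph.Walk.length (p.take_spec hm)
      rw [SimpleGraph.Walk.length_append] at this
      rw [← this]
      push_cast
      exact add_le_add (SimpleGraph.edist_le _) (SimpleGraph.edist_le _)
    obtain ⟨h1, h2⟩ := hT.mem_support_of_not_below p hu hz
    exact ⟨key _ h1, key _ h2⟩

/-- Induction from the leaves to the root: in a finite tree the reversed rank is well-founded. -/
theorem children_induction [Finite V] {P : V → Prop}
    (h : ∀ v, (∀ c, c ≠ root → par c = v → P c) → P v) (v : V) : P v := by
  have wf : WellFounded fun a b : V => rk b < rk a := by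
    have : IsTrans V fun a b => rk b < rk a := ⟨fun _ _ _ h₁ h₂ => lt_trans h₂ h₁⟩
    have : Std.Irrefl fun a b : V => rk b < rk a := ⟨fun _ => lt_irrefl _⟩
    exact Finite.wellFounded_of_trans_of_irrefl _
  induction v using wf.induction with
  | _ v ih => exact h v fun c hc hcv => ih c (hcv ▸ hT.rk_par c hc)

omit hT in
/-- Downward decomposition: a vertex strictly below `v` lies below a child of `v`. -/
theorem _root_.DrDSR.Below.exists_child {u v : V} (h : Below root par u v) (hne : u ≠ v) :
    ∃ c, c ≠ root ∧ par c = v ∧ Below root par u c := by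
  rcases Relation.ReflTransGen.cases_tail h with h | ⟨c, h1, h2, h3⟩
  · exact absurd h.symm hne
  · exact ⟨c, h2, h3, h1⟩

/-- Go from `u` up to `v` and down to `z`. The hypothesis is the length of this detour, written
without subtraction. -/
theorem edist_le_of_dep {u v z : V} {k : ℕ} (hu : Below root par u v) (hz : Below root par z v)
    (h : dep u + dep z ≤ 2 * dep v + k) : T.edist u z ≤ k := by
  have h1 := hT.edist_add_dep hu
  have h2 := hT.edist_add_dep hz
  have h3 : T.edist u z ≤ T.edist u v + T.edist z v := by
    rw [SimpleGraph.edist_comm (u := z)]; exact SimpleGraph.edist_triangle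
  have e1 : T.edist u v ≠ ⊤ := fun e => by rw [e] at h1; simp at h1
  have e2 : T.edist z v ≠ ⊤ := fun e => by rw [e] at h2; simp at h2
  lift T.edist u v to ℕ using e1 with a
  lift T.edist z v to ℕ using e2 with b
  refine h3.trans ?_
  norm_cast at *
  omega

/-- Inside `S` every vertex climbs along its parents to the top vertex `t`. -/
theorem induce_connected_of_top {S : Set V} (t : V) (ht : t ∈ S)
    (h : ∀ v ∈ S, v ≠ t → v ≠ root ∧ par v ∈ S) : (T.induce S).Connected := by
  have key : ∀ v (hv : v ∈ S), (T.induce S).Reachable ⟨v, hv⟩ ⟨t, ht⟩ := by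
    intro v
    induction hn : rk v using Nat.strong_induction_on generalizing v with
    | _ n ih =>
      intro hv
      by_cases hvt : v = t
      · subst hvt; rfl
      · obtain ⟨h1, h2⟩ := h v hv hvt
        have : (T.induce S).Adj ⟨v, hv⟩ ⟨par v, h2⟩ := by simpa using hT.adj_par h1
        exact this.reachable.trans (ih _ (hn ▸ hT.rk_par v h1) _ rfl h2)
  have : Nonempty S := ⟨⟨t, ht⟩⟩
  exact ⟨fun a b => (key a a.2).trans (key b b.2).symm⟩

end IsRooted

end Rooted

/-! ### The greedy algorithm -/

section Greedy

variable {V : Type*} [DecidableEq V] {T : SimpleGraph V} {root : V} {par : V → V}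
  {dep rk : V → ℕ} {r : ℕ} {A B : V → ℕ} {C : Finset V}

/-- One plus the distance from `v` to the farthest vertex below `v` that no center below `v`
dominates, and zero if there is none. -/
def needOut (A B : V → ℕ) (C : Finset V) (v : V) : ℕ :=
  if v ∈ C ∨ A v ≤ B v then 0 else A v

/-- By how much the radius `r + 1` exceeds the distance from `v` to the nearest center below `v`. -/
def slackOut (r : ℕ) (B : V → ℕ) (C : Finset V) (v : V) : ℕ :=
  if v ∈ C then r + 1 else B v

/-- The equations of the bottom-up dynamic program that selects the set `C` of centers:
`A v` and `B v` are the values of `needOut` and `slackOut` before the decision on `v`. -/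
structure IsGreedy (root : V) (par : V → V) (r : ℕ) (A B : V → ℕ) (C : Finset V) : Prop where
  one_le : ∀ v, 1 ≤ A v
  need_par : ∀ c, c ≠ root → needOut A B C c ≠ 0 → needOut A B C c + 1 ≤ A (par c)
  need_att : ∀ v, A v = 1 ∨ ∃ c, c ≠ root ∧ par c = v ∧ needOut A B C c ≠ 0 ∧
    A v = needOut A B C c + 1
  slack_par : ∀ c, c ≠ root → slackOut r B C c ≤ B (par c) + 1
  slack_att : ∀ v, B v = 0 ∨ ∃ c, c ≠ root ∧ par c = v ∧ B v + 1 = slackOut r B C c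
  mem_iff : ∀ v, v ∈ C ↔ B v < A v ∧ (A v = r + 1 ∨ v = root)

namespace IsGreedy

variable (hT : IsRooted T root par dep rk) (hG : IsGreedy root par r A B C)

include hT hG

/-- An unserved vertex whose need reaches `r + 1` becomes a center and reports nothing; hence each
child reports at most `r`. -/
theorem need_le [Finite V] (v : V) : A v ≤ r + 1 := by
  induction v using hT.children_induction with
  | _ v ih =>
    rcases hG.need_att v with h | ⟨c, hc, hcv, h0, h⟩
    · omega
    · have h1 := ih c hc hcv
      have h2 := hG.mem_iff c
      unfold needOut at h h0
      split_ifs at h h0 with h3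
      · exact absurd rfl h0
      · have : A c ≠ r + 1 := fun h4 => h3 (Or.inl (h2.2 ⟨by omega, Or.inl h4⟩))
        omega

theorem slack_le [Finite V] (v : V) : B v ≤ r := by
  induction v using hT.children_induction with
  | _ v ih =>
    rcases hG.slack_att v with h | ⟨c, hc, hcv, h⟩
    · omega
    · have h1 := ih c hc hcv
      unfold slackOut at h
      split_ifs at h <;> omega

/-- A positive slack comes from an actual center at distance at most `r + 1` minus the slack.
Together with `le_slackOut`, which says that no center below is nearer, this justifies the meaning
of the slack. -/
theorem slackOut_pos [Finite V] (v : V) (hv : slackOut r B C v ≠ 0) :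
    ∃ z ∈ C, Below root par z v ∧ dep z + slackOut r B C v ≤ dep v + r + 1 := by
  induction v using hT.children_induction with
  | _ v ih =>
    unfold slackOut at hv ⊢
    split_ifs at hv ⊢ with h
    · exact ⟨v, h, .refl v, by omega⟩
    · rcases hG.slack_att v with h' | ⟨c, hc, hcv, h'⟩
      · exact absurd h' hv
      · obtain ⟨z, hz, hzc, hd⟩ := ih c hc hcv (by omega)
        refine ⟨z, hz, hzc.trans (hcv ▸ below_par hc), ?_⟩
        have := hT.dep_par c hc
        rw [hcv] at this
        omega

theorem le_slackOut [Finite V] {z v : V} (hz : z ∈ C) (h : Below root par z v) :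
    dep v + r + 1 ≤ dep z + slackOut r B C v := by
  induction h with
  | refl => simp [slackOut, hz, add_assoc]
  | @tail b c _ h ih =>
    have h1 := hG.slack_par b h.1
    have h2 := hT.dep_par b h.1
    rw [h.2] at h1 h2
    have h3 := hG.slack_le hT c
    have : B c ≤ slackOut r B C c := by
      unfold slackOut
      split_ifs <;> omega
    omega

/-- Every vertex below `v` is dominated from below `v`, or its depth is bounded by `needOut`. -/
theorem covered_or_le [Finite V] {u v : V} (h : Below root par u v) :
    (∃ z ∈ C, Below root par z v ∧ T.edist u z ≤ r) ∨ dep u + 1 ≤ dep v + needOut A B C v := by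
  -- The decision at one vertex `w`. A center at `w` reaches `u` because `A w ≤ r + 1`. If `A w ≤ B
  -- w`, then `u` is at most `A w - 1` below `w` and some center at most `r + 1 - B w`, which add up
  -- to at most `r`.
  have main : ∀ w, Below root par u w → dep u + 1 ≤ dep w + A w →
      (∃ z ∈ C, Below root par z w ∧ T.edist u z ≤ r) ∨ dep u + 1 ≤ dep w + needOut A B C w := by
    intro w hw hle
    have hA := hG.need_le hT w
    by_cases hC : w ∈ C
    · exact Or.inl ⟨w, hC, .refl w, hT.edist_le_of_dep hw (.refl w) (by omega)⟩
    · by_cases hAB : A w ≤ B w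
      · have h1 := hG.one_le w
        have h2 : slackOut r B C w = B w := by simp [slackOut, hC]
        obtain ⟨z, hz, hzw, hd⟩ := hG.slackOut_pos hT w (by omega)
        exact Or.inl ⟨z, hz, hzw, hT.edist_le_of_dep hw hzw (by omega)⟩
      · right
        simpa [needOut, hC, hAB] using hle
  induction h with
  | refl => exact main u (.refl u) (by have := hG.one_le u; omega)
  | @tail b c hub h ih =>
    have hbc : Below root par b c := h.2 ▸ below_par h.1
    rcases ih with ⟨z, hz, hzb, hd⟩ | hle
    · exact Or.inl ⟨z, hz, hzb.trans hbc, hd⟩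
    · have h2 := hT.dep_par b h.1
      have h3 := hT.dep_le_of_below hub
      have h4 := hG.need_par b h.1 (by omega)
      rw [h.2] at h2 h4
      exact main c (hub.trans hbc) (by omega)

/-- A center reports no need, so nothing below it remains to be served from outside. This
independence of subtrees makes the token moves possible. -/
theorem covered_of_mem [Finite V] {u x : V} (hx : x ∈ C) (h : Below root par u x) :
    ∃ z ∈ C, Below root par z x ∧ T.edist u z ≤ r := by
  rcases hG.covered_or_le hT h with h' | h'
  · exact h'
  · have := hT.dep_le_of_below h
    simp only [needOut, hx, true_or, if_true] at h'
    omega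

theorem isDrDS [Finite V] : IsDrDS T r C := by
  intro u
  rcases hG.covered_or_le hT (hT.below_root u) with ⟨z, hz, _, h⟩ | h
  · exact ⟨z, hz, h⟩
  · have h1 := hT.dep_le_of_below (hT.below_root u)
    -- The root becomes a center as soon as `B root < A root`, whatever the size of its need.
    have h2 : needOut A B C root = 0 := by
      have := hG.mem_iff root
      simp only [or_true, and_true] at this
      unfold needOut
      rw [if_pos]
      rw [this]
      omega
    omega

/-- Descend along the children that attain the need. The bottom vertex `u` is at distance `A v - 1`
from `v`, and centers in other branches are at distance at least `r + 1 - B v` from `v`. As `B v < A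
v`, they are farther than `r` from `u`. Centers in the same branch are excluded by induction. The
vertex `v` itself is exempt, since it may become a center. -/
theorem exists_witness [Finite V] (v : V) (hv : B v < A v) :
    ∃ u, Below root par u v ∧ dep u + 1 = dep v + A v ∧
      ∀ z ∈ C, Below root par z v → z ≠ v → (r : ℕ∞) < T.edist u z := by
  induction v using hT.children_induction with
  | _ v ih =>
    -- A center strictly below `v` lies below a child, and the report of that child entered `B v`.
    have hslack : ∀ z ∈ C, Below root par z v → z ≠ v → dep v + r < dep z + B v := by
      intro z hz hzv hne
      obtain ⟨c, hc, hcv, hzc⟩ := hzv.exists_child hne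
      have h1 := hG.le_slackOut hT hz hzc
      have h2 := hG.slack_par c hc
      have h3 := hT.dep_par c hc
      rw [hcv] at h2 h3
      omega
    rcases hG.need_att v with h | ⟨c, hc, hcv, h0, h⟩
    · refine ⟨v, .refl v, by omega, fun z hz hzv hne => ?_⟩
      have h1 := hslack z hz hzv hne
      have h2 := hT.dep_le_add_edist z v
      rw [SimpleGraph.edist_comm] at h2
      by_contra! h3
      have h4 := h2.trans (add_le_add_right h3 _)
      norm_cast at h4
      omega
    · have hcC : c ∉ C := fun hcC => h0 (by simp [needOut, hcC])
      have hAB : ¬ A c ≤ B c := fun hAB => h0 (by simp [needOut, hAB])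
      have hout : needOut A B C c = A c := by simp [needOut, hcC, hAB]
      obtain ⟨u, huc, hd, hfar⟩ := ih c hc hcv (by omega)
      have hcd := hT.dep_par c hc
      have hbc : Below root par c v := hcv ▸ below_par hc
      rw [hcv] at hcd
      refine ⟨u, huc.trans hbc, by omega, fun z hz hzv hne => ?_⟩
      by_cases hzc : Below root par z c
      · exact hfar z hz hzc fun e => hcC (e ▸ hz)
      · have h1 := hslack z hz hzv hne
        have h2 := hT.dep_le_add_edist z v
        have h3 := hT.dep_le_add_edist u v
        have h4 := (hT.edist_split huc hzc).2
        rw [hcv] at h4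
        rw [SimpleGraph.edist_comm] at h2
        by_contra! h5
        have h6 := h4.trans h5
        have e1 : T.edist u v ≠ ⊤ := fun e => by rw [e] at h6; simp at h6
        have e2 : T.edist v z ≠ ⊤ := fun e => by rw [e] at h6; simp at h6
        lift T.edist u v to ℕ using e1 with a
        lift T.edist v z to ℕ using e2 with b
        norm_cast at *
        omega

end IsGreedy

/-- `rep` maps a vertex to the nearest center above it, or to the first center `x₀` if there is
none. -/
structure IsRep (root : V) (par : V → V) (rk : V → ℕ) (C : Finset V) (x₀ : V) (rep : V → V) :
    Prop where
  mem : x₀ ∈ C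
  rk_le : ∀ z ∈ C, rk x₀ ≤ rk z
  rep_center : ∀ v ∈ C, rep v = v
  rep_par : ∀ v ∉ C, v ≠ root → rep v = rep (par v)
  rep_root : root ∉ C → rep root = x₀

namespace IsRep

variable {x₀ : V} {rep : V → V} (hT : IsRooted T root par dep rk)
  (hG : IsGreedy root par r A B C) (hR : IsRep root par rk C x₀ rep)

include hT hR

theorem rep_mem (v : V) : rep v ∈ C := by
  induction h : rk v using Nat.strong_induction_on generalizing v with
  | _ n ih =>
    by_cases hv : v ∈ C
    · rwa [hR.rep_center v hv]
    · by_cases hvr : v = root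
      · subst hvr; rw [hR.rep_root hv]; exact hR.mem
      · rw [hR.rep_par v hv hvr]
        exact ih _ (h ▸ hT.rk_par v hvr) _ rfl

omit hT in
-- As `rep v` is the first center met when climbing from `v`, any other center above `v` is above
-- `rep v`.
theorem below_rep {x v : V} (hx : x ∈ C) (h : Below root par v x) :
    Below root par v (rep v) ∧ Below root par (rep v) x := by
  induction h using Relation.ReflTransGen.head_induction_on with
  | refl => rw [hR.rep_center x hx]; exact ⟨.refl _, .refl _⟩
  | @head v p h hpx ih =>
    by_cases hv : v ∈ C
    · rw [hR.rep_center v hv]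
      exact ⟨.refl _, Relation.ReflTransGen.head h hpx⟩
    · rw [hR.rep_par v hv h.1, h.2]
      exact ⟨Relation.ReflTransGen.head h ih.1, ih.2⟩

theorem rep_eq_of_forall_not_mem {v : V} (h : ∀ z ∈ C, ¬ Below root par v z) : rep v = x₀ := by
  induction hn : rk v using Nat.strong_induction_on generalizing v with
  | _ n ih =>
    have hv : v ∉ C := fun hv => h v hv (.refl v)
    by_cases hvr : v = root
    · subst hvr; exact hR.rep_root hv
    · rw [hR.rep_par v hv hvr]
      exact ih _ (hn ▸ hT.rk_par v hvr) (fun z hz hb => h z hz ((below_par hvr).trans hb)) rfl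

/-- Only the class of `x₀` may contain vertices that are not below their center. -/
theorem below_rep_or (v : V) : Below root par v (rep v) ∨ rep v = x₀ := by
  by_cases h : ∃ z ∈ C, Below root par v z
  · obtain ⟨z, hz, hvz⟩ := h
    exact Or.inl (hR.below_rep hz hvz).1
  · push Not at h
    exact Or.inr (hR.rep_eq_of_forall_not_mem hT h)

include hG

/-- Around every center there is a ball of radius `r` inside its class. -/
theorem exists_ball [Finite V] {x : V} (hx : x ∈ C) :
    ∃ u, ∀ w, T.edist u w ≤ r → rep w = x := by
  obtain ⟨hlt, hor⟩ := (hG.mem_iff x).1 hx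
  obtain ⟨u, hux, hd, hfar⟩ := hG.exists_witness hT x hlt
  refine ⟨u, fun w hw => ?_⟩
  -- The ball does not leave the subtree of `x`: unless `x` is the root, `A x = r + 1`, so `u` is
  -- already at distance `r` from `x` and at distance more than `r` from `par x`.
  have hwx : Below root par w x := by
    by_contra hwx
    have hxr : x ≠ root := fun h => hwx (h ▸ hT.below_root w)
    have hA : A x = r + 1 := hor.resolve_right hxr
    have h1 := (hT.edist_split hux hwx).2
    have h2 := hT.dep_le_add_edist u (par x)
    have h3 := hT.dep_par x hxr
    have h4 : T.edist u (par x) ≤ r := le_self_add.trans (h1.trans hw)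
    have h5 := h2.trans (add_le_add_right h4 _)
    norm_cast at h5
    omega
  -- Suppose that `w` belongs to another center `rep w` below `x`. If `u` is also below `rep w`, a
  -- center there dominates `u`, contrary to the choice of `u`. If not, the way from `w` to `u`
  -- passes through `rep w`, which is too far from `u`.
  obtain ⟨hwz, hzx⟩ := hR.below_rep hx hwx
  have hz := hR.rep_mem hT w
  by_contra hne
  have hfz := hfar _ hz hzx hne
  by_cases huz : Below root par u (rep w)
  · obtain ⟨z, hzC, hzz, hdz⟩ := hG.covered_of_mem hT hz huz
    have hzx' : z ≠ x := by
      rintro rfl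
      have h1 := hT.rk_le_of_below hzz
      have h2 := hT.rk_le_of_below hzx
      have := (hzx.par_below hne).2
      have h3 := hT.rk_le_of_below this
      have h4 := hT.rk_par _ (hzx.par_below hne).1
      omega
    exact absurd hdz (not_le.2 (hfar z hzC (hzz.trans hzx) hzx'))
  · have h1 := (hT.edist_split hwz huz).1
    rw [SimpleGraph.edist_comm (u := w) (v := u), SimpleGraph.edist_comm (v := u)] at h1
    exact absurd (le_add_self.trans (h1.trans hw)) (not_le.2 hfz)

theorem meets [Finite V] {D : Finset V} (hD : IsDrDS T r D) {x : V} (hx : x ∈ C) :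
    ∃ v ∈ D, rep v = x := by
  obtain ⟨u, hu⟩ := hR.exists_ball hT hG hx
  obtain ⟨w, hw, hd⟩ := hD u
  exact ⟨w, hw, hu w hd⟩

omit hG in
-- The top of a class is its center, except that the class of `x₀` has the root as its top when the
-- root is not a center.
theorem induce_connected {x : V} (hx : x ∈ C) : (T.induce {v | rep v = x}).Connected := by
  by_cases hcase : root ∉ C ∧ x = x₀
  · obtain ⟨hroot, rfl⟩ := hcase
    refine hT.induce_connected_of_top root (hR.rep_root hroot) fun v hv hvr => ⟨hvr, ?_⟩
    -- For `v = x₀` the parent is in the class too: a center above it would have smaller rank than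
    -- `x₀`.
    by_cases hvC : v ∈ C
    · have hvx : v = x := (hR.rep_center v hvC).symm.trans hv
      subst hvx
      refine hR.rep_eq_of_forall_not_mem hT fun z hz hb => ?_
      have h1 := hT.rk_le_of_below hb
      have h2 := hR.rk_le z hz
      have h3 := hT.rk_par v hvr
      omega
    · exact (hR.rep_par v hvC hvr).symm.trans hv
  · refine hT.induce_connected_of_top x (hR.rep_center x hx) fun v hv hvx => ?_
    have hvC : v ∉ C := fun hvC => hvx ((hR.rep_center v hvC).symm.trans hv)
    have hvr : v ≠ root := by
      rintro rfl
      exact hcase ⟨hvC, (hv.symm.trans (hR.rep_root hvC))⟩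
    exact ⟨hvr, (hR.rep_par v hvC hvr).symm.trans hv⟩

theorem isCanonicalPartition [Finite V] (hac : T.IsAcyclic) :
    IsCanonicalPartition T r C rep where
  minimum := by
    refine ⟨hG.isDrDS hT, fun D hD => ?_⟩
    -- The map `rep` sends `D` onto a set that contains all centers.
    refine (Finset.card_le_card fun x hx => ?_).trans (Finset.card_image_le (s := D) (f := rep))
    obtain ⟨v, hv, h⟩ := hR.meets hT hG hD hx
    exact Finset.mem_image.2 ⟨v, hv, h⟩
  rep_mem := hR.rep_mem hT
  rep_self := hR.rep_center
  subtree x hx := ⟨hR.induce_connected hT hx, hac.induce _⟩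
  meets D hD x hx := hR.meets hT hG hD hx

/-- A token of the class of `x` may jump to `x` if all centers after `x` carry tokens. -/
theorem isDrDS_move [Finite V] {D D' : Finset V} {x y : V} (hx : x ∈ C) (hD : IsDrDS T r D)
    (hy : rep y = x) (hlater : ∀ z ∈ C, rk x ≤ rk z → z ∈ D')
    (hsub : ∀ z ∈ D, z ≠ y → z ∈ D') : IsDrDS T r D' := by
  have hxD' : x ∈ D' := hlater x hx le_rfl
  rcases hR.below_rep_or hT y with hyx | hyx
  -- The token is below `x`. Vertices below `x` are served by centers below `x`, none of which comes
  -- before `x`. For the others the way to `y` passes through `x`, so `x` serves them at least as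
  -- well.
  · rw [hy] at hyx
    intro u
    by_cases hux : Below root par u x
    · obtain ⟨z, hz, hzx, hd⟩ := hG.covered_of_mem hT hx hux
      exact ⟨z, hlater z hz (hT.rk_le_of_below hzx), hd⟩
    · obtain ⟨z, hz, hd⟩ := hD u
      by_cases hzy : z = y
      · subst hzy
        have h1 := (hT.edist_split hyx hux).1
        rw [SimpleGraph.edist_comm (u := z) (v := u), SimpleGraph.edist_comm (v := u)] at h1
        exact ⟨x, hxD', le_add_self.trans (h1.trans hd)⟩
      · exact ⟨z, hsub z hz hzy, hd⟩
  -- Otherwise `x = x₀` is the first center, so all centers carry tokens in `D'`.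
  · intro u
    obtain ⟨z, hz, hd⟩ := hG.isDrDS hT u
    refine ⟨z, hlater z hz ?_, hd⟩
    rw [← hy, hyx]
    exact hR.rk_le z hz

end IsRep

end Greedy

/-! ### Token jumping sequences -/

section TJ

variable {V : Type*} [DecidableEq V] {T : SimpleGraph V} {r : ℕ}

omit [DecidableEq V] in
theorem IsDrDS.mono {D D' : Finset V} (h : IsDrDS T r D) (hs : D ⊆ D') : IsDrDS T r D' := fun u =>
  let ⟨v, hv, hd⟩ := h u
  ⟨v, hs hv, hd⟩

namespace TJSequence

theorem isDrDS_left {D D' : Finset V} {m : List (V × V)} (h : TJSequence T r D m D') :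
    IsDrDS T r D := by
  cases h <;> assumption

theorem card_eq {D D' : Finset V} {m : List (V × V)} (h : TJSequence T r D m D') :
    D.card = D'.card := by
  induction h with
  | nil => rfl
  | @cons D D' Dt x y m _ h1 h2 _ ih =>
    rw [← ih, ← Finset.card_sdiff_add_card_inter D D', h1, ← Finset.card_sdiff_add_card_inter D' D,
      h2, Finset.inter_comm, Finset.card_singleton, Finset.card_singleton]

theorem append {D₁ D₂ D₃ : Finset V} {m m' : List (V × V)} (h : TJSequence T r D₁ m D₂)
    (h' : TJSequence T r D₂ m' D₃) : TJSequence T r D₁ (m ++ m') D₃ := by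
  induction h with
  | nil => exact h'
  | cons h0 h1 h2 _ ih => exact .cons h0 h1 h2 (ih h')

theorem reverse {D D' : Finset V} {m : List (V × V)} (h : TJSequence T r D m D') :
    TJSequence T r D' (m.reverse.map Prod.swap) D := by
  induction h with
  | nil h => exact .nil h
  | cons h0 h1 h2 h3 ih =>
    simp only [List.reverse_cons, List.map_append, List.map_cons, List.map_nil, Prod.swap_prod_mk]
    exact ih.append (.cons h3.isDrDS_left h2 h1 (.nil h0))

theorem of_insert_erase {D D' Dt : Finset V} {x y : V} {m : List (V × V)} (h : IsDrDS T r D)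
    (hx : x ∈ D) (hy : y ∉ D) (hD' : D' = insert y (D.erase x)) (h' : TJSequence T r D' m Dt) :
    TJSequence T r D ((x, y) :: m) Dt := by
  have hxy : x ≠ y := fun e => hy (e ▸ hx)
  subst hD'
  refine .cons h ?_ ?_ h'
  · ext v
    simp only [Finset.mem_sdiff, Finset.mem_insert, Finset.mem_erase, Finset.mem_singleton]
    constructor
    · tauto
    · rintro rfl; tauto
  · ext v
    simp only [Finset.mem_sdiff, Finset.mem_insert, Finset.mem_erase, Finset.mem_singleton]
    constructor
    · tauto
    · rintro rfl; tauto

/-- Above a dominating set `K`, tokens may jump freely. -/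
theorem zip {K : Finset V} (hK : IsDrDS T r K) {X : Finset V} {l l' : List V} (hKX : K ⊆ X)
    (hlK : ∀ v ∈ l, v ∉ K) (hlX : ∀ v ∈ l, v ∈ X) (hl : l.Nodup) (hlX' : ∀ v ∈ l', v ∉ X)
    (hl' : l'.Nodup) (hlen : l.length = l'.length) :
    TJSequence T r X (l.zip l') ((X \ l.toFinset) ∪ l'.toFinset) := by
  induction l generalizing X l' with
  | nil =>
    obtain rfl : l' = [] := List.length_eq_zero_iff.1 hlen.symm
    simpa using TJSequence.nil (hK.mono hKX)
  | cons x l ih =>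
    obtain _ | ⟨y, l'⟩ := l'
    · simp at hlen
    · simp only [List.nodup_cons, List.mem_cons, forall_eq_or_imp] at *
      have hyX := hlX'.1
      have hl'X := hlX'.2
      have hlX2 := hlX.2
      refine of_insert_erase (hK.mono hKX) hlX.1 hlX'.1 rfl ?_
      have := ih (X := insert y (X.erase x)) (l' := l') ?_ hlK.2 ?_ hl.2 ?_ hl'.2
        (by simpa using hlen)
      · convert this using 1
        · rfl
        ext v
        simp only [List.toFinset_cons, Finset.mem_union, Finset.mem_sdiff, Finset.mem_insert,
          List.mem_toFinset, Finset.mem_erase]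
        have : v ∈ l → v ∈ X := hlX2 v
        by_cases hvy : v = y
        · subst hvy
          tauto
        · tauto
      · intro v hv
        have : v ≠ x := fun e => hlK.1 (e ▸ hv)
        simp [this, hKX hv]
      · intro v hv
        have : v ≠ x := fun e => hl.1 (e ▸ hv)
        simp [this, hlX2 v hv]
      · intro v hv
        have h1 : v ≠ y := fun e => hl'.1 (e ▸ hv)
        simp [h1, hl'X v hv]

end TJSequence

variable {root : V} {par : V → V} {dep rk : V → ℕ} {A B : V → ℕ} {C : Finset V} {x₀ : V}
  {rep : V → V}

/-- `tok x` is a token of `D` in the class of `x`, and `x` itself if it carries a token. -/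
def IsTok (C : Finset V) (rep : V → V) (D : Finset V) (tok : V → V) : Prop :=
  ∀ x ∈ C, tok x ∈ D ∧ rep (tok x) = x ∧ (x ∈ D → tok x = x)

/-- The moves that take the tokens `tok x` to the vertices `x` of a list. -/
def pushMoves (tok : V → V) (l : List V) : List (V × V) :=
  (l.filter fun x => tok x ≠ x).map fun x => (tok x, x)

/-- The tokens of `D` not chosen by `tok`. -/
def extra (rep : V → V) (D : Finset V) (tok : V → V) : Finset V :=
  D.filter fun v => tok (rep v) ≠ v

/-- Induction over the centers still to be treated, in decreasing rank; all centers outside `l`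
already carry tokens. Since `tok x = x` whenever `x` is occupied, a jump always goes to a free
vertex. -/
theorem push_list [Finite V] (hT : IsRooted T root par dep rk) (hG : IsGreedy root par r A B C)
    (hR : IsRep root par rk C x₀ rep) {tok : V → V} (l : List V)
    (hl : l.Pairwise fun a b => rk b < rk a) (hlC : ∀ v ∈ l, v ∈ C) {D : Finset V}
    (hD : IsDrDS T r D) (hrest : ∀ z ∈ C, z ∉ l → z ∈ D)
    (hlater : ∀ x ∈ l, ∀ z ∈ C, rk x ≤ rk z → z = x ∨ z ∈ l ∨ z ∈ D)
    (hsorted : ∀ x ∈ l, ∀ z ∈ C, z ∉ l → rk x < rk z)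
    (htok : ∀ x ∈ l, tok x ∈ D ∧ rep (tok x) = x ∧ (x ∈ D → tok x = x)) :
    TJSequence T r D (pushMoves tok l) ((D \ l.toFinset.image tok) ∪ l.toFinset) := by
  induction l generalizing D with
  | nil => simpa [pushMoves] using TJSequence.nil hD
  | cons x l ih =>
    simp only [List.pairwise_cons, List.mem_cons, forall_eq_or_imp] at *
    obtain ⟨⟨hxD, hrx, hxx⟩, htok⟩ := htok
    have hxl : x ∉ l := fun h => (hl.1 x h).false
    have hnext : ∀ D' : Finset V, D' = insert x (D.erase (tok x)) →
        TJSequence T r D' (pushMoves tok l) ((D' \ l.toFinset.image tok) ∪ l.toFinset) := by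
      intro D' hD'
      have hmem : ∀ z ∈ C, z ∉ l → z ∈ D' := by
        intro z hz hzl
        rw [hD']
        by_cases hzx : z = x
        · simp [hzx]
        · have hzD := hrest z hz (by tauto)
          -- Tokens chosen for different classes differ, so the jump does not empty another center.
          have : z ≠ tok x := fun e => hzx (by rw [← hrx, ← e, hR.rep_center z hz])
          simp [this, hzD]
      refine ih hl.2 hlC.2 ?_ hmem ?_ ?_ ?_
      · refine hR.isDrDS_move hT hG hlC.1 hD hrx (fun z hz hzx => hmem z hz fun hzl => ?_) ?_
        · have := hl.1 z hzl; omega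
        · intro z hz hzy
          rw [hD']
          simp [hz, hzy]
      · intro x' hx' z hz _
        by_cases hzl : z ∈ l
        · tauto
        · exact Or.inr (Or.inr (hmem z hz hzl))
      · intro x' hx' z hz hzl
        by_cases hzx : z = x
        · rw [hzx]; exact hl.1 x' hx'
        · exact hsorted.2 x' hx' z hz (by tauto)
      · intro x' hx'
        obtain ⟨h1, h2, h3⟩ := htok x' hx'
        have hne : x' ≠ x := fun e => hxl (e ▸ hx')
        have : tok x' ≠ tok x := fun e => hne (by rw [← h2, ← hrx, e])
        rw [hD']
        refine ⟨by simp [this, h1], h2, fun h => h3 ?_⟩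
        simp only [Finset.mem_insert, Finset.mem_erase] at h
        tauto
    have hset : ∀ D' : Finset V, D' = insert x (D.erase (tok x)) →
        (D' \ l.toFinset.image tok) ∪ l.toFinset =
          (D \ (x :: l).toFinset.image tok) ∪ (x :: l).toFinset := by
      intro D' hD'
      subst hD'
      -- The center `x` lies in its own class, so it is not the chosen token of another class.
      have hx' : ∀ x' ∈ l, tok x' = x → x ∈ l := by
        intro x' hx' e
        obtain ⟨h1, h2, h3⟩ := htok x' hx'
        rw [e, hR.rep_center x hlC.1] at h2
        exact h2 ▸ hx'
      ext v
      simp only [List.toFinset_cons, Finset.image_insert, Finset.mem_union, Finset.mem_sdiff,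
        Finset.mem_insert, Finset.mem_erase, Finset.mem_image, List.mem_toFinset, not_or,
        not_exists, not_and]
      by_cases hvx : v = x
      · subst hvx
        constructor
        · tauto
        · intro _
          exact Or.inl ⟨Or.inl rfl, fun x' h1 h2 => hxl (hx' x' h1 h2)⟩
      · tauto
    by_cases hx : tok x = x
    · have hxD' : D = insert x (D.erase (tok x)) := by
        rw [hx, Finset.insert_erase (hx ▸ hxD)]
      have hm : pushMoves tok (x :: l) = pushMoves tok l := by simp [pushMoves, hx]
      rw [hm, ← hset D hxD']
      exact hnext D hxD'
    · have hm : pushMoves tok (x :: l) = (tok x, x) :: pushMoves tok l := by simp [pushMoves, hx]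
      rw [hm, ← hset _ rfl]
      exact .of_insert_erase hD hxD (fun h => hx (hxx h)) rfl (hnext _ rfl)

theorem push_centers [Finite V] (hT : IsRooted T root par dep rk)
    (hG : IsGreedy root par r A B C) (hR : IsRep root par rk C x₀ rep) {tok : V → V} (l : List V)
    (hl : l.Pairwise fun a b => rk b < rk a) (hlC : ∀ v, v ∈ l ↔ v ∈ C) {D : Finset V}
    (hD : IsDrDS T r D) (htok : IsTok C rep D tok) :
    TJSequence T r D (pushMoves tok l) (extra rep D tok ∪ C) := by
  have := push_list hT hG hR l hl (fun v => (hlC v).1) hD (fun z hz hzl => absurd ((hlC z).2 hz) hzl)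
    (fun _ _ z hz _ => Or.inr (Or.inl ((hlC z).2 hz)))
    (fun _ _ z hz hzl => absurd ((hlC z).2 hz) hzl) fun x hx => htok x ((hlC x).1 hx)
  convert this using 1
  have hC : l.toFinset = C := by ext; simp [hlC]
  rw [hC]
  congr 1
  ext v
  simp only [extra, Finset.mem_filter, Finset.mem_sdiff, Finset.mem_image, not_exists, not_and]
  -- A token can only be chosen for its own class, so being unchosen is tested at `rep v` alone.
  refine and_congr_right fun hv => ⟨fun h x hx e => h ?_, fun h e => h _ (hR.rep_mem hT v) e⟩
  rw [← e, (htok x hx).2.1]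

/-- The moves of the whole sequence. -/
def allMoves (rep : V → V) (toks tokt : V → V) (Ds Dt : Finset V) (centers verts : List V) :
    List (V × V) :=
  pushMoves toks centers.reverse ++
    ((verts.filter fun v => v ∈ extra rep Ds toks ∧ v ∉ extra rep Dt tokt).zip
      (verts.filter fun v => v ∈ extra rep Dt tokt ∧ v ∉ extra rep Ds toks)) ++
    (centers.filter fun x => tokt x ≠ x).map fun x => (x, tokt x)

/-- No counting is needed: pushing the tokens to the centers is a jumping sequence that ends in the
disjoint union of the extra tokens and the centers, and jumps preserve cardinality. -/
theorem card_extra_add [Finite V] (hT : IsRooted T root par dep rk)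
    (hG : IsGreedy root par r A B C) (hR : IsRep root par rk C x₀ rep) {tok : V → V} (l : List V)
    (hl : l.Pairwise fun a b => rk a < rk b) (hlC : ∀ v, v ∈ l ↔ v ∈ C) {D : Finset V}
    (hD : IsDrDS T r D) (htok : IsTok C rep D tok) :
    Disjoint (extra rep D tok) C ∧ (extra rep D tok).card + C.card = D.card := by
  have hdis : Disjoint (extra rep D tok) C := by
    rw [Finset.disjoint_left]
    intro v hv hvC
    simp only [extra, Finset.mem_filter] at hv
    rw [hR.rep_center v hvC] at hv
    exact hv.2 ((htok v hvC).2.2 hv.1)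
  refine ⟨hdis, ?_⟩
  rw [← Finset.card_union_of_disjoint hdis]
  exact (push_centers hT hG hR l.reverse (by rwa [List.pairwise_reverse]) (by simpa using hlC)
    hD htok).card_eq.symm

/-- Equal sizes leave equally many extra tokens on both sides, hence equally many outside the common
ones. So zipping the two lists loses nothing. -/
theorem length_filter_extra [Finite V] (hT : IsRooted T root par dep rk)
    (hG : IsGreedy root par r A B C) (hR : IsRep root par rk C x₀ rep) {toks tokt : V → V}
    (l : List V) (hl : l.Pairwise fun a b => rk a < rk b) (hlC : ∀ v, v ∈ l ↔ v ∈ C)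
    {Ds Dt : Finset V} (hDs : IsDrDS T r Ds) (hDt : IsDrDS T r Dt) (htoks : IsTok C rep Ds toks)
    (htokt : IsTok C rep Dt tokt) (hcard : Ds.card = Dt.card) (verts : List V)
    (hv : verts.Nodup) (hmem : ∀ v, v ∈ verts) :
    (verts.filter fun v => v ∈ extra rep Ds toks ∧ v ∉ extra rep Dt tokt).length =
      (verts.filter fun v => v ∈ extra rep Dt tokt ∧ v ∉ extra rep Ds toks).length := by
  have h1 := (card_extra_add hT hG hR l hl hlC hDs htoks).2
  have h2 := (card_extra_add hT hG hR l hl hlC hDt htokt).2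
  have key : ∀ E E' : Finset V, (verts.filter fun v => v ∈ E ∧ v ∉ E').length = (E \ E').card := by
    intro E E'
    rw [← List.toFinset_card_of_nodup (hv.filter _)]
    congr 1
    ext v
    simp [hmem]
  rw [key, key]
  have h3 := Finset.card_sdiff_add_card_inter (extra rep Ds toks) (extra rep Dt tokt)
  have h4 := Finset.card_sdiff_add_card_inter (extra rep Dt tokt) (extra rep Ds toks)
  rw [Finset.inter_comm] at h4
  omega

/-- The set of all centers, together with the extra tokens, is the meeting point. The last part of
the moves reverses a push, so it runs through the centers by increasing rank. -/
theorem tjSequence_allMoves [Finite V] (hT : IsRooted T root par dep rk)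
    (hG : IsGreedy root par r A B C) (hR : IsRep root par rk C x₀ rep) {toks tokt : V → V}
    (l : List V) (hl : l.Pairwise fun a b => rk a < rk b) (hlC : ∀ v, v ∈ l ↔ v ∈ C)
    {Ds Dt : Finset V} (hDs : IsDrDS T r Ds) (hDt : IsDrDS T r Dt) (htoks : IsTok C rep Ds toks)
    (htokt : IsTok C rep Dt tokt) (hcard : Ds.card = Dt.card) (verts : List V)
    (hv : verts.Nodup) (hmem : ∀ v, v ∈ verts) :
    TJSequence T r Ds (allMoves rep toks tokt Ds Dt l verts) Dt := by
  have hlr : l.reverse.Pairwise fun a b => rk b < rk a := by rwa [List.pairwise_reverse]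
  have hs := push_centers hT hG hR l.reverse hlr (by simpa using hlC) hDs htoks
  have ht := (push_centers hT hG hR l.reverse hlr (by simpa using hlC) hDt htokt).reverse
  have hds := Finset.disjoint_left.1 (card_extra_add hT hG hR l hl hlC hDs htoks).1
  have hdt := Finset.disjoint_left.1 (card_extra_add hT hG hR l hl hlC hDt htokt).1
  have hlen := length_filter_extra hT hG hR l hl hlC hDs hDt htoks htokt hcard verts hv hmem
  refine (hs.append ?_).append (m' := _) (D₂ := extra rep Dt tokt ∪ C) ?_
  · have := TJSequence.zip (hG.isDrDS hT) (X := extra rep Ds toks ∪ C)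
      (l := verts.filter fun v => v ∈ extra rep Ds toks ∧ v ∉ extra rep Dt tokt)
      (l' := verts.filter fun v => v ∈ extra rep Dt tokt ∧ v ∉ extra rep Ds toks)
      Finset.subset_union_right ?_ ?_ (hv.filter _) ?_ (hv.filter _) hlen
    · convert this using 1
      ext v
      have h1 : v ∈ extra rep Ds toks → v ∉ C := @hds v
      have h2 : v ∈ extra rep Dt tokt → v ∉ C := @hdt v
      simp only [Finset.mem_union, Finset.mem_sdiff, List.mem_toFinset, List.mem_filter, hmem,
        true_and, decide_eq_true_eq]
      tauto
    · intro v hv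
      simp only [List.mem_filter, decide_eq_true_eq] at hv
      exact hds hv.2.1
    · intro v hv
      simp only [List.mem_filter, decide_eq_true_eq] at hv
      simp [hv.2.1]
    · intro v hv
      simp only [List.mem_filter, decide_eq_true_eq] at hv
      simp [hv.2.2, hdt hv.2.1]
  · convert ht using 1
    simp [pushMoves, List.filter_reverse, ← List.map_reverse, Function.comp_def]

end TJ

/-! ### Breadth-first search -/

section Search

variable {V : Type*} [DecidableEq V]

/-- The state of a breadth-first search: the vertices visited so far and their parents. -/
structure Queue (V : Type*) where
  order : List V
  par : V → V

/-- Look at the neighbour `w` of `u`. -/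
def Queue.visit (u : V) (Q : Queue V) (w : V) : Queue V :=
  if w ∈ Q.order then Q else ⟨Q.order ++ [w], Function.update Q.par w u⟩

/-- The state of the search after the neighbours of the first `h` vertices were visited. -/
def search (adj : V → List V) (root : V) : ℕ → Queue V
  | 0 => ⟨[root], fun _ => root⟩
  | h + 1 =>
    match (search adj root h).order[h]? with
    | none => search adj root h
    | some u => (adj u).foldl (Queue.visit u) (search adj root h)

/-- The position in the visiting order will serve as the rank; `par_mem` says that parents are
adjacent to their children and come earlier. -/
structure Queue.Valid (adj : V → List V) (root : V) (Q : Queue V) : Prop where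
  nodup : Q.order.Nodup
  root_mem : root ∈ Q.order
  par_root : Q.par root = root
  par_mem : ∀ v ∈ Q.order, v ≠ root → Q.par v ∈ Q.order ∧
    Q.order.idxOf (Q.par v) < Q.order.idxOf v ∧ v ∈ adj (Q.par v)

variable {adj : V → List V} {root : V}

theorem Queue.prefix_visit (u : V) (Q : Queue V) (w : V) : Q.order <+: (Q.visit u w).order := by
  unfold Queue.visit
  split_ifs
  · exact List.prefix_rfl
  · exact List.prefix_append _ _

theorem Queue.mem_visit (u : V) (Q : Queue V) (w : V) : w ∈ (Q.visit u w).order := by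
  unfold Queue.visit
  split_ifs with h <;> simp [h]

theorem Queue.prefix_foldl (u : V) (l : List V) (Q : Queue V) :
    Q.order <+: (l.foldl (Queue.visit u) Q).order := by
  induction l generalizing Q with
  | nil => exact List.prefix_rfl
  | cons w l ih => exact (Q.prefix_visit u w).trans (ih _)

theorem Queue.subset_foldl (u : V) (l : List V) (Q : Queue V) :
    ∀ w ∈ l, w ∈ (l.foldl (Queue.visit u) Q).order := by
  induction l generalizing Q with
  | nil => simp
  | cons w l ih =>
    intro w' hw'
    rcases List.mem_cons.1 hw' with rfl | h
    · exact (prefix_foldl u l _).subset (Q.mem_visit u w')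
    · exact ih _ w' h

theorem Queue.Valid.visit {Q : Queue V} (hQ : Q.Valid adj root) {u w : V} (hu : u ∈ Q.order)
    (hw : w ∈ adj u) : (Q.visit u w).Valid adj root := by
  unfold Queue.visit
  split_ifs with h
  · exact hQ
  · have hne : ∀ v ∈ Q.order, v ≠ w := fun v hv e => h (e ▸ hv)
    refine ⟨?_, by simp [hQ.root_mem], ?_, fun v hv hvr => ?_⟩
    · simpa [List.nodup_append, hQ.nodup] using fun a ha => (hne a ha)
    · simp [Function.update_of_ne (hne _ hQ.root_mem), hQ.par_root]
    · dsimp only at hv ⊢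
      rcases List.mem_append.1 hv with hv | hv
      · obtain ⟨h1, h2, h3⟩ := hQ.par_mem v hv hvr
        rw [Function.update_of_ne (hne v hv), List.idxOf_append_of_mem h1,
          List.idxOf_append_of_mem hv]
        exact ⟨List.mem_append_left _ h1, h2, h3⟩
      · obtain rfl := List.mem_singleton.1 hv
        simp only [Function.update_self]
        rw [List.idxOf_append_of_mem hu, List.idxOf_append_of_notMem h]
        exact ⟨List.mem_append_left _ hu, Nat.lt_add_right _ (List.idxOf_lt_length_of_mem hu), hw⟩

theorem Queue.Valid.foldl {Q : Queue V} (hQ : Q.Valid adj root) {u : V} (hu : u ∈ Q.order)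
    (l : List V) (hl : ∀ w ∈ l, w ∈ adj u) : (l.foldl (Queue.visit u) Q).Valid adj root := by
  induction l generalizing Q with
  | nil => exact hQ
  | cons w l ih =>
    exact ih (hQ.visit hu (hl w List.mem_cons_self)) ((Q.prefix_visit u w).subset hu)
      fun w' h => hl w' (List.mem_cons_of_mem _ h)

theorem search_succ_of_some {h : ℕ} {u : V} (hu : (search adj root h).order[h]? = some u) :
    search adj root (h + 1) = (adj u).foldl (Queue.visit u) (search adj root h) := by
  rw [search, hu]

theorem search_succ_of_none {h : ℕ} (hu : (search adj root h).order[h]? = none) :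
    search adj root (h + 1) = search adj root h := by
  rw [search, hu]

theorem search_prefix_succ (h : ℕ) :
    (search adj root h).order <+: (search adj root (h + 1)).order := by
  cases hu : (search adj root h).order[h]? with
  | none => rw [search_succ_of_none hu]
  | some u => rw [search_succ_of_some hu]; exact Queue.prefix_foldl _ _ _

theorem search_prefix {h k : ℕ} (hk : h ≤ k) :
    (search adj root h).order <+: (search adj root k).order := by
  induction hk with
  | refl => exact List.prefix_rfl
  | step _ ih => exact ih.trans (search_prefix_succ _)

theorem search_valid (h : ℕ) : (search adj root h).Valid adj root := by
  induction h with
  | zero => exact ⟨by simp [search], by simp [search], rfl, by simp +contextual [search]⟩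
  | succ h ih =>
    cases hu : (search adj root h).order[h]? with
    | none => rwa [search_succ_of_none hu]
    | some u =>
      rw [search_succ_of_some hu]
      exact ih.foldl (List.mem_of_getElem? hu) _ fun _ h => h

theorem search_eq_of_length_le {h k : ℕ} (hk : h ≤ k) (hl : (search adj root h).order.length ≤ h) :
    search adj root k = search adj root h := by
  induction hk with
  | refl => rfl
  | @step m hm ih =>
    rw [search_succ_of_none, ih]
    rw [ih]
    exact List.getElem?_eq_none (hl.trans hm)

/-- The queue is only extended at its end, so a vertex keeps its position and its neighbours stay in
the queue once it has been processed. -/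
theorem search_closed (h i : ℕ) (hi : i < h) (v : V) (hv : (search adj root h).order[i]? = some v) :
    ∀ w ∈ adj v, w ∈ (search adj root h).order := by
  induction h with
  | zero => omega
  | succ h ih =>
    cases hu : (search adj root h).order[h]? with
    | none =>
      rw [search_succ_of_none hu] at hv ⊢
      have hlt := (List.getElem?_eq_some_iff.1 hv).1
      have hle := List.getElem?_eq_none_iff.1 hu
      exact ih (by omega) hv
    | some u =>
      have hlt := (List.getElem?_eq_some_iff.1 hu).1
      have hp := search_prefix_succ (adj := adj) (root := root) h
      have e : (search adj root (h + 1)).order[i]? = (search adj root h).order[i]? := by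
        obtain ⟨t, ht⟩ := hp
        rw [← ht, List.getElem?_append_left (by omega)]
      rw [e] at hv
      by_cases hih : i = h
      · subst hih
        rw [hu, Option.some_inj] at hv
        subst hv
        rw [search_succ_of_some hu]
        exact Queue.subset_foldl _ _ _
      · exact fun w hw => hp.subset (ih (by omega) hv w hw)

variable [Fintype V]

theorem search_length_le (h : ℕ) : (search adj root h).order.length ≤ Fintype.card V :=
  (search_valid h).nodup.length_le_card

variable {T : SimpleGraph V}

/-- The queue has no repetitions, so after `Fintype.card V` rounds all of it has been processed. The
visited set is then closed under adjacency and contains the root. -/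
theorem mem_search (hT : T.Connected) (hadj : ∀ v w, w ∈ adj v ↔ T.Adj v w) (v : V) :
    v ∈ (search adj root (Fintype.card V)).order := by
  obtain ⟨p⟩ := hT.preconnected root v
  suffices ∀ {a b : V} (p : T.Walk a b), a ∈ (search adj root (Fintype.card V)).order →
      b ∈ (search adj root (Fintype.card V)).order from this p (search_valid _).root_mem
  intro a b p
  induction p with
  | nil => exact id
  | cons h p ih =>
    intro ha
    obtain ⟨i, hi, hia⟩ := List.getElem_of_mem ha
    exact ih (search_closed _ i (hi.trans_le (search_length_le _)) _
      (List.getElem?_eq_some_iff.2 ⟨hi, hia⟩) _ ((hadj _ _).2 h))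

theorem length_search (hT : T.Connected) (hadj : ∀ v w, w ∈ adj v ↔ T.Adj v w) :
    (search adj root (Fintype.card V)).order.length = Fintype.card V := by
  rw [← List.toFinset_card_of_nodup (search_valid _).nodup, ← Finset.card_univ]
  congr 1
  ext v
  simp [mem_search hT hadj]

/-- By counting: the edges from the non-root vertices to their parents are distinct, because the
rank decreases towards the parent. Their number is the number of edges of a tree, so there are no
others. -/
theorem adj_iff_par (hT : T.IsTree) {par : V → V} {rk : V → ℕ}
    (hpar : ∀ v, v ≠ root → T.Adj v (par v)) (hroot : par root = root)
    (hrk : ∀ v, v ≠ root → rk (par v) < rk v) (u v : V) :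
    T.Adj u v ↔ u ≠ v ∧ (par u = v ∨ par v = u) := by
  classical
  have himg : (Finset.univ.erase root).image (fun v => s(v, par v)) = T.edgeFinset := by
    refine Finset.eq_of_subset_of_card_le ?_ ?_
    · intro e he
      obtain ⟨v, hv, rfl⟩ := Finset.mem_image.1 he
      simpa using hpar v (Finset.ne_of_mem_erase hv)
    · rw [Finset.card_image_of_injOn, Finset.card_erase_of_mem (Finset.mem_univ _),
        Finset.card_univ, ← hT.card_edgeFinset, Nat.add_sub_cancel]
      intro v hv w hw h
      simp only [Sym2.eq_iff] at h
      rcases h with h | ⟨h1, h2⟩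
      · exact h.1
      · have h3 := hrk v (by simpa using hv)
        have h4 := hrk w (by simpa using hw)
        rw [h2] at h3
        rw [← h1] at h4
        omega
  constructor
  · intro h
    refine ⟨h.ne, ?_⟩
    have he : s(u, v) ∈ T.edgeFinset := by simpa using h
    rw [← himg] at he
    obtain ⟨w, -, he⟩ := Finset.mem_image.1 he
    clear h
    rcases Sym2.eq_iff.1 he with ⟨rfl, h⟩ | ⟨rfl, h⟩
    · exact Or.inl h
    · exact Or.inr h
  · rintro ⟨hne, rfl | rfl⟩
    · exact hpar u fun h => hne (by rw [h, hroot])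
    · exact (hpar v fun h => hne (by rw [h, hroot])).symm

theorem search_isRooted (hT : T.IsTree) (hadj : ∀ v w, w ∈ adj v ↔ T.Adj v w) :
    ∃ dep : V → ℕ, IsRooted T root (search adj root (Fintype.card V)).par dep
      (fun v => (search adj root (Fintype.card V)).order.idxOf v) := by
  set Q := search adj root (Fintype.card V) with hQ
  have hv : Q.Valid adj root := search_valid _
  have hpm : ∀ v, v ≠ root → _ := fun v => hv.par_mem v (mem_search hT.connected hadj v)
  have hex : ∀ v, ∃ k, Q.par^[k] v = root := by
    intro v
    induction h : Q.order.idxOf v using Nat.strong_induction_on generalizing v with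
    | _ m ih =>
      by_cases hvr : v = root
      · exact ⟨0, hvr⟩
      · obtain ⟨k, hk⟩ := ih _ (h ▸ (hpm v hvr).2.1) _ rfl
        exact ⟨k + 1, hk⟩
  -- The depth is the least number of parent steps to the root.
  refine ⟨fun v => Nat.find (hex v), hv.par_root, fun v hvr => ?_, fun v hvr => (hpm v hvr).2.1,
    adj_iff_par (rk := fun v => Q.order.idxOf v) hT (fun v hvr => ((hadj _ _).1 (hpm v hvr).2.2).symm) hv.par_root
      fun v hvr => (hpm v hvr).2.1⟩
  exact Nat.find_comp_succ (hex v) (hex (Q.par v)) hvr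

end Search

/-! ### The dynamic program -/

section Select

variable {V : Type*} [DecidableEq V]

/-- The state of the dynamic program. -/
structure Selection (V : Type*) where
  need : V → ℕ
  slack : V → ℕ
  centers : Finset V
  first : V

/-- `v` becomes a center. -/
def Selection.Chosen (root : V) (r : ℕ) (S : Selection V) (v : V) : Prop :=
  S.slack v < S.need v ∧ (S.need v = r + 1 ∨ v = root)

instance (root : V) (r : ℕ) (S : Selection V) (v : V) : Decidable (S.Chosen root r v) :=
  inferInstanceAs (Decidable (_ ∧ _))

/-- Decide on `v`. -/
def Selection.decide (root : V) (r : ℕ) (v : V) (S : Selection V) : Selection V :=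
  if S.Chosen root r v then { S with centers := insert v S.centers, first := v } else S

/-- What `v` reports to its parent about its need. -/
def Selection.needMsg (S : Selection V) (v : V) : ℕ :=
  if needOut S.need S.slack S.centers v = 0 then 0 else needOut S.need S.slack S.centers v + 1

/-- Report from `v` to its parent. -/
def Selection.push (root : V) (par : V → V) (r : ℕ) (v : V) (S : Selection V) : Selection V :=
  if v = root then S else
    { S with
      need := Function.update S.need (par v) (max (S.need (par v)) (S.needMsg v))
      slack := Function.update S.slack (par v)
        (max (S.slack (par v)) (slackOut r S.slack S.centers v - 1)) }

/-- The dynamic program on a list of vertices, from the last to the first. -/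
def select (root : V) (par : V → V) (r : ℕ) (l : List V) : Selection V :=
  l.foldr (fun v S => (S.decide root r v).push root par r v) ⟨fun _ => 1, fun _ => 0, ∅, root⟩

/-- The equations of `IsGreedy` at a moment when only the vertices of `l` have decided and reported.
-/
structure Selection.Valid (root : V) (par : V → V) (rk : V → ℕ) (r : ℕ) (l : List V)
    (S : Selection V) : Prop where
  one_le : ∀ v, 1 ≤ S.need v
  need_par : ∀ c ∈ l, c ≠ root → needOut S.need S.slack S.centers c ≠ 0 →
    needOut S.need S.slack S.centers c + 1 ≤ S.need (par c)
  need_att : ∀ v, S.need v = 1 ∨ ∃ c ∈ l, c ≠ root ∧ par c = v ∧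
    needOut S.need S.slack S.centers c ≠ 0 ∧
    S.need v = needOut S.need S.slack S.centers c + 1
  slack_par : ∀ c ∈ l, c ≠ root → slackOut r S.slack S.centers c ≤ S.slack (par c) + 1
  slack_att : ∀ v, S.slack v = 0 ∨ ∃ c ∈ l, c ≠ root ∧ par c = v ∧
    S.slack v + 1 = slackOut r S.slack S.centers c
  mem_iff : ∀ v, v ∈ S.centers ↔ v ∈ l ∧ S.Chosen root r v
  first_mem : S.centers.Nonempty → S.first ∈ S.centers
  first_le : ∀ z ∈ S.centers, rk S.first ≤ rk z

/-- The report of `v` changes only the values at `par v`, which has not decided yet. So the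
decisions and messages of all processed vertices stay as they were. -/
theorem Selection.Valid.step {root : V} {par : V → V} {rk : V → ℕ} {r : ℕ} {l : List V}
    {S : Selection V} (hS : S.Valid root par rk r l) {v : V} (hv : ∀ w ∈ l, rk v < rk w)
    (hpar : v ≠ root → rk (par v) < rk v) :
    ((S.decide root r v).push root par r v).Valid root par rk r (v :: l) := by
  set S' := (S.decide root r v).push root par r v with hS'
  have hvl : v ∉ l := fun h => (hv v h).false
  have hdec : (S.decide root r v).need = S.need ∧ (S.decide root r v).slack = S.slack := by
    unfold Selection.decide
    split_ifs <;> exact ⟨rfl, rfl⟩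
  have hc : S'.centers = (S.decide root r v).centers := by
    rw [hS', Selection.push]
    split_ifs <;> rfl
  have hcen : ∀ c, c ∈ S'.centers ↔ c ∈ S.centers ∨ (c = v ∧ S.Chosen root r v) := by
    intro c
    rw [hc, Selection.decide]
    split_ifs with h <;> simp [h]
    tauto
  have hvC : v ∉ S.centers := fun h => hvl ((hS.mem_iff v).1 h).1
  -- The rank of the parent is below the ranks of all processed vertices.
  have hpl : v ≠ root → ∀ c ∈ v :: l, c ≠ par v := by
    intro h c hc e
    have h1 := hpar h
    rcases List.mem_cons.1 hc with rfl | hc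
    · rw [← e] at h1; omega
    · have := hv c hc; rw [e] at this; omega
  have hneed : ∀ w, S'.need w = if v ≠ root ∧ w = par v then
      max (S.need w) ((S.decide root r v).needMsg v) else S.need w := by
    intro w
    rw [hS', Selection.push, ← hdec.1]
    by_cases h : v = root
    · simp [h]
    · by_cases hw : w = par v
      · subst hw; simp [h]
      · simp [h, hw]
  have hslack : ∀ w, S'.slack w = if v ≠ root ∧ w = par v then
      max (S.slack w) (slackOut r S.slack S'.centers v - 1) else S.slack w := by
    intro w
    rw [hc, hS', Selection.push, ← hdec.2]
    by_cases h : v = root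
    · simp [h]
    · by_cases hw : w = par v
      · subst hw; simp [h]
      · simp [h, hw]
  have hneedl : ∀ c ∈ v :: l, S'.need c = S.need c := by
    intro c hc
    rw [hneed, if_neg]
    exact fun h => hpl h.1 c hc h.2
  have hslackl : ∀ c ∈ v :: l, S'.slack c = S.slack c := by
    intro c hc
    rw [hslack, if_neg]
    exact fun h => hpl h.1 c hc h.2
  have hmsg : (S.decide root r v).needMsg v =
      if needOut S'.need S'.slack S'.centers v = 0 then 0
        else needOut S'.need S'.slack S'.centers v + 1 := by
    rw [hc]
    simp only [Selection.needMsg, needOut, hdec.1, hdec.2, hneedl v List.mem_cons_self,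
      hslackl v List.mem_cons_self]
  have hsv : slackOut r S.slack S'.centers v = slackOut r S'.slack S'.centers v := by
    simp only [slackOut, hslackl v List.mem_cons_self]
  rw [hmsg] at hneed
  rw [hsv] at hslack
  have hcl : ∀ c ∈ l, (c ∈ S'.centers ↔ c ∈ S.centers) := by
    intro c hc
    have : c ≠ v := fun e => hvl (e ▸ hc)
    simp [hcen, this]
  have hno : ∀ c ∈ l, needOut S'.need S'.slack S'.centers c = needOut S.need S.slack S.centers c := by
    intro c hc
    simp only [needOut, hcl c hc, hneedl c (List.mem_cons_of_mem _ hc),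
      hslackl c (List.mem_cons_of_mem _ hc)]
  have hso : ∀ c ∈ l, slackOut r S'.slack S'.centers c = slackOut r S.slack S.centers c := by
    intro c hc
    simp only [slackOut, hcl c hc, hslackl c (List.mem_cons_of_mem _ hc)]
  have hneedle : ∀ w, S.need w ≤ S'.need w := by
    intro w
    rw [hneed]
    split_ifs <;> simp
  have hslackle : ∀ w, S.slack w ≤ S'.slack w := by
    intro w
    rw [hslack]
    split_ifs <;> simp
  have hfirst : S'.first = if S.Chosen root r v then v else S.first := by
    rw [hS', Selection.push, Selection.decide]
    split_ifs <;> rfl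
  clear_value S'
  refine ⟨fun w => (hS.one_le w).trans (hneedle w), ?_, ?_, ?_, ?_, ?_, ?_, ?_⟩
  · intro c hc hcr h0
    rcases List.mem_cons.1 hc with rfl | hc
    · rw [hneed (par c), if_pos ⟨hcr, rfl⟩, if_neg h0]
      exact le_max_right _ _
    · rw [hno c hc] at h0 ⊢
      exact (hS.need_par c hc hcr h0).trans (hneedle _)
  · intro w
    have hold : S'.need w = S.need w → S'.need w = 1 ∨ ∃ c ∈ v :: l, c ≠ root ∧ par c = w ∧
        needOut S'.need S'.slack S'.centers c ≠ 0 ∧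
        S'.need w = needOut S'.need S'.slack S'.centers c + 1 := by
      intro h
      rcases hS.need_att w with h1 | ⟨c, hc, h1, h2, h3, h4⟩
      · exact Or.inl (h.trans h1)
      · refine Or.inr ⟨c, List.mem_cons_of_mem _ hc, h1, h2, ?_⟩
        rw [hno c hc, h]
        exact ⟨h3, h4⟩
    by_cases hw : v ≠ root ∧ w = par v
    · have h := hneed w
      rw [if_pos hw] at h
      by_cases h0 : needOut S'.need S'.slack S'.centers v = 0
      · rw [if_pos h0] at h
        exact hold (by simpa using h)
      · rw [if_neg h0] at h
        rcases max_choice (S.need w) (needOut S'.need S'.slack S'.centers v + 1) with h1 | h1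
        · exact hold (h.trans h1)
        · exact Or.inr ⟨v, List.mem_cons_self, hw.1, hw.2.symm, h0, h.trans h1⟩
    · exact hold (by rw [hneed, if_neg hw])
  · intro c hc hcr
    rcases List.mem_cons.1 hc with rfl | hc
    · rw [hslack (par c), if_pos ⟨hcr, rfl⟩]
      omega
    · rw [hso c hc]
      exact (hS.slack_par c hc hcr).trans (Nat.add_le_add_right (hslackle _) 1)
  · intro w
    have hold : S'.slack w = S.slack w → S'.slack w = 0 ∨ ∃ c ∈ v :: l, c ≠ root ∧ par c = w ∧
        S'.slack w + 1 = slackOut r S'.slack S'.centers c := by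
      intro h
      rcases hS.slack_att w with h1 | ⟨c, hc, h1, h2, h3⟩
      · exact Or.inl (h.trans h1)
      · refine Or.inr ⟨c, List.mem_cons_of_mem _ hc, h1, h2, ?_⟩
        rw [hso c hc, h]
        exact h3
    by_cases hw : v ≠ root ∧ w = par v
    · have h := hslack w
      rw [if_pos hw] at h
      rcases max_choice (S.slack w) (slackOut r S'.slack S'.centers v - 1) with h1 | h1
      · exact hold (h.trans h1)
      · by_cases h0 : S'.slack w = 0
        · exact Or.inl h0
        · exact Or.inr ⟨v, List.mem_cons_self, hw.1, hw.2.symm, by omega⟩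
    · exact hold (by rw [hslack, if_neg hw])
  · intro c
    rw [hcen, hS.mem_iff]
    constructor
    · rintro (⟨h1, h2⟩ | ⟨rfl, h⟩)
      · refine ⟨List.mem_cons_of_mem _ h1, ?_⟩
        simpa only [Selection.Chosen, hneedl c (List.mem_cons_of_mem _ h1),
          hslackl c (List.mem_cons_of_mem _ h1)] using h2
      · refine ⟨List.mem_cons_self, ?_⟩
        simpa only [Selection.Chosen, hneedl c List.mem_cons_self,
          hslackl c List.mem_cons_self] using h
    · rintro ⟨h1, h2⟩
      simp only [Selection.Chosen, hneedl c h1, hslackl c h1] at h2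
      rcases List.mem_cons.1 h1 with rfl | h1
      · exact Or.inr ⟨rfl, h2⟩
      · exact Or.inl ⟨h1, h2⟩
  · intro hne
    by_cases h : S.Chosen root r v
    · rw [hfirst, if_pos h, hcen]
      exact Or.inr ⟨rfl, h⟩
    · rw [hfirst, if_neg h, hcen]
      obtain ⟨c, hc⟩ := hne
      rw [hcen] at hc
      exact Or.inl (hS.first_mem ⟨c, hc.resolve_right fun h' => h h'.2⟩)
  · intro z hz
    rw [hcen] at hz
    rw [hfirst]
    split_ifs with h
    · rcases hz with hz | hz
      · exact (hv z ((hS.mem_iff z).1 hz).1).le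
      · rw [hz.1]
    · exact hS.first_le z (hz.resolve_right fun h' => h h'.2)

theorem select_valid {root : V} {par : V → V} {rk : V → ℕ} {r : ℕ} (l : List V)
    (hl : l.Pairwise fun a b => rk a < rk b) (hpar : ∀ v ≠ root, rk (par v) < rk v) :
    (select root par r l).Valid root par rk r l := by
  induction l with
  | nil => exact ⟨by simp [select], by simp, by simp [select], by simp, by simp [select],
      by simp [select], by simp [select], by simp [select]⟩
  | cons v l ih =>
    rw [List.pairwise_cons] at hl
    exact (ih hl.2).step hl.1 (hpar v)

theorem select_isGreedy {root : V} {par : V → V} {rk : V → ℕ} {r : ℕ} {l : List V}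
    (hl : l.Pairwise fun a b => rk a < rk b) (hpar : ∀ v ≠ root, rk (par v) < rk v)
    (hmem : ∀ v, v ∈ l) :
    IsGreedy root par r (select root par r l).need (select root par r l).slack
      (select root par r l).centers := by
  have h := select_valid (r := r) l hl hpar
  refine ⟨h.one_le, fun c => h.need_par c (hmem c), fun v => ?_, fun c => h.slack_par c (hmem c),
    fun v => ?_, fun v => ?_⟩
  · rcases h.need_att v with h | ⟨c, _, h⟩
    · exact Or.inl h
    · exact Or.inr ⟨c, h⟩
  · rcases h.slack_att v with h | ⟨c, _, h⟩
    · exact Or.inl h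
    · exact Or.inr ⟨c, h⟩
  · rw [h.mem_iff, and_iff_right (hmem v)]
    rfl

/-- Climb along the parents until a center or the root is met; at a root that is no center, take
`x₀`. -/
theorem exists_isRep {T : SimpleGraph V} {root : V} {par : V → V} {dep rk : V → ℕ} {C : Finset V}
    {x₀ : V} (hT : IsRooted T root par dep rk) (h₀ : x₀ ∈ C) (hle : ∀ z ∈ C, rk x₀ ≤ rk z) :
    ∃ rep, IsRep root par rk C x₀ rep := by
  have hex : ∀ v, ∃ k, par^[k] v ∈ C ∨ par^[k] v = root := by
    intro v
    induction h : rk v using Nat.strong_induction_on generalizing v with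
    | _ m ih =>
      by_cases hvr : v = root
      · exact ⟨0, Or.inr hvr⟩
      · obtain ⟨k, hk⟩ := ih _ (h ▸ hT.rk_par v hvr) _ rfl
        exact ⟨k + 1, hk⟩
  have h0 : ∀ v, v ∈ C ∨ v = root → par^[Nat.find (hex v)] v = v := by
    intro v hv
    rw [(Nat.find_eq_zero (hex v)).2 hv, Function.iterate_zero, id]
  refine ⟨fun v => if par^[Nat.find (hex v)] v ∈ C then par^[Nat.find (hex v)] v else x₀,
    h₀, hle, fun v hv => ?_, fun v hv hvr => ?_, fun hr => ?_⟩
  · simp only [h0 v (Or.inl hv), hv, if_true]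
  · have : Nat.find (hex v) = Nat.find (hex (par v)) + 1 :=
      Nat.find_comp_succ (hex v) (hex (par v)) (by simp [hv, hvr])
    simp only [this, Function.iterate_succ_apply]
  · simp only [h0 root (Or.inr rfl), hr, if_false]

end Select

/-! ### Reading lists from memory -/

/-- The cells of `f` from `p` on contain the list `l`. -/
def Reads (f : ℕ → ℕ) : ℕ → List ℕ → Prop
  | _, [] => True
  | p, x :: l => f p = x ∧ Reads f (p + 1) l

theorem reads_append {f : ℕ → ℕ} {p : ℕ} {l l' : List ℕ} :
    Reads f p (l ++ l') ↔ Reads f p l ∧ Reads f (p + l.length) l' := by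
  induction l generalizing p with
  | nil => simp [Reads]
  | cons x l ih =>
    simp only [List.cons_append, Reads, ih, and_assoc, List.length_cons]
    rw [show p + 1 + l.length = p + (l.length + 1) by ring]

theorem Reads.congr {f g : ℕ → ℕ} {p : ℕ} {l : List ℕ} (h : Reads f p l)
    (hfg : ∀ i, p ≤ i → i < p + l.length → g i = f i) : Reads g p l := by
  induction l generalizing p with
  | nil => trivial
  | cons x l ih =>
    rw [List.length_cons] at hfg
    exact ⟨(hfg p le_rfl (by omega)).trans h.1,
      ih h.2 fun i hi hi' => hfg i (by omega) (by omega)⟩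

theorem Reads.getElem? {f : ℕ → ℕ} {p i x : ℕ} {l : List ℕ} (h : Reads f p l)
    (hx : l[i]? = some x) : f (p + i) = x := by
  induction l generalizing p i with
  | nil => simp at hx
  | cons y l ih =>
    cases i with
    | zero => simpa [h.1] using hx
    | succ i =>
      have := ih h.2 (i := i) (by simpa using hx)
      rwa [show p + (i + 1) = p + 1 + i by ring]

theorem reads_getD (l : List ℕ) : Reads (fun i => l.getD i 0) 0 l := by
  suffices ∀ l' : List ℕ, Reads (fun i => (l' ++ l).getD i 0) l'.length l from this []
  induction l with
  | nil => intro; trivial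
  | cons x l ih =>
    intro l'
    refine ⟨by simp, ?_⟩
    have := ih (l' ++ [x])
    simpa using this

theorem Reads.map_range {f : ℕ → ℕ} {p : ℕ} {l : List ℕ} (h : Reads f p l) :
    (List.range l.length).map (fun i => f (p + i)) = l := by
  apply List.ext_getElem?
  intro i
  by_cases hi : i < l.length
  · have := h.getElem? (List.getElem?_eq_getElem hi)
    rw [List.getElem?_map, List.getElem?_range hi, Option.map_some, this,
      List.getElem?_eq_getElem hi]
  · rw [List.getElem?_eq_none (by simpa using hi), List.getElem?_eq_none (by simpa using hi)]

theorem encodeList_eq {n : ℕ} (l : List (Fin n)) : encodeList l = l.length :: l.map Fin.val := by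
  simp only [encodeList, List.map_id', List.bind_eq_flatMap, List.pure_def]
  rw [List.map_eq_flatMap]

/-- Where the lists of `L` start when they are stored one after the other, each one preceded by its
length, from position `1` on. -/
def offset {α : Type*} (L : List (List α)) (i : ℕ) : ℕ :=
  1 + ((L.take i).map fun l => l.length + 1).sum

theorem offset_succ {α : Type*} (L : List (List α)) (i : ℕ) (hi : i < L.length) :
    offset L (i + 1) = offset L i + L[i].length + 1 := by
  rw [offset, offset, List.take_succ_eq_append_getElem hi, List.map_append, List.sum_append]
  simp [add_assoc]

theorem Reads.offset {n : ℕ} {f : ℕ → ℕ} (L : List (List (Fin n)))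
    (h : Reads f 1 (L.map encodeList).flatten) (i : ℕ) (hi : i < L.length) :
    f (offset L i) = L[i].length ∧
      Reads f (DrDSR.offset L i + 1) (L[i].map Fin.val) := by
  have h1 : L = L.take i ++ L[i] :: L.drop (i + 1) := by simp
  rw [h1, List.map_append, List.flatten_append, reads_append] at h
  have h2 := h.2
  rw [List.map_cons, List.flatten_cons, reads_append] at h2
  have h3 : 1 + ((L.take i).map encodeList).flatten.length = DrDSR.offset L i := by
    simp [DrDSR.offset, List.length_flatten, Function.comp_def, encodeList_eq]
  rw [h3] at h2
  rw [encodeList_eq] at h2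
  exact h2.1

/-! ### The program: parsing and breadth-first search -/

infixr:60 " ;; " => Prog.seq

/-- Store the positions of the lists of the input in array `2`. -/
def scanBody : Prog :=
  .ite (.eq 5 20) (.store 2 3 4 ;; .load 5 0 4 ;; .succ 4 ;; .succ 3) (.succ 4 ;; .pred 5)

theorem runs_scan {α : Type*} (L : List (List α)) (s : State) (h2 : s.reg 2 = L.length)
    (h3 : s.reg 3 = 0) (h4 : s.reg 4 = 1) (h5 : s.reg 5 = 0) (h20 : s.reg 20 = 0)
    (hf : ∀ i (hi : i < L.length), s.arr 0 (offset L i) = L[i].length) :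
    ∃ s', Runs (.loop (.lt 3 2) scanBody) s (offset L L.length * (scanBody.size + 1) + 1) s' ∧
      ∀ i ≤ L.length, i < L.length → s'.arr 2 i = offset L i := by
  have hmono : ∀ i k, i + k ≤ L.length → offset L i ≤ offset L (i + k) := by
    intro i k
    induction k with
    | zero => simp
    | succ k ih =>
      intro hk
      have h1 := ih (by omega)
      have h2 := offset_succ L (i + k) (by omega)
      rw [← add_assoc]
      omega
  obtain ⟨s', hr, hb, hF, m', hI⟩ := runs_loop (.lt 3 2) scanBody rfl
    -- Register `4` is the reading position and register `5` the number of entries of the current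
    -- list still to be skipped, so their sum is where list number `s.reg 3` starts. The fuel pays
    -- for the cells not yet passed.
    (fun m s => s.reg 3 ≤ L.length ∧ s.reg 4 + s.reg 5 = offset L (s.reg 3) ∧
      (∀ i < s.reg 3, s.arr 2 i = offset L i) ∧ offset L L.length ≤ m + s.reg 4) s
    (by
      rintro m s' hF ⟨hle, hpos, hoff, hm⟩ hb
      have r2 : s'.reg 2 = L.length := (hF.reg 2 (by decide)).trans h2
      have r20 : s'.reg 20 = 0 := (hF.reg 20 (by decide)).trans h20
      have a0 : s'.arr 0 = s.arr 0 := hF.arr 0 (by decide)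
      have hlt : s'.reg 3 < L.length := by simpa [Test.Holds, r2] using hb
      have hs := offset_succ L _ hlt
      have hle2 := hmono (s'.reg 3 + 1) (L.length - (s'.reg 3 + 1)) (by omega)
      rw [show s'.reg 3 + 1 + (L.length - (s'.reg 3 + 1)) = L.length by omega] at hle2
      refine ⟨m - 1, by omega, ?_⟩
      by_cases hk : s'.reg 5 = 0
      · have hpos' : s'.reg 4 = offset L (s'.reg 3) := by omega
        have hfi := hf _ hlt
        simp only [scanBody, Prog.eval, Test.Holds, hk, r20, if_true, State.reg_setReg,
          State.arr_setReg, State.reg_setArr, State.arr_setArr, a0]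
        norm_num
        rw [hpos', hfi]
        refine ⟨by omega, by omega, fun i hi => ?_, by omega⟩
        by_cases hi' : i = s'.reg 3
        · simp [hi']
        · rw [if_neg hi']
          exact hoff i (by omega)
      · simp only [scanBody, Prog.eval, Test.Holds, hk, r20, if_false, State.reg_setReg,
          State.arr_setReg, State.reg_setArr, State.arr_setArr]
        norm_num
        exact ⟨hle, by omega, hoff, by omega⟩)
    (offset L L.length) ⟨by omega, by simp [h3, h4, h5, offset], by simp [h3], by omega⟩
  refine ⟨s', hr, fun i _ hi => hI.2.2.1 i ?_⟩
  have r2 : s'.reg 2 = L.length := (hF.reg 2 (by decide)).trans h2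
  simp only [Test.Holds, r2] at hb
  omega

/-- Breadth-first search: visit the next neighbour, or go on to the next vertex. -/
def searchBody : Prog :=
  .ite (.eq 10 20) (.succ 6 ;; .load 8 3 6 ;; .load 9 2 8 ;; .load 10 0 9 ;; .succ 9)
    (.load 11 0 9 ;; .succ 9 ;; .pred 10 ;; .load 12 4 11 ;;
      .ite (.eq 12 20)
        (.copy 12 8 ;; .succ 12 ;; .store 4 11 12 ;; .store 3 7 11 ;; .succ 7) .skip)

section

variable {n : ℕ}

/-- The arrays `3` and `4` contain the state `Q` of the search. -/
structure HasQueue (s : State) (Q : Queue (Fin n)) : Prop where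
  len : s.reg 7 = Q.order.length
  order : Reads (s.arr 3) 0 (Q.order.map Fin.val)
  par : ∀ v : Fin n, s.arr 4 v = if v ∈ Q.order then (Q.par v : ℕ) + 1 else 0

/-- Array `4` stores the parent plus one; zero marks a vertex that has not been visited. -/
theorem HasQueue.visit {s : State} {Q : Queue (Fin n)} (h : HasQueue s Q) {u w : Fin n}
    (h8 : s.reg 8 = u) (h9 : s.arr 0 (s.reg 9) = w) (h10 : s.reg 10 ≠ 0) (h20 : s.reg 20 = 0) :
    HasQueue (searchBody.eval s) (Q.visit u w) ∧ (searchBody.eval s).reg 6 = s.reg 6 ∧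
      (searchBody.eval s).reg 8 = s.reg 8 ∧ (searchBody.eval s).reg 9 = s.reg 9 + 1 ∧
      (searchBody.eval s).reg 10 = s.reg 10 - 1 := by
  have hw := h.par w
  by_cases hwQ : w ∈ Q.order
  · rw [if_pos hwQ] at hw
    have e : searchBody.eval s = ((((s.setReg 11 w).setReg 9 (s.reg 9 + 1)).setReg 10 (s.reg 10 - 1)).setReg 12
      (Q.par w + 1)) := by
      simp [searchBody, Prog.eval, Test.Holds, h10, h20, h9, hw]
    rw [e]
    rw [Queue.visit, if_pos hwQ]
    refine ⟨⟨by simpa using h.len, h.order, h.par⟩, ?_⟩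
    simp
  · rw [if_neg hwQ] at hw
    have e : searchBody.eval s = ((((((((s.setReg 11 w).setReg 9 (s.reg 9 + 1)).setReg 10
      (s.reg 10 - 1)).setReg 12 0).setReg 12 (s.reg 8)).setReg 12 (s.reg 8 + 1)).setArr
      4 w (s.reg 8 + 1)).setArr 3 (s.reg 7) w).setReg 7 (s.reg 7 + 1) := by
      simp [searchBody, Prog.eval, Test.Holds, h10, h20, h9, hw]
    rw [e]
    rw [Queue.visit, if_neg hwQ]
    refine ⟨⟨?_, ?_, fun v => ?_⟩, by simp⟩
    · simp [h.len]
    · simp only [List.map_append, List.map_cons, List.map_nil, reads_append]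
      refine ⟨h.order.congr fun i _ hi => ?_, ?_, trivial⟩
      · have : i ≠ s.reg 7 := by rw [h.len]; simp at hi; omega
        simp [this]
      · simp [h.len]
    · by_cases hvw : v = w
      · subst hvw; simp [h8]
      · have : (v : ℕ) ≠ w := fun e => hvw (Fin.ext e)
        simp [this, hvw, h.par v]

theorem runs_search {adj : Fin n → List (Fin n)} {root : Fin n} (off : ℕ → ℕ) (s : State)
    (h6 : s.reg 6 = 0) (h7 : s.reg 7 = 1) (h8 : s.reg 8 = root)
    (h9 : s.reg 9 = off root + 1) (h10 : s.reg 10 = (adj root).length) (h20 : s.reg 20 = 0)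
    (h3 : s.arr 3 0 = root) (h4 : ∀ v : Fin n, s.arr 4 v = if v = root then (root : ℕ) + 1 else 0)
    (h2 : ∀ v : Fin n, s.arr 2 v = off v) (hf : ∀ v : Fin n, s.arr 0 (off v) = (adj v).length ∧
      Reads (s.arr 0) (off v + 1) ((adj v).map Fin.val))
    (hlen : (search adj root n).order.length = n) :
    ∃ s', Runs (.loop (.lt 6 7) searchBody) s
        (((search adj root n).order.map fun v => (adj v).length + 1).sum * (searchBody.size + 1) + 1)
        s' ∧ HasQueue s' (search adj root n) := by
  set F := (search adj root n).order with hF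
  have hget : ∀ k ≤ n, ∀ (i : ℕ) (u : Fin n), (search adj root k).order[i]? = some u → F[i]? = some u := by
    intro k hk i u hu
    have hp := search_prefix (adj := adj) (root := root) hk
    obtain ⟨t, ht⟩ := hp
    rw [hF, ← ht, List.getElem?_append_left (List.getElem?_eq_some_iff.1 hu).1, hu]
  have hdrop : ∀ (i : ℕ) (u : Fin n), F[i]? = some u → F.drop i = u :: F.drop (i + 1) := by
    intro i u hu
    obtain ⟨hi, rfl⟩ := List.getElem?_eq_some_iff.1 hu
    exact List.drop_eq_getElem_cons hi
  have hcard : ∀ k, (search adj root k).order.length ≤ n := by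
    intro k
    simpa using search_length_le (adj := adj) (root := root) k
  obtain ⟨s', hr, hb, hFr, m', hI⟩ := runs_loop (.lt 6 7) searchBody rfl
    -- The nested loop of the search is run as one loop: `u` is the vertex at the head, `sc` its
    -- scanned and `rest` its remaining neighbours. The fuel pays for `rest`, for one change of the
    -- head, and for each later vertex of the final order `F` with its neighbours. The last
    -- alternative is a head that has run past the end.
    (fun m s' => (∃ h u sc rest, (search adj root h).order[h]? = some u ∧ adj u = sc ++ rest ∧
        s'.reg 6 = h ∧ s'.reg 8 = u ∧ s'.reg 10 = rest.length ∧
        Reads (s.arr 0) (s'.reg 9) (rest.map Fin.val) ∧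
        HasQueue s' (sc.foldl (Queue.visit u) (search adj root h)) ∧
        ((F.drop (h + 1)).map fun v => (adj v).length + 1).sum + rest.length + 1 ≤ m) ∨
      (s'.reg 6 = s'.reg 7 ∧ HasQueue s' (search adj root n))) s
    (by
      rintro m s' hFr hI hb
      have r20 : s'.reg 20 = 0 := (hFr.reg 20 (by decide)).trans h20
      have a0 : s'.arr 0 = s.arr 0 := hFr.arr 0 (by decide)
      have a2 : s'.arr 2 = s.arr 2 := hFr.arr 2 (by decide)
      rcases hI with ⟨h, u, sc, rest, hu, hadj, e6, e8, e10, hrest, hQ, hm⟩ | ⟨h1, _⟩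
      swap
      · simp [Test.Holds, h1] at hb
      cases rest with
      | nil =>
        rw [List.append_nil] at hadj
        rw [← hadj, ← search_succ_of_some hu] at hQ
        have hlt : h < (search adj root (h + 1)).order.length :=
          (List.getElem?_eq_some_iff.1 hu).1.trans_le (search_prefix_succ h).length_le
        have hhn := hlt.trans_le (hcard (h + 1))
        have ev : ∀ s'', s'' = searchBody.eval s' → s''.reg 6 = h + 1 ∧ s''.reg 7 = s'.reg 7 ∧
            s''.arr = s'.arr ∧ s''.reg 8 = s'.arr 3 (h + 1) ∧
            s''.reg 9 = s.arr 2 (s''.reg 8) + 1 ∧ s''.reg 10 = s.arr 0 (s.arr 2 (s''.reg 8)) := by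
          rintro _ rfl
          simp [searchBody, Prog.eval, Test.Holds, e10, r20, a0, a2, e6]
        obtain ⟨f6, f7, fa, f8, f9, f10⟩ := ev _ rfl
        have hQ' : HasQueue (searchBody.eval s') (search adj root (h + 1)) :=
          ⟨f7.trans hQ.len, by rw [fa]; exact hQ.order, by rw [fa]; exact hQ.par⟩
        -- With no further vertex in the queue, the registers just loaded hold meaningless values;
        -- the loop test fails next, so they are never used.
        cases hu' : (search adj root (h + 1)).order[h + 1]? with
        | none =>
          have hle := List.getElem?_eq_none_iff.1 hu'
          refine ⟨0, by omega, Or.inr ⟨?_, ?_⟩⟩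
          · rw [f6, f7, hQ.len]; omega
          · rwa [search_eq_of_length_le (h := h + 1) (by omega) hle]
        | some u' =>
          have hF' := hdrop _ _ (hget _ (by omega) _ _ hu')
          have h3' := hQ.order.getElem? (i := h + 1) (x := u') (by simp [hu'])
          rw [zero_add] at h3'
          rw [h3'] at f8
          rw [f8, h2 u'] at f9 f10
          rw [hF', List.map_cons, List.sum_cons, List.length_nil] at hm
          refine ⟨m - 1, by omega, Or.inl ⟨h + 1, u', [], adj u', hu', rfl, f6, f8, ?_, ?_, hQ', ?_⟩⟩
          · rw [f10, (hf u').1]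
          · rw [f9]; exact (hf u').2
          · omega
      | cons w rest =>
        obtain ⟨hw, hrest⟩ := hrest
        rw [← a0] at hw
        obtain ⟨hQ', f6, f8, f9, f10⟩ := hQ.visit e8 hw (by simp [e10]) r20
        rw [List.length_cons] at hm e10
        refine ⟨m - 1, by omega, Or.inl ⟨h, u, sc ++ [w], rest, hu, by simp [hadj], f6.trans e6,
          f8.trans e8, by omega, by rwa [f9], ?_, by omega⟩⟩
        rwa [List.foldl_append])
    ((F.map fun v => (adj v).length + 1).sum) (by
      refine Or.inl ⟨0, root, [], adj root, rfl, rfl, h6, h8, h10, by rw [h9]; exact (hf root).2,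
        ⟨h7, ⟨h3, trivial⟩, by simpa [search] using h4⟩, ?_⟩
      have hF' := hdrop 0 root (hget 0 (by omega) _ _ rfl)
      rw [List.drop_zero] at hF'
      rw [hF', List.map_cons, List.sum_cons, ← hF']
      omega)
  refine ⟨s', hr, ?_⟩
  rcases hI with ⟨h, u, sc, rest, hu, hadj, e6, e8, e10, hrest, hQ, hm⟩ | h
  · exfalso
    apply hb
    simp only [Test.Holds]
    rw [e6, hQ.len]
    exact (List.getElem?_eq_some_iff.1 hu).1.trans_le (Queue.prefix_foldl _ _ _).length_le
  · exact h.2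

end

/-! ### The program: selection of the centers -/

/-- Load the data of the next vertex. -/
def fetchBlock : Prog :=
  .pred 13 ;; .load 14 3 13 ;; .load 15 5 14 ;; .ite (.eq 15 20) (.const 15 1) .skip ;;
    .load 16 6 14 ;; .load 17 4 14 ;; .pred 17

/-- Make the current vertex a center. -/
def chooseBlock : Prog :=
  .store 7 14 22 ;; .copy 18 14 ;; .const 15 0 ;; .copy 16 21

/-- Decide on the current vertex. -/
def decideBlock : Prog :=
  .ite (.le 15 16) (.const 15 0)
    (.ite (.eq 15 21) chooseBlock (.ite (.eq 14 20) chooseBlock .skip))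

/-- Report to the parent. -/
def pushBlock : Prog :=
  .ite (.ne 15 20) (.succ 15) .skip ;; .load 19 5 17 ;; .ite (.lt 19 15) (.store 5 17 15) .skip ;;
    .pred 16 ;; .load 19 6 17 ;; .ite (.lt 19 16) (.store 6 17 16) .skip

/-- One step of the dynamic program. -/
def selectBody : Prog := fetchBlock ;; decideBlock ;; pushBlock

/-- Needs start at `1` but array `5` is initially zero. Reading `0` as `1` saves an initialization
and explains the maximum with `1`. -/
theorem eval_fetchBlock (s : State) (h20 : s.reg 20 = 0) :
    (fetchBlock.eval s).reg 13 = s.reg 13 - 1 ∧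
    (fetchBlock.eval s).reg 14 = s.arr 3 (s.reg 13 - 1) ∧
    (fetchBlock.eval s).reg 15 = max 1 (s.arr 5 (s.arr 3 (s.reg 13 - 1))) ∧
    (fetchBlock.eval s).reg 16 = s.arr 6 (s.arr 3 (s.reg 13 - 1)) ∧
    (fetchBlock.eval s).reg 17 = s.arr 4 (s.arr 3 (s.reg 13 - 1)) - 1 := by
  by_cases h : s.arr 5 (s.arr 3 (s.reg 13 - 1)) = 0
  · simp [fetchBlock, Prog.eval, Test.Holds, h20, h]
  · simp [fetchBlock, Prog.eval, Test.Holds, h20, h]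
    omega

theorem eval_pushBlock (s : State) (h20 : s.reg 20 = 0) (j : ℕ) :
    (pushBlock.eval s).arr 5 j = (if j = s.reg 17 then
      max (s.arr 5 j) (if s.reg 15 = 0 then 0 else s.reg 15 + 1) else s.arr 5 j) ∧
    (pushBlock.eval s).arr 6 j = (if j = s.reg 17 then
      max (s.arr 6 j) (s.reg 16 - 1) else s.arr 6 j) := by
  have key : ∀ s' : State, (∀ j, s'.arr 6 j = s.arr 6 j) → s'.reg 16 = s.reg 16 →
      s'.reg 17 = s.reg 17 →
      ∀ s'', s'' = Prog.eval (.pred 16 ;; .load 19 6 17 ;; .ite (.lt 19 16) (.store 6 17 16) .skip) s' →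
      s''.arr 5 = s'.arr 5 ∧ s''.arr 6 j = (if j = s.reg 17 then
      max (s.arr 6 j) (s.reg 16 - 1) else s.arr 6 j) := by
    rintro s' h1 h2 h3 _ rfl
    refine ⟨(runs_eval _ rfl _).frame.arr 5 (by decide), ?_⟩
    by_cases h : s.arr 6 (s.reg 17) < s.reg 16 - 1
    · by_cases hj : j = s.reg 17
      · subst hj; simp [Prog.eval, Test.Holds, h1, h2, h3, h, h.le]
      · simp [Prog.eval, Test.Holds, h1, h2, h3, h, hj]
    · by_cases hj : j = s.reg 17
      · subst hj; simp [Prog.eval, Test.Holds, h1, h2, h3, h]; omega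
      · simp [Prog.eval, Test.Holds, h1, h2, h3, h, hj]
  have key2 : ∀ s', s' = Prog.eval (.load 19 5 17 ;; .ite (.lt 19 15) (.store 5 17 15) .skip)
      (Prog.eval (.ite (.ne 15 20) (.succ 15) .skip) s) → (∀ j, s'.arr 6 j = s.arr 6 j) ∧
      s'.reg 16 = s.reg 16 ∧ s'.reg 17 = s.reg 17 ∧ s'.arr 5 j = (if j = s.reg 17 then
      max (s.arr 5 j) (if s.reg 15 = 0 then 0 else s.reg 15 + 1) else s.arr 5 j) := by
    rintro _ rfl
    by_cases h0 : s.reg 15 = 0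
    · simp [Prog.eval, Test.Holds, h0, h20]
    · by_cases h : s.arr 5 (s.reg 17) < s.reg 15 + 1
      · by_cases hj : j = s.reg 17
        · subst hj; simp [Prog.eval, Test.Holds, h20, h0, h, h.le]
        · simp [Prog.eval, Test.Holds, h20, h0, h, hj]
      · by_cases hj : j = s.reg 17
        · subst hj; simp [Prog.eval, Test.Holds, h20, h0, h]; omega
        · simp [Prog.eval, Test.Holds, h20, h0, h, hj]
  obtain ⟨h1, h2, h3, h4⟩ := key2 _ rfl
  obtain ⟨h5, h6⟩ := key _ h1 h2 h3 _ rfl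
  exact ⟨(congrFun h5 j).trans h4, h6⟩

section

variable {n : ℕ}

/-- The root is the vertex `0`, so the program recognizes it by comparison with the zero register.
After the decision, registers `15` and `16` hold the two messages for the parent. -/
theorem eval_decideBlock {root v : Fin n} {r : ℕ} {S : Selection (Fin n)} (s : State)
    (hroot : (root : ℕ) = 0) (h14 : s.reg 14 = v) (h15 : s.reg 15 = S.need v)
    (h16 : s.reg 16 = S.slack v) (h18 : s.reg 18 = S.first) (h20 : s.reg 20 = 0)
    (h21 : s.reg 21 = r + 1) (h22 : s.reg 22 = 1) (hv : v ∉ S.centers)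
    (h7 : ∀ w : Fin n, s.arr 7 w = if w ∈ S.centers then 1 else 0) :
    (decideBlock.eval s).reg 15 = needOut S.need S.slack (S.decide root r v).centers v ∧
    (decideBlock.eval s).reg 16 = slackOut r S.slack (S.decide root r v).centers v ∧
    (decideBlock.eval s).reg 18 = (S.decide root r v).first ∧
    ∀ w : Fin n, (decideBlock.eval s).arr 7 w =
      if w ∈ (S.decide root r v).centers then 1 else 0 := by
  have hvr : (v : ℕ) = 0 ↔ v = root := by rw [← hroot, Fin.val_inj]
  have hch : S.Chosen root r v → decideBlock.eval s =
      (((s.setArr 7 v 1).setReg 18 v).setReg 15 0).setReg 16 (r + 1) := by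
    rintro ⟨h1, h2⟩
    by_cases h3 : S.need v = r + 1
    · rw [h3] at h1
      simp [decideBlock, chooseBlock, Prog.eval, Test.Holds, h14, h15, h16, h21, h22, h3,
        not_le.2 h1]
    · simp [decideBlock, chooseBlock, Prog.eval, Test.Holds, h14, h15, h16, h20, h21, h22, h3,
        not_le.2 h1, hvr.2 (h2.resolve_left h3)]
  by_cases hc : S.Chosen root r v
  · rw [hch hc, Selection.decide, if_pos hc]
    refine ⟨by simp [needOut], by simp [slackOut], by simp, fun w => ?_⟩
    by_cases hw : w = v
    · subst hw; simp
    · have : (w : ℕ) ≠ v := fun e => hw (Fin.ext e)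
      simp [hw, this, h7]
  · rw [Selection.decide, if_neg hc]
    by_cases h1 : S.need v ≤ S.slack v
    · have e : decideBlock.eval s = s.setReg 15 0 := by
        simp [decideBlock, Prog.eval, Test.Holds, h15, h16, h1]
      rw [e]
      exact ⟨by simp [needOut, h1], by simp [slackOut, hv, h16], by simp [h18], by simpa using h7⟩
    · have h2 : S.need v ≠ r + 1 ∧ (v : ℕ) ≠ 0 := by
        rw [Ne, Ne, hvr, ← not_or]
        exact fun h => hc ⟨not_le.1 h1, h⟩
      have e : decideBlock.eval s = s := by
        simp [decideBlock, Prog.eval, Test.Holds, h14, h15, h16, h20, h21, h1, h2]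
      rw [e]
      exact ⟨by simp [needOut, h1, hv, h15], by simp [slackOut, hv, h16], h18, h7⟩

/-- The memory contains the state `S` of the dynamic program, as far as it concerns the vertices
of `l`. -/
structure HasSelection (s : State) (l : List (Fin n)) (S : Selection (Fin n)) : Prop where
  need : ∀ v ∈ l, max 1 (s.arr 5 v) = S.need v
  slack : ∀ v ∈ l, s.arr 6 v = S.slack v
  centers : ∀ v : Fin n, s.arr 7 v = if v ∈ S.centers then 1 else 0
  first : s.reg 18 = S.first

/-- The program reports even from the root, unlike `Selection.push`. This is harmless: the root
comes last, so `l` is empty and no need or slack is read again. -/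
theorem HasSelection.step {root v : Fin n} {par : Fin n → Fin n} {r : ℕ} {S : Selection (Fin n)}
    {l : List (Fin n)} {s : State} (h : HasSelection s (l ++ [v]) S) (hroot : (root : ℕ) = 0)
    (h13 : s.reg 13 = l.length + 1) (h3 : s.arr 3 l.length = v) (h4 : s.arr 4 v = par v + 1)
    (h20 : s.reg 20 = 0) (h21 : s.reg 21 = r + 1) (h22 : s.reg 22 = 1) (hv : v ∉ S.centers)
    (hvl : v = root → l = []) :
    HasSelection (selectBody.eval s) l ((S.decide root r v).push root par r v) ∧
      (selectBody.eval s).reg 13 = l.length := by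
  obtain ⟨f13, f14, f15, f16, f17⟩ := eval_fetchBlock s h20
  have hfr := (runs_eval fetchBlock rfl s).frame
  set s₁ := fetchBlock.eval s with hs₁
  have e : s.reg 13 - 1 = l.length := by omega
  rw [e] at f13 f14 f15 f16 f17
  rw [h3] at f14 f15 f16 f17
  rw [h.need v (by simp)] at f15
  rw [h.slack v (by simp)] at f16
  rw [h4, Nat.add_sub_cancel] at f17
  have f20 := (hfr.reg 20 (by decide)).trans h20
  obtain ⟨d15, d16, d18, d7⟩ := eval_decideBlock s₁ hroot f14 f15 f16
    ((hfr.reg 18 (by decide)).trans h.first) f20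
    ((hfr.reg 21 (by decide)).trans h21) ((hfr.reg 22 (by decide)).trans h22) hv
    (by rw [hfr.arr 7 (by decide)]; exact h.centers)
  have hfr₂ := (runs_eval decideBlock rfl s₁).frame
  set s₂ := decideBlock.eval s₁ with hs₂
  have g20 := (hfr₂.reg 20 (by decide)).trans f20
  have g17 := (hfr₂.reg 17 (by decide)).trans f17
  have p := eval_pushBlock s₂ g20
  have hfr₃ := (runs_eval pushBlock rfl s₂).frame
  have hs : selectBody.eval s = pushBlock.eval s₂ := rfl
  rw [hs]
  set s₃ := pushBlock.eval s₂
  have g5 : s₂.arr 5 = s.arr 5 := (hfr₂.arr 5 (by decide)).trans (hfr.arr 5 (by decide))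
  have g6 : s₂.arr 6 = s.arr 6 := (hfr₂.arr 6 (by decide)).trans (hfr.arr 6 (by decide))
  have hdec : (S.decide root r v).need = S.need ∧ (S.decide root r v).slack = S.slack := by
    unfold Selection.decide
    split_ifs <;> exact ⟨rfl, rfl⟩
  rw [← hdec.1, ← hdec.2] at d15
  rw [← hdec.2] at d16
  refine ⟨⟨fun w hw => ?_, fun w hw => ?_, fun w => ?_, ?_⟩, ?_⟩
  · have hvr : v ≠ root := fun e => by simp [hvl e] at hw
    rw [(p w).1, d15, g17, g5, Selection.push, if_neg hvr]
    have := h.need w (by simp [hw])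
    by_cases hwp : w = par v
    · subst hwp
      simp only [if_true, Function.update_self, Selection.needMsg]
      rw [← max_assoc, this, ← hdec.1]
    · have hne : (w : ℕ) ≠ par v := fun e => hwp (Fin.ext e)
      simp [hwp, hne, this, hdec.1]
  · have hvr : v ≠ root := fun e => by simp [hvl e] at hw
    rw [(p w).2, d16, g17, g6, Selection.push, if_neg hvr]
    have := h.slack w (by simp [hw])
    by_cases hwp : w = par v
    · subst hwp
      simp only [if_true, Function.update_self]
      rw [this, ← hdec.2]
    · have hne : (w : ℕ) ≠ par v := fun e => hwp (Fin.ext e)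
      simp [hwp, hne, this, hdec.2]
  · rw [hfr₃.arr 7 (by decide), d7, Selection.push]
    split_ifs <;> rfl
  · rw [hfr₃.reg 18 (by decide), d18, Selection.push]
    split_ifs <;> rfl
  · rw [hfr₃.reg 13 (by decide), hfr₂.reg 13 (by decide), f13]

theorem runs_select {root : Fin n} {par : Fin n → Fin n} {rk : Fin n → ℕ} {r : ℕ}
    {q : List (Fin n)} (hq : q.Pairwise fun a b => rk a < rk b)
    (hpar : ∀ v ≠ root, rk (par v) < rk v) (hq0 : ∀ v ∈ q, rk root ≤ rk v) (s : State)
    (hroot : (root : ℕ) = 0) (h13 : s.reg 13 = q.length)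
    (h3 : Reads (s.arr 3) 0 (q.map Fin.val)) (h4 : ∀ v : Fin n, s.arr 4 v = par v + 1)
    (h20 : s.reg 20 = 0) (h21 : s.reg 21 = r + 1) (h22 : s.reg 22 = 1) (h18 : s.reg 18 = 0)
    (h5 : ∀ v, s.arr 5 v = 0) (h6 : ∀ v, s.arr 6 v = 0) (h7 : ∀ v, s.arr 7 v = 0) :
    ∃ s', Runs (.loop (.lt 20 13) selectBody) s (q.length * (selectBody.size + 1) + 1) s' ∧
      HasSelection s' [] (select root par r q) := by
  obtain ⟨s', hr, hb, hF, m', hI⟩ := runs_loop (.lt 20 13) selectBody rfl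
    (fun m s' => ∃ l l', q = l ++ l' ∧ s'.reg 13 = l.length ∧ l.length ≤ m ∧
      HasSelection s' l (select root par r l')) s
    (by
      rintro m s' hF ⟨l, l', rfl, e13, hm, hS⟩ hb
      have e20 := (hF.reg 20 (by decide)).trans h20
      simp only [Test.Holds, e20, e13] at hb
      obtain ⟨l, v, rfl⟩ : ∃ k v, l = k ++ [v] :=
        ⟨l.dropLast, l.getLast (List.ne_nil_of_length_pos hb),
          (List.dropLast_append_getLast _).symm⟩
      rw [List.append_assoc, List.singleton_append, List.pairwise_append,
        List.pairwise_cons] at hq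
      have hvalid := select_valid (r := r) l' hq.2.1.2 hpar
      rw [List.length_append, List.length_singleton] at e13 hm
      obtain ⟨hS', e13'⟩ := hS.step (par := par) (r := r) hroot e13
        (by
          rw [hF.arr 3 (by decide)]
          simpa using h3.getElem? (i := l.length) (x := v) (by simp))
        (by rw [hF.arr 4 (by decide)]; exact h4 v) e20
        ((hF.reg 21 (by decide)).trans h21) ((hF.reg 22 (by decide)).trans h22)
        (fun h => (hq.2.1.1 v ((hvalid.mem_iff v).1 h).1).false)
        (by
          rintro rfl
          by_contra hne
          obtain ⟨w, hw⟩ := List.exists_mem_of_ne_nil l hne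
          have h1 := hq.2.2 w hw v List.mem_cons_self
          have h2 := hq0 w (by simp [hw])
          omega)
      exact ⟨l.length, by omega, l, v :: l', by simp, e13', le_rfl, hS'⟩)
    q.length ⟨q, [], by simp, h13, le_rfl, by simp [h5, select], by simp [h6, select],
      by simp [h7, select], by simp [h18, select, hroot]⟩
  obtain ⟨l, l', rfl, e13, -, hS⟩ := hI
  have e20 := (hF.reg 20 (by decide)).trans h20
  simp only [Test.Holds, e20, e13, not_lt, Nat.le_zero, List.length_eq_zero_iff] at hb
  subst hb
  exact ⟨s', by simpa using hr, hS⟩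

/-! ### The program: the partition -/

/-- Compute the class of the next vertex and write it to the output. -/
def repBody : Prog :=
  .load 24 3 23 ;; .load 25 7 24 ;;
    .ite (.eq 25 20)
      (.load 26 4 24 ;; .pred 26 ;; .ite (.eq 24 20) (.copy 26 18) (.load 26 8 26))
      (.copy 26 24) ;;
    .store 8 24 26 ;; .succ 24 ;; .store 1 24 26 ;; .succ 23

/-- In the order of the search the class of the parent is known first. The classes are written to
array `1` shifted by one cell, because cell `0` is reserved for the answer. -/
theorem runs_rep {root x₀ : Fin n} {par : Fin n → Fin n} {rk : Fin n → ℕ} {C : Finset (Fin n)}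
    {rep : Fin n → Fin n} (hR : IsRep root par rk C x₀ rep) (hpar : ∀ v ≠ root, rk (par v) < rk v)
    {q : List (Fin n)} (hq : q.Pairwise fun a b => rk a < rk b) (hmem : ∀ v, v ∈ q)
    (hroot : (root : ℕ) = 0) (s : State) (h1 : s.reg 1 = q.length) (h18 : s.reg 18 = x₀)
    (h20 : s.reg 20 = 0) (h23 : s.reg 23 = 0) (h3 : Reads (s.arr 3) 0 (q.map Fin.val))
    (h4 : ∀ v : Fin n, s.arr 4 v = par v + 1)
    (h7 : ∀ v : Fin n, s.arr 7 v = if v ∈ C then 1 else 0) (h0 : s.arr 1 0 = 0) :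
    ∃ s', Runs (.loop (.lt 23 1) repBody) s (q.length * (repBody.size + 1) + 1) s' ∧
      s'.arr 1 0 = 0 ∧ ∀ v : Fin n, s'.arr 8 v = rep v ∧ s'.arr 1 (v + 1) = rep v := by
  obtain ⟨s', hr, hb, hF, m', hI⟩ := runs_loop (.lt 23 1) repBody rfl
    (fun m s' => ∃ l l', q = l ++ l' ∧ s'.reg 23 = l.length ∧ l'.length ≤ m ∧ s'.arr 1 0 = 0 ∧
      ∀ v ∈ l, s'.arr 8 v = rep v ∧ s'.arr 1 (v + 1) = rep v) s
    (by
      rintro m s' hF ⟨l, l', rfl, e23, hm, e0, hS⟩ hb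
      have e20 := (hF.reg 20 (by decide)).trans h20
      have e18 := (hF.reg 18 (by decide)).trans h18
      have e1 := (hF.reg 1 (by decide)).trans h1
      simp only [Test.Holds, e23, e1, List.length_append] at hb
      obtain _ | ⟨v, l'⟩ := l'
      · simp at hb
      rw [List.length_cons] at hm
      have e3 : s'.arr 3 l.length = v := by
        rw [hF.arr 3 (by decide)]
        simpa using h3.getElem? (i := l.length) (x := v) (by simp)
      have e4 : s'.arr 4 v = par v + 1 := by rw [hF.arr 4 (by decide)]; exact h4 v
      have e7 : s'.arr 7 v = if v ∈ C then 1 else 0 := by rw [hF.arr 7 (by decide)]; exact h7 v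
      have hvr : (v : ℕ) = 0 ↔ v = root := by rw [← hroot, Fin.val_inj]
      have key : (repBody.eval s').reg 23 = s'.reg 23 + 1 ∧
          ∀ j, (repBody.eval s').arr 8 j = (if j = v then (rep v : ℕ) else s'.arr 8 j) ∧
            (repBody.eval s').arr 1 j = if j = v + 1 then (rep v : ℕ) else s'.arr 1 j := by
        by_cases hvC : v ∈ C
        · rw [hR.rep_center v hvC]
          simp [repBody, Prog.eval, Test.Holds, e23, e3, e7, hvC, e20]
        · by_cases hv : v = root
          · have hv0 := hvr.2 hv
            subst hv
            rw [hR.rep_root hvC]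
            rw [hv0, if_neg hvC] at e7
            simp [repBody, Prog.eval, Test.Holds, e23, e3, e7, e20, hv0, e18]
          · have hpl : par v ∈ l := by
              have h := hmem (par v)
              have hlt := hpar v hv
              rw [List.pairwise_append, List.pairwise_cons] at hq
              rcases List.mem_append.1 h with h | h
              · exact h
              · rcases List.mem_cons.1 h with h | h
                · rw [h] at hlt; omega
                · have := hq.2.1.1 _ h; omega
            rw [hR.rep_par v hvC hv]
            simp [repBody, Prog.eval, Test.Holds, e23, e3, e7, hvC, e20, hvr, hv, e4,
              (hS _ hpl).1]
      refine ⟨l'.length, by omega, l ++ [v], l', by simp, by simp [key.1, e23], le_rfl, ?_, ?_⟩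
      · rw [(key.2 0).2, if_neg (by omega), e0]
      · intro w hw
        rw [(key.2 w).1, (key.2 (w + 1)).2]
        by_cases hwv : w = v
        · simp [hwv]
        · have hne : (w : ℕ) ≠ v := fun e => hwv (Fin.ext e)
          have hwl : w ∈ l := by simpa [hwv] using hw
          simp [hne, hS w hwl])
    q.length ⟨[], q, by simp, h23, le_rfl, h0, by simp⟩
  obtain ⟨l, l', rfl, e23, -, e0, hS⟩ := hI
  have e1 := (hF.reg 1 (by decide)).trans h1
  simp only [Test.Holds, e23, e1, not_lt, List.length_append] at hb
  obtain rfl : l' = [] := List.length_eq_zero_iff.1 (by omega)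
  exact ⟨s', hr, e0, fun v => hS v (by simpa using hmem v)⟩

end

/-! ### The program: choice of tokens -/

/-- Read the vertex at the position in register `p`, record it in the array `a`, and make it the
token of its class in the array `b`, if it is the first one or the center. -/
def tokenBlock (p a b : ℕ) : Prog :=
  .load 33 0 p ;; .succ p ;; .store a 33 32 ;; .load 34 8 33 ;;
    .ite (.eq 34 33) (.copy 35 33 ;; .succ 35 ;; .store b 34 35)
      (.load 35 b 34 ;; .ite (.eq 35 20) (.copy 35 33 ;; .succ 35 ;; .store b 34 35) .skip)

def tokenBody : Prog := tokenBlock 27 9 10 ;; tokenBlock 29 11 12 ;; .pred 28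

section

variable {n : ℕ}

/-- The array `a` contains the characteristic function of `l`, the array `b` a token of `l` for
every class. -/
structure HasTokens (s : State) (a b : ℕ) (rep : Fin n → Fin n) (l : List (Fin n)) : Prop where
  flag : ∀ v : Fin n, s.arr a v = if v ∈ l then 1 else 0
  tok : ∀ x : Fin n, (s.arr b x = 0 ∧ ∀ y ∈ l, rep y ≠ x) ∨
    ∃ y ∈ l, rep y = x ∧ s.arr b x = y + 1 ∧ (x ∈ l → rep x = x → y = x)

theorem HasTokens.congr {s s' : State} {a b : ℕ} {rep : Fin n → Fin n} {l : List (Fin n)}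
    (h : HasTokens s a b rep l) (ha : s'.arr a = s.arr a) (hb : s'.arr b = s.arr b) :
    HasTokens s' a b rep l :=
  ⟨by rw [ha]; exact h.flag, by rw [hb]; exact h.tok⟩

/-- Array `b` stores a token plus one, with zero for none; a token on the center itself overrides an
earlier choice. Listing the two concrete uses in `hpab` lets `simp` decide which registers and
arrays coincide. -/
theorem HasTokens.step {s : State} {p a b : ℕ} {rep : Fin n → Fin n} {l : List (Fin n)} {y : Fin n}
    (h : HasTokens s a b rep l)
    (hpab : p = 27 ∧ a = 9 ∧ b = 10 ∨ p = 29 ∧ a = 11 ∧ b = 12) (hy : s.arr 0 (s.reg p) = y)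
    (h8 : s.arr 8 y = rep y) (h32 : s.reg 32 = 1) (h20 : s.reg 20 = 0) :
    HasTokens ((tokenBlock p a b).eval s) a b rep (l ++ [y]) ∧
      ((tokenBlock p a b).eval s).reg p = s.reg p + 1 := by
  have hyr : (rep y : ℕ) = y ↔ rep y = y := Fin.val_inj
  have key : ((tokenBlock p a b).eval s).reg p = s.reg p + 1 ∧
      (∀ j, ((tokenBlock p a b).eval s).arr a j = if j = y then 1 else s.arr a j) ∧
      ∀ j, ((tokenBlock p a b).eval s).arr b j =
        if j = rep y ∧ (rep y = y ∨ s.arr b (rep y) = 0) then (y : ℕ) + 1 else s.arr b j := by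
    by_cases h1 : rep y = y
    · rcases hpab with ⟨rfl, rfl, rfl⟩ | ⟨rfl, rfl, rfl⟩ <;>
      simp [tokenBlock, Prog.eval, Test.Holds, hy, h8, h32, h1]
    · by_cases h2 : s.arr b (rep y) = 0
      · rcases hpab with ⟨rfl, rfl, rfl⟩ | ⟨rfl, rfl, rfl⟩ <;>
        simp [tokenBlock, Prog.eval, Test.Holds, hy, h8, h32, h20, hyr, h1, h2]
      · rcases hpab with ⟨rfl, rfl, rfl⟩ | ⟨rfl, rfl, rfl⟩ <;>
        simp [tokenBlock, Prog.eval, Test.Holds, hy, h8, h32, h20, hyr, h1, h2]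
  obtain ⟨k1, k2, k3⟩ := key
  refine ⟨⟨fun v => ?_, fun x => ?_⟩, k1⟩
  · rw [k2]
    by_cases hv : v = y
    · simp [hv]
    · have : (v : ℕ) ≠ y := fun e => hv (Fin.ext e)
      simp [hv, this, h.flag]
  · rw [k3]
    by_cases hx : x = rep y
    · right
      by_cases hc : rep y = y ∨ s.arr b (rep y) = 0
      · refine ⟨y, by simp, hx.symm, by simp [hx, hc], fun hxl hxx => ?_⟩
        rcases hc with hc | hc
        · rw [hx, hc]
        · rcases h.tok (rep y) with ⟨_, h'⟩ | ⟨z, _, _, hz, _⟩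
          · rcases List.mem_append.1 hxl with hxl | hxl
            · exact absurd (hxx.trans hx) (h' x hxl)
            · exact (List.mem_singleton.1 hxl).symm
          · omega
      · rcases h.tok x with ⟨h', _⟩ | ⟨z, hz, hzx, hb, hxx⟩
        · exact absurd (Or.inr (hx ▸ h')) hc
        · refine ⟨z, by simp [hz], hzx, by rw [if_neg fun h => hc h.2, hb], fun hxl hxr => ?_⟩
          rcases List.mem_append.1 hxl with hxl | hxl
          · exact hxx hxl hxr
          · have hxy := List.mem_singleton.1 hxl
            exact absurd (Or.inl (by rw [← hxy, hxr])) hc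
    · have hne : (x : ℕ) ≠ rep y := fun e => hx (Fin.ext e)
      rw [if_neg fun h => hne h.1]
      rcases h.tok x with ⟨h', h''⟩ | ⟨z, hz, hzx, hb, hxx⟩
      · refine Or.inl ⟨h', fun z hz => ?_⟩
        rcases List.mem_append.1 hz with hz | hz
        · exact h'' z hz
        · rw [List.mem_singleton.1 hz]; exact Ne.symm hx
      · refine Or.inr ⟨z, by simp [hz], hzx, hb, fun hxl hxr => ?_⟩
        rcases List.mem_append.1 hxl with hxl | hxl
        · exact hxx hxl hxr
        · exact absurd (by rw [← List.mem_singleton.1 hxl, hxr]) hx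

theorem HasTokens.exists_isTok {s : State} {a b : ℕ} {rep : Fin n → Fin n} {l : List (Fin n)}
    (h : HasTokens s a b rep l) {C : Finset (Fin n)} (hC : ∀ x ∈ C, ∃ v ∈ l.toFinset, rep v = x)
    (hrep : ∀ x ∈ C, rep x = x) :
    ∃ tok : Fin n → Fin n, IsTok C rep l.toFinset tok ∧ ∀ x ∈ C, s.arr b x = tok x + 1 := by
  have : ∀ x : Fin n, ∃ y : Fin n, x ∈ C →
      (y ∈ l.toFinset ∧ rep y = x ∧ (x ∈ l.toFinset → y = x)) ∧ s.arr b x = y + 1 := by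
    intro x
    by_cases hx : x ∈ C
    · rcases h.tok x with ⟨_, h'⟩ | ⟨y, hy, hyx, hb, hxx⟩
      · obtain ⟨v, hv, hvx⟩ := hC x hx
        exact absurd hvx (h' v (by simpa using hv))
      · exact ⟨y, fun _ => ⟨⟨by simpa using hy, hyx, fun h => hxx (by simpa using h) (hrep x hx)⟩,
          hb⟩⟩
    · exact ⟨x, fun h => absurd h hx⟩
  choose tok htok using this
  exact ⟨tok, fun x hx => (htok x hx).1, fun x hx => (htok x hx).2⟩

/-- Equal lengths allow both lists to be read in lockstep. -/
theorem runs_tokens {rep : Fin n → Fin n} {ls lt : List (Fin n)} (hlen : ls.length = lt.length)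
    (s : State) (h27 : Reads (s.arr 0) (s.reg 27) (ls.map Fin.val))
    (h29 : Reads (s.arr 0) (s.reg 29) (lt.map Fin.val)) (h28 : s.reg 28 = ls.length)
    (h20 : s.reg 20 = 0) (h32 : s.reg 32 = 1) (h8 : ∀ v : Fin n, s.arr 8 v = rep v)
    (h9 : ∀ v, s.arr 9 v = 0) (h10 : ∀ v, s.arr 10 v = 0) (h11 : ∀ v, s.arr 11 v = 0)
    (h12 : ∀ v, s.arr 12 v = 0) :
    ∃ s', Runs (.loop (.lt 20 28) tokenBody) s (ls.length * (tokenBody.size + 1) + 1) s' ∧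
      HasTokens s' 9 10 rep ls ∧ HasTokens s' 11 12 rep lt := by
  obtain ⟨s', hr, hb, hF, m', hI⟩ := runs_loop (.lt 20 28) tokenBody rfl
    (fun m s' => ∃ k k' l l', ls = k ++ k' ∧ lt = l ++ l' ∧ s'.reg 28 = k'.length ∧
      k'.length = l'.length ∧ k'.length ≤ m ∧ Reads (s.arr 0) (s'.reg 27) (k'.map Fin.val) ∧
      Reads (s.arr 0) (s'.reg 29) (l'.map Fin.val) ∧ HasTokens s' 9 10 rep k ∧
      HasTokens s' 11 12 rep l) s
    (by
      rintro m s' hF ⟨k, k', l, l', rfl, rfl, e28, hl, hm, hk', hl', hk, hl2⟩ hb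
      have e20 := (hF.reg 20 (by decide)).trans h20
      have e32 := (hF.reg 32 (by decide)).trans h32
      have a0 : s'.arr 0 = s.arr 0 := hF.arr 0 (by decide)
      have a8 : s'.arr 8 = s.arr 8 := hF.arr 8 (by decide)
      simp only [Test.Holds, e20, e28] at hb
      obtain _ | ⟨y, k'⟩ := k'
      · simp at hb
      obtain _ | ⟨z, l'⟩ := l'
      · simp at hl
      simp only [List.length_cons] at hm hl e28
      obtain ⟨hy, hk'⟩ := hk'
      obtain ⟨hz, hl'⟩ := hl'
      obtain ⟨t1, r27⟩ := hk.step (Or.inl ⟨rfl, rfl, rfl⟩) (by rw [a0]; exact hy)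
        (by rw [a8]; exact h8 y) e32 e20
      have f1 := (runs_eval (tokenBlock 27 9 10) rfl s').frame
      set s₁ := (tokenBlock 27 9 10).eval s'
      have hl3 := hl2.congr (s' := s₁) (f1.arr 11 (by decide)) (f1.arr 12 (by decide))
      obtain ⟨t2, r29⟩ := hl3.step (p := 29) (y := z) (Or.inr ⟨rfl, rfl, rfl⟩)
        (by rw [f1.arr 0 (by decide), f1.reg 29 (by decide), a0]; exact hz)
        (by rw [f1.arr 8 (by decide), a8]; exact h8 z)
        ((f1.reg 32 (by decide)).trans e32) ((f1.reg 20 (by decide)).trans e20)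
      have f2 := (runs_eval (tokenBlock 29 11 12) rfl s₁).frame
      set s₂ := (tokenBlock 29 11 12).eval s₁
      have hev : tokenBody.eval s' = s₂.setReg 28 (s₂.reg 28 - 1) := rfl
      rw [hev]
      refine ⟨k'.length, by omega, k ++ [y], k', l ++ [z], l', by simp, by simp, ?_, by omega,
        le_rfl, ?_, ?_, t1.congr (f2.arr 9 (by decide)) (f2.arr 10 (by decide)),
        t2.congr rfl rfl⟩
      · rw [State.reg_setReg, if_pos rfl, f2.reg 28 (by decide), f1.reg 28 (by decide), e28,
          Nat.add_sub_cancel]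
      · rw [State.reg_setReg, if_neg (by decide), f2.reg 27 (by decide), r27]
        exact hk'
      · rw [State.reg_setReg, if_neg (by decide), r29, f1.reg 29 (by decide)]
        exact hl')
    ls.length ⟨[], ls, [], lt, rfl, rfl, h28, hlen, le_rfl, h27, h29,
      ⟨by simp [h9], by simp [h10]⟩, ⟨by simp [h11], by simp [h12]⟩⟩
  obtain ⟨k, k', l, l', rfl, rfl, e28, hl, -, -, -, hk, hl2⟩ := hI
  have e20 := (hF.reg 20 (by decide)).trans h20
  simp only [Test.Holds, e20, e28, not_lt, Nat.le_zero, List.length_eq_zero_iff] at hb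
  subst hb
  obtain rfl : l' = [] := List.length_eq_zero_iff.1 hl.symm
  exact ⟨s', hr, by simpa using hk, by simpa using hl2⟩

/-! ### The program: output of the moves -/

/-- The machine has written `out`. -/
def HasOutput (s : State) (out : List ℕ) : Prop :=
  s.reg 0 = out.length ∧ Reads (s.arr 1) 0 out

theorem HasOutput.output_eq {s : State} {out : List ℕ} (h : HasOutput s out) : s.output = out := by
  have := h.2.map_range
  simp only [zero_add] at this
  rw [State.output, h.1, this]

theorem hasOutput_setReg {s : State} {x v : ℕ} {out : List ℕ} (hx : x ≠ 0) :
    HasOutput (s.setReg x v) out ↔ HasOutput s out := by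
  simp [HasOutput, hx.symm]

theorem HasOutput.append {s s' : State} {out out' : List ℕ} (h : HasOutput s out)
    (h0 : s'.reg 0 = s.reg 0 + out'.length) (hlt : ∀ j < s.reg 0, s'.arr 1 j = s.arr 1 j)
    (h' : Reads (s'.arr 1) (s.reg 0) out') : HasOutput s' (out ++ out') := by
  refine ⟨by rw [h0, h.1, List.length_append], reads_append.2 ⟨?_, ?_⟩⟩
  · exact h.2.congr fun i _ hi => hlt i (by rw [h.1]; omega)
  · rw [zero_add, ← h.1]; exact h'

theorem HasOutput.append_pair {s s' : State} {out : List ℕ} {x y : ℕ} (h : HasOutput s out)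
    (h0 : s'.reg 0 = s.reg 0 + 2)
    (h1 : ∀ j, s'.arr 1 j = if j = s.reg 0 + 1 then y else if j = s.reg 0 then x else s.arr 1 j) :
    HasOutput s' (out ++ [x, y]) := by
  refine h.append h0 (fun j hj => ?_) ⟨by simp [h1], by simp [h1], trivial⟩
  rw [h1, if_neg (by omega), if_neg (by omega)]

/-- Move the token of the next class to its center. -/
def pushBody : Prog :=
  .pred 36 ;; .load 37 3 36 ;; .load 38 7 37 ;;
    .ite (.ne 38 20)
      (.load 38 10 37 ;; .pred 38 ;;
        .ite (.ne 38 37) (.store 1 0 38 ;; .succ 0 ;; .store 1 0 37 ;; .succ 0) .skip)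
      .skip

/-- Reading the visiting order from its end produces the centers by decreasing rank, as `push_list`
demands. -/
theorem runs_push {C : Finset (Fin n)} {tok : Fin n → Fin n} {q : List (Fin n)} {out : List ℕ}
    (s : State) (hout : HasOutput s out) (h36 : s.reg 36 = q.length) (h20 : s.reg 20 = 0)
    (h3 : Reads (s.arr 3) 0 (q.map Fin.val))
    (h7 : ∀ v : Fin n, s.arr 7 v = if v ∈ C then 1 else 0)
    (h10 : ∀ v ∈ C, s.arr 10 v = tok v + 1) :
    ∃ s', Runs (.loop (.lt 20 36) pushBody) s (q.length * (pushBody.size + 1) + 1) s' ∧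
      HasOutput s' (out ++ encodeMoves (pushMoves tok (q.filter (· ∈ C)).reverse)) := by
  obtain ⟨s', hr, hb, hF, m', hI⟩ := runs_loop (.lt 20 36) pushBody rfl
    (fun m s' => ∃ l l', q = l ++ l' ∧ s'.reg 36 = l.length ∧ l.length ≤ m ∧
      HasOutput s' (out ++ encodeMoves (pushMoves tok (l'.filter (· ∈ C)).reverse))) s
    (by
      rintro m s' hF ⟨l, l', rfl, e36, hm, hS⟩ hb
      have e20 := (hF.reg 20 (by decide)).trans h20
      simp only [Test.Holds, e20, e36] at hb
      obtain ⟨l, v, rfl⟩ : ∃ k v, l = k ++ [v] :=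
        ⟨l.dropLast, l.getLast (List.ne_nil_of_length_pos hb),
          (List.dropLast_append_getLast _).symm⟩
      rw [List.length_append, List.length_singleton] at e36 hm
      have e3 : s'.arr 3 l.length = v := by
        rw [hF.arr 3 (by decide)]
        simpa using h3.getElem? (i := l.length) (x := v) (by simp)
      have e7 : s'.arr 7 v = if v ∈ C then 1 else 0 := by rw [hF.arr 7 (by decide)]; exact h7 v
      have e10 : v ∈ C → s'.arr 10 v = tok v + 1 := by rw [hF.arr 10 (by decide)]; exact h10 v
      refine ⟨l.length, by omega, l, v :: l', by simp, ?_, le_rfl, ?_⟩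
      · by_cases hv : v ∈ C
        · by_cases ht : tok v = v
          · simp [pushBody, Prog.eval, Test.Holds, e36, e3, e7, e20, hv, e10 hv, ht]
          · have ht' : (tok v : ℕ) ≠ v := fun e => ht (Fin.ext e)
            simp [pushBody, Prog.eval, Test.Holds, e36, e3, e7, e20, hv, e10 hv, ht']
        · simp [pushBody, Prog.eval, Test.Holds, e36, e3, e7, e20, hv]
      · by_cases hv : v ∈ C
        · by_cases ht : tok v = v
          · have hl : pushMoves tok ((v :: l').filter (· ∈ C)).reverse =
                pushMoves tok (l'.filter (· ∈ C)).reverse := by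
              simp [pushMoves, hv, ht]
            rw [hl]
            simpa [hasOutput_setReg, pushBody, Prog.eval, Test.Holds, e36, e3, e7, e20, hv, e10 hv, ht] using hS
          · have ht' : (tok v : ℕ) ≠ v := fun e => ht (Fin.ext e)
            have hl : encodeMoves (pushMoves tok ((v :: l').filter (· ∈ C)).reverse) =
                encodeMoves (pushMoves tok (l'.filter (· ∈ C)).reverse) ++ [(tok v : ℕ), (v : ℕ)] := by
              simp [pushMoves, hv, ht, encodeMoves]
            rw [hl, ← List.append_assoc]
            apply hS.append_pair <;>
            simp [pushBody, Prog.eval, Test.Holds, e36, e3, e7, e20, hv, e10 hv, ht']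
        · have hl : pushMoves tok ((v :: l').filter (· ∈ C)).reverse =
              pushMoves tok (l'.filter (· ∈ C)).reverse := by
            simp [pushMoves, hv]
          rw [hl]
          simpa [hasOutput_setReg, pushBody, Prog.eval, Test.Holds, e36, e3, e7, e20, hv] using hS)
    q.length ⟨q, [], by simp, h36, le_rfl, by simpa [pushMoves, encodeMoves] using hout⟩
  obtain ⟨l, l', rfl, e36, -, hS⟩ := hI
  have e20 := (hF.reg 20 (by decide)).trans h20
  simp only [Test.Holds, e20, e36, not_lt, Nat.le_zero, List.length_eq_zero_iff] at hb
  subst hb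
  exact ⟨s', hr, hS⟩

/-- Move the token on the next center to where the target set has its token of this class. -/
def pullBody : Prog :=
  .load 47 3 46 ;; .succ 46 ;; .load 48 7 47 ;;
    .ite (.ne 48 20)
      (.load 48 12 47 ;; .pred 48 ;;
        .ite (.ne 48 47) (.store 1 0 47 ;; .succ 0 ;; .store 1 0 48 ;; .succ 0) .skip)
      .skip

theorem runs_pull {C : Finset (Fin n)} {tok : Fin n → Fin n} {q : List (Fin n)} {out : List ℕ}
    (s : State) (hout : HasOutput s out) (h46 : s.reg 46 = 0) (h1 : s.reg 1 = q.length)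
    (h20 : s.reg 20 = 0) (h3 : Reads (s.arr 3) 0 (q.map Fin.val))
    (h7 : ∀ v : Fin n, s.arr 7 v = if v ∈ C then 1 else 0)
    (h12 : ∀ v ∈ C, s.arr 12 v = tok v + 1) :
    ∃ s', Runs (.loop (.lt 46 1) pullBody) s (q.length * (pullBody.size + 1) + 1) s' ∧
      HasOutput s' (out ++ encodeMoves
        (((q.filter (· ∈ C)).filter fun x => tok x ≠ x).map fun x => (x, tok x))) := by
  obtain ⟨s', hr, hb, hF, m', hI⟩ := runs_loop (.lt 46 1) pullBody rfl
    (fun m s' => ∃ l l', q = l ++ l' ∧ s'.reg 46 = l.length ∧ l'.length ≤ m ∧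
      HasOutput s' (out ++ encodeMoves
        (((l.filter (· ∈ C)).filter fun x => tok x ≠ x).map fun x => (x, tok x)))) s
    (by
      rintro m s' hF ⟨l, l', rfl, e46, hm, hS⟩ hb
      have e20 := (hF.reg 20 (by decide)).trans h20
      have e1 := (hF.reg 1 (by decide)).trans h1
      simp only [Test.Holds, e1, e46, List.length_append] at hb
      obtain _ | ⟨v, l'⟩ := l'
      · simp at hb
      rw [List.length_cons] at hm
      have e3 : s'.arr 3 l.length = v := by
        rw [hF.arr 3 (by decide)]
        simpa using h3.getElem? (i := l.length) (x := v) (by simp)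
      have e7 : s'.arr 7 v = if v ∈ C then 1 else 0 := by rw [hF.arr 7 (by decide)]; exact h7 v
      have e12 : v ∈ C → s'.arr 12 v = tok v + 1 := by rw [hF.arr 12 (by decide)]; exact h12 v
      refine ⟨l'.length, by omega, l ++ [v], l', by simp, ?_, le_rfl, ?_⟩
      · by_cases hv : v ∈ C
        · by_cases ht : tok v = v
          · simp [pullBody, Prog.eval, Test.Holds, e46, e3, e7, e20, hv, e12 hv, ht]
          · have ht' : (tok v : ℕ) ≠ v := fun e => ht (Fin.ext e)
            simp [pullBody, Prog.eval, Test.Holds, e46, e3, e7, e20, hv, e12 hv, ht']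
        · simp [pullBody, Prog.eval, Test.Holds, e46, e3, e7, e20, hv]
      · by_cases hv : v ∈ C
        · by_cases ht : tok v = v
          · have hl : ((l ++ [v]).filter (· ∈ C)).filter (fun x => tok x ≠ x) =
                (l.filter (· ∈ C)).filter (fun x => tok x ≠ x) := by
              simp [hv, ht]
            rw [hl]
            simpa [hasOutput_setReg, pullBody, Prog.eval, Test.Holds, e46, e3, e7, e20, hv, e12 hv, ht] using hS
          · have ht' : (tok v : ℕ) ≠ v := fun e => ht (Fin.ext e)
            have hl : encodeMoves ((((l ++ [v]).filter (· ∈ C)).filter fun x => tok x ≠ x).map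
                fun x => (x, tok x)) = encodeMoves (((l.filter (· ∈ C)).filter
                fun x => tok x ≠ x).map fun x => (x, tok x)) ++ [(v : ℕ), (tok v : ℕ)] := by
              simp [hv, ht, encodeMoves]
            rw [hl, ← List.append_assoc]
            apply hS.append_pair <;>
            simp [pullBody, Prog.eval, Test.Holds, e46, e3, e7, e20, hv, e12 hv, ht']
        · have hl : ((l ++ [v]).filter (· ∈ C)).filter (fun x => tok x ≠ x) =
              (l.filter (· ∈ C)).filter (fun x => tok x ≠ x) := by
            simp [hv]
          rw [hl]
          simpa [hasOutput_setReg, pullBody, Prog.eval, Test.Holds, e46, e3, e7, e20, hv] using hS)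
    q.length ⟨[], q, by simp, h46, le_rfl, by simpa [encodeMoves] using hout⟩
  obtain ⟨l, l', rfl, e46, -, hS⟩ := hI
  have e1 := (hF.reg 1 (by decide)).trans h1
  simp only [Test.Holds, e46, e1, not_lt, List.length_append] at hb
  obtain rfl : l' = [] := List.length_eq_zero_iff.1 (by omega)
  exact ⟨s', hr, by simpa using hS⟩

/-- Compute for the vertex in register `41` whether its token is to be moved away and whether a
token is to be moved there. -/
def flagBlock : Prog :=
  .load 42 9 41 ;; .load 44 8 41 ;; .load 45 10 44 ;; .pred 45 ;;
    .ite (.eq 45 41) (.const 42 0) .skip ;;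
    .load 43 11 41 ;; .load 45 12 44 ;; .pred 45 ;; .ite (.eq 45 41) (.const 43 0) .skip

/-- Write the sources and the targets of the remaining tokens. -/
def middleBody : Prog :=
  flagBlock ;;
    .ite (.lt 43 42) (.store 1 39 41 ;; .succ 39 ;; .succ 39)
      (.ite (.lt 42 43) (.store 1 40 41 ;; .succ 40 ;; .succ 40) .skip) ;;
    .succ 41

theorem eval_flagBlock {rep toks tokt : Fin n → Fin n} {Ds Dt : Finset (Fin n)} (s : State)
    {v : Fin n} (h41 : s.reg 41 = v) (h8 : s.arr 8 v = rep v)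
    (h9 : s.arr 9 v = if v ∈ Ds then 1 else 0) (h10 : s.arr 10 (rep v) = toks (rep v) + 1)
    (h11 : s.arr 11 v = if v ∈ Dt then 1 else 0) (h12 : s.arr 12 (rep v) = tokt (rep v) + 1) :
    (flagBlock.eval s).reg 42 = (if v ∈ extra rep Ds toks then 1 else 0) ∧
      (flagBlock.eval s).reg 43 = if v ∈ extra rep Dt tokt then 1 else 0 := by
  have es : (toks (rep v) : ℕ) = v ↔ toks (rep v) = v := Fin.val_inj
  have et : (tokt (rep v) : ℕ) = v ↔ tokt (rep v) = v := Fin.val_inj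
  by_cases hs : toks (rep v) = v
  · by_cases ht : tokt (rep v) = v
    · simp [flagBlock, Prog.eval, Test.Holds, h41, h8, h10, h12, hs, ht, extra]
    · simp [flagBlock, Prog.eval, Test.Holds, h41, h8, h10, h11, h12, hs, ht, et, extra]
  · by_cases ht : tokt (rep v) = v
    · simp [flagBlock, Prog.eval, Test.Holds, h41, h8, h9, h10, h12, hs, ht, es, extra]
    · simp [flagBlock, Prog.eval, Test.Holds, h41, h8, h9, h10, h11, h12, hs, ht, es, et, extra]

/-- The cells `p`, `p + 2`, … of `f` contain the list `l`. -/
def ReadsEven (f : ℕ → ℕ) (p : ℕ) (l : List (Fin n)) : Prop :=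
  ∀ (i : ℕ) (v : Fin n), l[i]? = some v → f (p + 2 * i) = v

theorem ReadsEven.concat {f g : ℕ → ℕ} {p : ℕ} {l : List (Fin n)} {v : Fin n}
    (h : ReadsEven f p l) (hg : ∀ i < l.length, g (p + 2 * i) = f (p + 2 * i))
    (hv : g (p + 2 * l.length) = v) : ReadsEven g p (l ++ [v]) := by
  intro i w hw
  by_cases hi : i < l.length
  · rw [List.getElem?_append_left hi] at hw
    rw [hg i hi, h i w hw]
  · rw [List.getElem?_append_right (by omega)] at hw
    have := List.getElem?_eq_some_iff.1 hw
    obtain ⟨h1, h2⟩ := this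
    simp only [List.length_singleton] at h1
    obtain rfl : i = l.length := by omega
    simp at h2
    rw [hv, h2]

theorem ReadsEven.congr {f g : ℕ → ℕ} {p : ℕ} {l : List (Fin n)} (h : ReadsEven f p l)
    (hg : ∀ i < l.length, g (p + 2 * i) = f (p + 2 * i)) : ReadsEven g p l := by
  intro i w hw
  rw [hg i (List.getElem?_eq_some_iff.1 hw).1, h i w hw]

theorem reads_encodeMoves_zip {f : ℕ → ℕ} {p : ℕ} {l l' : List (Fin n)}
    (hlen : l.length = l'.length) (h : ReadsEven f p l) (h' : ReadsEven f (p + 1) l') :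
    Reads f p (encodeMoves (l.zip l')) := by
  induction l generalizing l' p with
  | nil => simp [encodeMoves, Reads]
  | cons x l ih =>
    obtain _ | ⟨y, l'⟩ := l'
    · simp at hlen
    · have e : encodeMoves ((x :: l).zip (y :: l')) = (x : ℕ) :: (y : ℕ) :: encodeMoves (l.zip l') := by
        simp [encodeMoves]
      rw [e]
      refine ⟨h 0 x rfl, h' 0 y rfl, ih (by simpa using hlen) ?_ ?_⟩
      · intro i v hv
        have := h (i + 1) v (by simpa using hv)
        rwa [show p + 1 + 1 + 2 * i = p + 2 * (i + 1) by ring]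
      · intro i v hv
        have := h' (i + 1) v (by simpa using hv)
        rwa [show p + 1 + 1 + 1 + 2 * i = p + 1 + 2 * (i + 1) by ring]

theorem length_encodeMoves (m : List (Fin n × Fin n)) : (encodeMoves m).length = 2 * m.length := by
  induction m with
  | nil => rfl
  | cons a m ih =>
    simp only [encodeMoves, List.flatMap_cons, List.length_append, List.length_cons] at ih ⊢
    rw [ih]
    simp
    ring

/-- Sources and targets turn up at different times in one scan of the vertices. Two write positions
interleave them, sources at even and targets at odd distance from the start. Since both lists have
the same length, no gap remains and register `39` ends at the new end of the output. -/
theorem runs_middle {rep toks tokt : Fin n → Fin n} {Ds Dt : Finset (Fin n)} {C : Finset (Fin n)}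
    {out : List ℕ} (s : State) (hout : HasOutput s out) (h39 : s.reg 39 = s.reg 0)
    (h40 : s.reg 40 = s.reg 0 + 1) (h41 : s.reg 41 = 0) (h1 : s.reg 1 = n)
    (hrep : ∀ v, rep v ∈ C) (h8 : ∀ v : Fin n, s.arr 8 v = rep v)
    (h9 : ∀ v : Fin n, s.arr 9 v = if v ∈ Ds then 1 else 0)
    (h10 : ∀ x ∈ C, s.arr 10 x = toks x + 1)
    (h11 : ∀ v : Fin n, s.arr 11 v = if v ∈ Dt then 1 else 0)
    (h12 : ∀ x ∈ C, s.arr 12 x = tokt x + 1)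
    (hlen : ((List.finRange n).filter
        fun v => v ∈ extra rep Ds toks ∧ v ∉ extra rep Dt tokt).length =
      ((List.finRange n).filter fun v => v ∈ extra rep Dt tokt ∧ v ∉ extra rep Ds toks).length) :
    ∃ s', Runs (.seq (.loop (.lt 41 1) middleBody) (.copy 0 39)) s
        (n * (middleBody.size + 1) + 1 + 1) s' ∧
      HasOutput s' (out ++ encodeMoves
        (((List.finRange n).filter fun v => v ∈ extra rep Ds toks ∧ v ∉ extra rep Dt tokt).zip
          ((List.finRange n).filter
            fun v => v ∈ extra rep Dt tokt ∧ v ∉ extra rep Ds toks))) := by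
  set F := fun l : List (Fin n) => l.filter fun v => v ∈ extra rep Ds toks ∧ v ∉ extra rep Dt tokt
    with hFdef
  set G := fun l : List (Fin n) => l.filter fun v => v ∈ extra rep Dt tokt ∧ v ∉ extra rep Ds toks
    with hGdef
  obtain ⟨s', hr, hb, hF, m', hI⟩ := runs_loop (.lt 41 1) middleBody rfl
    (fun m s' => ∃ l l', List.finRange n = l ++ l' ∧ s'.reg 41 = l.length ∧ l'.length ≤ m ∧
      s'.reg 39 = s.reg 0 + 2 * (F l).length ∧ s'.reg 40 = s.reg 0 + 1 + 2 * (G l).length ∧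
      (∀ j < s.reg 0, s'.arr 1 j = s.arr 1 j) ∧ ReadsEven (s'.arr 1) (s.reg 0) (F l) ∧
      ReadsEven (s'.arr 1) (s.reg 0 + 1) (G l)) s
    (by
      rintro m s' hFr ⟨l, l', hl, e41, hm, e39, e40, hold, hS, hT⟩ hb
      have e1 := (hFr.reg 1 (by decide)).trans h1
      have hn : n = l.length + l'.length := by
        have := congrArg List.length hl
        simpa using this
      simp only [Test.Holds, e1, e41] at hb
      obtain _ | ⟨v, l'⟩ := l'
      · simp at hn; omega
      rw [List.length_cons] at hm
      have hv : (v : ℕ) = l.length := by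
        have h2 : (List.finRange n)[l.length]? = some v := by rw [hl]; simp
        obtain ⟨h3, h4⟩ := List.getElem?_eq_some_iff.1 h2
        rw [← h4]
        simp
      obtain ⟨b42, b43⟩ := eval_flagBlock (Ds := Ds) (Dt := Dt) (rep := rep) (toks := toks)
        (tokt := tokt) s' (v := v) (by rw [e41, hv])
        (by rw [hFr.arr 8 (by decide)]; exact h8 v)
        (by rw [hFr.arr 9 (by decide)]; exact h9 v)
        (by rw [hFr.arr 10 (by decide)]; exact h10 _ (hrep v))
        (by rw [hFr.arr 11 (by decide)]; exact h11 v)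
        (by rw [hFr.arr 12 (by decide)]; exact h12 _ (hrep v))
      have hf := (runs_eval flagBlock rfl s').frame
      set s₁ := flagBlock.eval s'
      have a1 : s₁.arr 1 = s'.arr 1 := hf.arr 1 (by decide)
      have r39 : s₁.reg 39 = _ := (hf.reg 39 (by decide)).trans e39
      have r40 : s₁.reg 40 = _ := (hf.reg 40 (by decide)).trans e40
      have r41 : s₁.reg 41 = _ := (hf.reg 41 (by decide)).trans e41
      have hev : middleBody.eval s' = Prog.eval (.ite (.lt 43 42)
        (.store 1 39 41 ;; .succ 39 ;; .succ 39)
        (.ite (.lt 42 43) (.store 1 40 41 ;; .succ 40 ;; .succ 40) .skip) ;; .succ 41) s₁ := rfl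
      rw [hev]
      refine ⟨l'.length, by omega, l ++ [v], l', by simp [hl], ?_⟩
      rw [← a1] at hS hT hold
      by_cases hs : v ∈ extra rep Ds toks
      · by_cases ht : v ∈ extra rep Dt tokt
        · have eF : F (l ++ [v]) = F l := by simp [hFdef, hs, ht]
          have eG : G (l ++ [v]) = G l := by simp [hGdef, hs, ht]
          rw [eF, eG]
          simp [Prog.eval, Test.Holds, b42, b43, hs, ht, r39, r40, r41]
          exact ⟨hold, hS, hT⟩
        · have eF : F (l ++ [v]) = F l ++ [v] := by simp [hFdef, hs, ht]
          have eG : G (l ++ [v]) = G l := by simp [hGdef, hs, ht]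
          rw [eF, eG]
          simp [Prog.eval, Test.Holds, b42, b43, hs, ht, r39, r40, r41]
          refine ⟨by ring, fun j hj => ?_, hS.concat (fun i hi => ?_) ?_, hT.congr fun i hi => ?_⟩
          · simp [show j ≠ s.reg 0 + 2 * (F l).length by omega, hold j hj]
          · simp [show i ≠ (F l).length by omega]
          · simp [hv]
          · simp [show s.reg 0 + 1 + 2 * i ≠ s.reg 0 + 2 * (F l).length by omega]
      · by_cases ht : v ∈ extra rep Dt tokt
        · have eF : F (l ++ [v]) = F l := by simp [hFdef, hs, ht]
          have eG : G (l ++ [v]) = G l ++ [v] := by simp [hGdef, hs, ht]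
          rw [eF, eG]
          simp [Prog.eval, Test.Holds, b42, b43, hs, ht, r39, r40, r41]
          refine ⟨by ring, fun j hj => ?_, hS.congr fun i hi => ?_, hT.concat (fun i hi => ?_) ?_⟩
          · simp [show j ≠ s.reg 0 + 1 + 2 * (G l).length by omega, hold j hj]
          · simp [show s.reg 0 + 2 * i ≠ s.reg 0 + 1 + 2 * (G l).length by omega]
          · simp [show i ≠ (G l).length by omega]
          · simp [hv]
        · have eF : F (l ++ [v]) = F l := by simp [hFdef, hs, ht]
          have eG : G (l ++ [v]) = G l := by simp [hGdef, hs, ht]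
          rw [eF, eG]
          simp [Prog.eval, Test.Holds, b42, b43, hs, ht, r39, r40, r41]
          exact ⟨hold, hS, hT⟩)
    n ⟨[], List.finRange n, by simp, h41, by simp, by simp [hFdef, h39], by simp [hGdef, h40],
      fun _ _ => rfl, by simp [hFdef, ReadsEven], by simp [hGdef, ReadsEven]⟩
  obtain ⟨l, l', hl, e41, hm, e39, e40, hold, hS, hT⟩ := hI
  have e1 := (hF.reg 1 (by decide)).trans h1
  have hn : n = l.length + l'.length := by
    have := congrArg List.length hl
    simpa using this
  simp only [Test.Holds, e1, e41] at hb
  obtain rfl : l' = [] := List.length_eq_zero_iff.1 (by omega)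
  rw [List.append_nil] at hl
  rw [← hl] at e39 hS hT
  refine ⟨_, hr.seq (runs_eval (.copy 0 39) rfl s'), hout.append ?_ ?_ ?_⟩
  · simp only [Prog.eval, State.reg_setReg, if_true, e39, length_encodeMoves, List.length_zip]
    rw [← hlen, min_self]
  · simpa [Prog.eval] using hold
  · simpa only [Prog.eval, State.arr_setReg] using reads_encodeMoves_zip hlen hS hT

end

/-! ### Canonical partitions and reconfigurability -/

section

variable {V : Type*} [DecidableEq V] [Fintype V] {T : SimpleGraph V} {adj : V → List V}

/-- The order in which a breadth-first search from `root` visits the vertices. -/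
def bfsOrder (adj : V → List V) (root : V) : List V := (search adj root (Fintype.card V)).order

/-- The parents of the vertices in a breadth-first search from `root`. -/
def bfsParent (adj : V → List V) (root : V) : V → V := (search adj root (Fintype.card V)).par

/-- The result of the dynamic program. -/
def bfsSelect (adj : V → List V) (root : V) (r : ℕ) : Selection V :=
  select root (bfsParent adj root) r (bfsOrder adj root)

omit [Fintype V] in
theorem pairwise_idxOf_lt {l : List V} (hl : l.Nodup) :
    l.Pairwise fun a b => l.idxOf a < l.idxOf b := by
  rw [List.pairwise_iff_getElem]
  intro i j hi hj hij
  rwa [hl.idxOf_getElem, hl.idxOf_getElem]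

theorem exists_isRep_bfs (hT : T.IsTree) (hadj : ∀ v w, w ∈ adj v ↔ T.Adj v w) (root : V) (r : ℕ) :
    ∃ dep rep,
      IsRooted T root (bfsParent adj root) dep (fun v => (bfsOrder adj root).idxOf v) ∧
      IsGreedy root (bfsParent adj root) r (bfsSelect adj root r).need
        (bfsSelect adj root r).slack (bfsSelect adj root r).centers ∧
      IsRep root (bfsParent adj root) (fun v => (bfsOrder adj root).idxOf v)
        (bfsSelect adj root r).centers (bfsSelect adj root r).first rep := by
  obtain ⟨dep, hR⟩ := search_isRooted (root := root) hT hadj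
  have hmem := mem_search (root := root) hT.connected hadj
  have hpw := pairwise_idxOf_lt (search_valid (adj := adj) (root := root) (Fintype.card V)).nodup
  have hG := select_isGreedy (r := r) hpw hR.rk_par hmem
  have hv := select_valid (r := r) _ hpw hR.rk_par
  -- There is at least one center, because the root is dominated; so `first` is a center.
  obtain ⟨z, hz, -⟩ := hG.isDrDS hR root
  obtain ⟨rep, hrep⟩ := exists_isRep hR (hv.first_mem ⟨z, hz⟩) hv.first_le
  exact ⟨dep, rep, hR, hG, hrep⟩

theorem mem_bfsOrder (hT : T.IsTree) (hadj : ∀ v w, w ∈ adj v ↔ T.Adj v w) (root v : V) :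
    v ∈ bfsOrder adj root := mem_search hT.connected hadj v

omit [Fintype V] in
theorem exists_isTok {C D : Finset V} {rep : V → V} (hrep : ∀ x ∈ C, rep x = x)
    (h : ∀ x ∈ C, ∃ v ∈ D, rep v = x) : ∃ tok, IsTok C rep D tok := by
  have : ∀ x, ∃ y, x ∈ C → y ∈ D ∧ rep y = x ∧ (x ∈ D → y = x) := by
    intro x
    by_cases hx : x ∈ C
    · by_cases hxD : x ∈ D
      · exact ⟨x, fun _ => ⟨hxD, hrep x hx, fun _ => rfl⟩⟩
      · obtain ⟨y, hy, hyx⟩ := h x hx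
        exact ⟨y, fun _ => ⟨hy, hyx, fun h => absurd h hxD⟩⟩
    · exact ⟨x, fun h => absurd h hx⟩
  choose tok htok using this
  exact ⟨tok, htok⟩

omit [DecidableEq V] in
theorem exists_adjacency (T : SimpleGraph V) : ∃ adj : V → List V, ∀ v w, w ∈ adj v ↔ T.Adj v w := by
  classical
  exact ⟨fun v => (Finset.univ.filter fun w => T.Adj v w).toList, by simp⟩

theorem pairwise_centers (hT : T.IsTree) (hadj : ∀ v w, w ∈ adj v ↔ T.Adj v w) (root : V)
    (C : Finset V) :
    (((bfsOrder adj root).filter (· ∈ C)).Pairwise fun a b =>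
      (bfsOrder adj root).idxOf a < (bfsOrder adj root).idxOf b) ∧
    ∀ v, v ∈ (bfsOrder adj root).filter (· ∈ C) ↔ v ∈ C :=
  ⟨(pairwise_idxOf_lt (search_valid _).nodup).filter _, fun v => by
    simp [mem_bfsOrder hT hadj root v]⟩

theorem exists_isCanonicalPartition (hT : T.IsTree) (r : ℕ) :
    ∃ (D : Finset V) (rep : V → V), IsCanonicalPartition T r D rep := by
  obtain ⟨adj, hadj⟩ := exists_adjacency T
  obtain ⟨root⟩ := hT.connected.nonempty
  obtain ⟨dep, rep, hR, hG, hrep⟩ := exists_isRep_bfs hT hadj root r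
  exact ⟨_, rep, hrep.isCanonicalPartition hR hG hT.isAcyclic⟩

theorem tjReconfigurable_iff (hT : T.IsTree) {r : ℕ} {Ds Dt : Finset V} (hs : IsDrDS T r Ds)
    (ht : IsDrDS T r Dt) : TJReconfigurable T r Ds Dt ↔ Ds.card = Dt.card := by
  refine ⟨fun ⟨m, h⟩ => h.card_eq, fun hcard => ?_⟩
  obtain ⟨adj, hadj⟩ := exists_adjacency T
  obtain ⟨root⟩ := hT.connected.nonempty
  obtain ⟨dep, rep, hR, hG, hrep⟩ := exists_isRep_bfs hT hadj root r
  obtain ⟨toks, htoks⟩ := exists_isTok hrep.rep_center fun x => hrep.meets hR hG hs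
  obtain ⟨tokt, htokt⟩ := exists_isTok hrep.rep_center fun x => hrep.meets hR hG ht
  obtain ⟨h1, h2⟩ := pairwise_centers hT hadj root (bfsSelect adj root r).centers
  exact ⟨_, tjSequence_allMoves hR hG hrep _ h1 h2 hs ht htoks htokt hcard Finset.univ.toList
    (Finset.nodup_toList _) (by simp)⟩

end

/-! ### The whole program -/

theorem Runs.iteTrue {b : Test} {p q : Prog} {s s' : State} {t : ℕ} (hb : b.Holds s)
    (h : Runs p s t s') : Runs (.ite b p q) s (1 + t) s' :=
  let ⟨u, hu, h⟩ := h
  ⟨1 + u, by omega, .iteTrue hb h⟩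

theorem Runs.iteFalse {b : Test} {p q : Prog} {s s' : State} {t : ℕ} (hb : ¬ b.Holds s)
    (h : Runs q s t s') : Runs (.ite b p q) s (1 + t) s' :=
  let ⟨u, hu, h⟩ := h
  ⟨1 + u, by omega, .iteFalse hb h⟩

/-- Prepare the parsing of the input. -/
def scanInit : Prog := .load 1 0 20 ;; .copy 2 1 ;; .succ 2 ;; .succ 2 ;; .const 4 1

/-- Prepare the search and the dynamic program. -/
def searchInit (r : ℕ) : Prog :=
  .const 7 1 ;; .load 9 2 20 ;; .load 10 0 9 ;; .succ 9 ;; .const 22 1 ;; .store 4 20 22 ;;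
    .copy 13 1 ;; .copy 36 1 ;; .const 21 (r + 1)

/-- Compute the partition. -/
def partitionProg (r : ℕ) : Prog :=
  scanInit ;; .loop (.lt 3 2) scanBody ;; searchInit r ;; .loop (.lt 6 7) searchBody ;;
    .loop (.lt 20 13) selectBody ;; .loop (.lt 23 1) repBody

/-- Find the two dominating sets and their sizes. -/
def compareInit : Prog :=
  .load 27 2 1 ;; .load 28 0 27 ;; .copy 30 1 ;; .succ 30 ;; .load 29 2 30 ;; .load 31 0 29 ;;
    .copy 0 30 ;; .succ 27 ;; .succ 29 ;; .const 32 1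

/-- Output the moves. -/
def movesProg : Prog :=
  .store 1 20 32 ;; .loop (.lt 20 28) tokenBody ;; .loop (.lt 20 36) pushBody ;;
    (.copy 39 0 ;; .copy 40 0 ;; .succ 40) ;;
    (.loop (.lt 41 1) middleBody ;; .copy 0 39) ;; .loop (.lt 46 1) pullBody

/-- The whole program. -/
def mainProg (r : ℕ) : Prog :=
  partitionProg r ;; compareInit ;; .ite (.eq 28 31) movesProg .skip

section

variable {n : ℕ} {T : SimpleGraph (Fin n)} {adj : Fin n → List (Fin n)}

theorem encodeInstance_eq (adj : Fin n → List (Fin n)) (ls lt : List (Fin n)) :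
    encodeInstance adj ls lt = n :: ((List.ofFn adj ++ [ls, lt]).map encodeList).flatten := by
  simp [encodeInstance, List.map_ofFn, Function.comp_def]

/-- Handshake lemma with `n - 1` edges: this makes the input and the search linear in `n`. -/
theorem sum_length_adj (hT : T.IsTree) (hadj : IsAdjacencyList T adj) :
    ∑ v, ((adj v).length + 1) + 2 = 3 * n := by
  classical
  have h1 : ∀ v, (adj v).length = T.degree v := by
    intro v
    rw [← List.toFinset_card_of_nodup (hadj v).1, ← T.card_neighborFinset_eq_degree]
    congr 1
    ext w
    simp [(hadj v).2 w]
  have h2 := T.sum_degrees_eq_twice_card_edges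
  have h3 := hT.card_edgeFinset
  rw [Fintype.card_fin] at h3
  simp only [h1, Finset.sum_add_distrib, h2, Finset.sum_const, Finset.card_univ, Fintype.card_fin]
  simp
  omega

theorem offset_length (ls lt : List (Fin n)) :
    offset (List.ofFn adj ++ [ls, lt]) (n + 2) =
      ∑ v, ((adj v).length + 1) + ls.length + lt.length + 3 := by
  rw [offset, List.take_of_length_le (by simp), List.map_append, List.sum_append, List.map_ofFn,
    List.sum_ofFn]
  simp
  ring

/-- The memory after the computation of the partition. -/
structure HasPartition (s : State) (order : List (Fin n)) (C : Finset (Fin n))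
    (rep : Fin n → Fin n) (ls lt : List (Fin n)) : Prop where
  size : s.reg 1 = n
  size' : s.reg 36 = n
  zero : ∀ x ∈ [20, 41, 46], s.reg x = 0
  reads_order : Reads (s.arr 3) 0 (order.map Fin.val)
  centers : ∀ v : Fin n, s.arr 7 v = if v ∈ C then 1 else 0
  rep_eq : ∀ v : Fin n, s.arr 8 v = rep v
  out : s.arr 1 0 = 0 ∧ ∀ v : Fin n, s.arr 1 (v + 1) = rep v
  empty : ∀ a ∈ [9, 10, 11, 12], ∀ i, s.arr a i = 0
  source : s.arr 0 (s.arr 2 n) = ls.length ∧ Reads (s.arr 0) (s.arr 2 n + 1) (ls.map Fin.val)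
  target : s.arr 0 (s.arr 2 (n + 1)) = lt.length ∧
    Reads (s.arr 0) (s.arr 2 (n + 1) + 1) (lt.map Fin.val)

theorem runs_partition {root : Fin n} (hroot : (root : ℕ) = 0) (r : ℕ) (hT : T.IsTree)
    (hadj : IsAdjacencyList T adj) {dep : Fin n → ℕ} {rep : Fin n → Fin n}
    (hR : IsRooted T root (bfsParent adj root) dep (fun v => (bfsOrder adj root).idxOf v))
    (hrep : IsRep root (bfsParent adj root) (fun v => (bfsOrder adj root).idxOf v)
        (bfsSelect adj root r).centers (bfsSelect adj root r).first rep) {ls lt : List (Fin n)}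
    (hls : ls.length ≤ n) (hlt : lt.length ≤ n) :
    ∃ s, Runs (partitionProg r) (State.init (encodeInstance adj ls lt)) (200 * n) s ∧
      HasPartition s (bfsOrder adj root) (bfsSelect adj root r).centers rep ls lt := by
  have hadj' : ∀ v w, w ∈ adj v ↔ T.Adj v w := fun v => (hadj v).2
  have hn : 0 < n := root.pos
  set L := List.ofFn adj ++ [ls, lt] with hL
  have hLlen : L.length = n + 2 := by simp [hL]
  set s₀ := State.init (encodeInstance adj ls lt) with hs₀
  have hreads : Reads (s₀.arr 0) 0 (encodeInstance adj ls lt) := reads_getD _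
  rw [encodeInstance_eq] at hreads
  have hoff : ∀ i (hi : i < L.length), s₀.arr 0 (offset L i) = L[i].length ∧
      Reads (s₀.arr 0) (offset L i + 1) (L[i].map Fin.val) := hreads.2.offset L
  have i0 : s₀.arr 0 0 = n := hreads.1
  have hLv : ∀ v : Fin n, s₀.arr 0 (offset L v) = (adj v).length ∧
      Reads (s₀.arr 0) (offset L v + 1) ((adj v).map Fin.val) := by
    intro v
    have hv : (v : ℕ) < n := v.2
    have h := hoff v (by rw [hLlen]; omega)
    have e : L[(v : ℕ)]'(by rw [hLlen]; omega) = adj v := by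
      simp [hL]
    rwa [e] at h
  have hLs : s₀.arr 0 (offset L n) = ls.length ∧
      Reads (s₀.arr 0) (offset L n + 1) (ls.map Fin.val) := by
    have h := hoff n (by rw [hLlen]; omega)
    have e : L[n]'(by rw [hLlen]; omega) = ls := by
      simp [hL]
    rwa [e] at h
  have hLt : s₀.arr 0 (offset L (n + 1)) = lt.length ∧
      Reads (s₀.arr 0) (offset L (n + 1) + 1) (lt.map Fin.val) := by
    have h := hoff (n + 1) (by rw [hLlen]; omega)
    have e : L[n + 1]'(by rw [hLlen]; omega) = lt := by
      simp [hL]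
    rwa [e] at h
  have z : ∀ x, s₀.reg x = 0 := fun _ => rfl
  have za : ∀ a i, a ≠ 0 → s₀.arr a i = 0 := fun a i ha => if_neg ha
  -- parsing
  have R1 := runs_eval scanInit rfl s₀
  set s₁ := scanInit.eval s₀ with hs₁
  have a1 : s₁.arr = s₀.arr := by
    funext a
    exact R1.frame.arr a (by simp [scanInit, Prog.arrs])
  have hr1 : s₁.reg 1 = n ∧ s₁.reg 2 = n + 2 ∧ s₁.reg 4 = 1 := by
    simp [hs₁, scanInit, Prog.eval, i0, z]
  have f1 := R1.frame.reg
  obtain ⟨s₂, R2, hoff2⟩ := runs_scan L s₁ (by rw [hr1.2.1, hLlen])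
    ((f1 3 (by decide)).trans (z _)) hr1.2.2 ((f1 5 (by decide)).trans (z _))
    ((f1 20 (by decide)).trans (z _)) (fun i hi => by rw [a1]; exact (hoff i hi).1)
  have f2 := R2.frame.reg
  have g2 := R2.frame.arr
  have off2 : ∀ i < n + 2, s₂.arr 2 i = offset L i := fun i hi =>
    hoff2 i (by omega) (by omega)
  -- search
  have R3 := runs_eval (searchInit r) rfl s₂
  set s₃ := (searchInit r).eval s₂ with hs₃
  have z2 : s₂.reg 20 = 0 := (f2 20 (by decide)).trans ((f1 20 (by decide)).trans (z _))
  have o2 : s₂.arr 2 0 = offset L root := by rw [off2 0 (by omega), hroot]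
  have b2 : s₂.arr 0 = s₀.arr 0 := (g2 0 (by decide)).trans (by rw [a1])
  have n2 : s₂.reg 1 = n := (f2 1 (by decide)).trans hr1.1
  have hr3 : s₃.reg 7 = 1 ∧ s₃.reg 9 = offset L root + 1 ∧ s₃.reg 10 = (adj root).length ∧
      s₃.reg 22 = 1 ∧ s₃.reg 13 = n ∧ s₃.reg 36 = n ∧ s₃.reg 21 = r + 1 ∧
      ∀ i, s₃.arr 4 i = if i = 0 then 1 else s₂.arr 4 i := by
    simp [hs₃, searchInit, Prog.eval, z2, o2, b2, n2, (hLv root).1]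
  have f3 : ∀ x ∉ [7, 9, 10, 22, 13, 36, 21], s₃.reg x = s₂.reg x := fun x hx =>
    R3.frame.reg x (by simp only [searchInit, Prog.regs]; simp at hx ⊢; tauto)
  have g3 : ∀ a, a ≠ 4 → s₃.arr a = s₂.arr a := fun a ha =>
    R3.frame.arr a (by simpa [searchInit, Prog.arrs] using ha)
  have f03 : ∀ x ∉ [7, 9, 10, 22, 13, 36, 21], x ∉ scanBody.regs → x ∉ scanInit.regs →
      s₃.reg x = 0 := fun x h1 h2 h3 => (f3 x h1).trans ((f2 x h2).trans ((f1 x h3).trans (z x)))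
  have g03 : ∀ a, a ≠ 0 → a ≠ 2 → a ≠ 4 → ∀ i, s₃.arr a i = 0 := by
    intro a h0 h2 h4 i
    rw [g3 a h4, g2 a (by simpa [scanBody, Prog.arrs] using h2), a1, za a i h0]
  obtain ⟨s₄, R4, hQ⟩ := runs_search (adj := adj) (root := root) (offset L) s₃
    (f03 6 (by decide) (by decide) (by decide)) hr3.1
    ((f03 8 (by decide) (by decide) (by decide)).trans hroot.symm) hr3.2.1 hr3.2.2.1
    (f03 20 (by decide) (by decide) (by decide))
    (by rw [g03 3 (by decide) (by decide) (by decide), hroot])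
    (by
      intro v
      have hvr : (v : ℕ) = 0 ↔ v = root := by rw [← hroot, Fin.val_inj]
      rw [hr3.2.2.2.2.2.2.2 v, g2 4 (by decide), a1, za _ _ (by decide), hroot]
      simp [hvr])
    (by intro v; rw [g3 2 (by decide)]; exact off2 v (by omega))
    (by rw [g3 0 (by decide), b2]; exact hLv)
    (by simpa using length_search (root := root) hT.connected hadj')
  have hcard : search adj root n = search adj root (Fintype.card (Fin n)) := by
    rw [Fintype.card_fin]
  have ho : (search adj root n).order = bfsOrder adj root := by rw [hcard]; rfl
  have hp : (search adj root n).par = bfsParent adj root := by rw [hcard]; rfl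
  have hlen : (bfsOrder adj root).length = n := by
    simpa [bfsOrder] using length_search (root := root) hT.connected hadj'
  have hmem := mem_bfsOrder hT hadj' root
  have f4 := R4.frame.reg
  have g4 := R4.frame.arr
  have q4 : ∀ v : Fin n, s₄.arr 4 v = bfsParent adj root v + 1 := by
    intro v
    rw [hQ.par v, ho, hp, if_pos (hmem v)]
  have q3 := hQ.order
  rw [ho] at q3
  have hnd : (bfsOrder adj root).Nodup := (search_valid _).nodup
  have hpw := pairwise_idxOf_lt hnd
  have hidx0 : (bfsOrder adj root).idxOf root = 0 := by
    obtain ⟨t, ht⟩ := search_prefix (adj := adj) (root := root) (Nat.zero_le (Fintype.card (Fin n)))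
    have : bfsOrder adj root = [root] ++ t := ht.symm
    rw [this]
    simp
  -- selection
  have f04 : ∀ x ∉ [7, 9, 10, 22, 13, 36, 21], x ∉ scanBody.regs → x ∉ scanInit.regs →
      x ∉ searchBody.regs → s₄.reg x = 0 := fun x h1 h2 h3 h4 => (f4 x h4).trans (f03 x h1 h2 h3)
  have g04 : ∀ a, a ≠ 0 → a ≠ 2 → a ≠ 3 → a ≠ 4 → ∀ i, s₄.arr a i = 0 := by
    intro a h0 h2 h3 h4 i
    rw [g4 a (by simp [searchBody, Prog.arrs]; tauto), g03 a h0 h2 h4]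
  obtain ⟨s₅, R5, hS⟩ := runs_select (r := r) hpw hR.rk_par (fun v _ => by simp [hidx0]) s₄
    hroot ((f4 13 (by decide)).trans (hr3.2.2.2.2.1.trans hlen.symm)) q3 q4
    (f04 20 (by decide) (by decide) (by decide) (by decide))
    ((f4 21 (by decide)).trans hr3.2.2.2.2.2.2.1) ((f4 22 (by decide)).trans hr3.2.2.2.1)
    (f04 18 (by decide) (by decide) (by decide) (by decide))
    (g04 5 (by decide) (by decide) (by decide) (by decide))
    (g04 6 (by decide) (by decide) (by decide) (by decide))
    (g04 7 (by decide) (by decide) (by decide) (by decide))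
  have f5 := R5.frame.reg
  have g5 := R5.frame.arr
  -- partition
  obtain ⟨s₆, R6, hout0, hout⟩ := runs_rep hrep hR.rk_par hpw hmem hroot s₅
    ((f5 1 (by decide)).trans ((f4 1 (by decide)).trans
      ((f3 1 (by decide)).trans (n2.trans hlen.symm)))) hS.first
    ((f5 20 (by decide)).trans (f04 20 (by decide) (by decide) (by decide) (by decide)))
    ((f5 23 (by decide)).trans (f04 23 (by decide) (by decide) (by decide) (by decide)))
    (by rw [g5 3 (by decide)]; exact q3) (by rw [g5 4 (by decide)]; exact q4) hS.centers
    (by rw [g5 1 (by decide)]; exact g04 1 (by decide) (by decide) (by decide) (by decide) 0)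
  have f6 := R6.frame.reg
  have g6 := R6.frame.arr
  have b6 : s₆.arr 0 = s₀.arr 0 := (g6 0 (by decide)).trans ((g5 0 (by decide)).trans
    ((g4 0 (by decide)).trans ((g3 0 (by decide)).trans b2)))
  have c6 : s₆.arr 2 = s₂.arr 2 := (g6 2 (by decide)).trans ((g5 2 (by decide)).trans
    ((g4 2 (by decide)).trans (g3 2 (by decide))))
  refine ⟨s₆, (R1.seq (R2.seq (R3.seq (R4.seq (R5.seq R6))))).mono ?_, ?_⟩
  -- The scan covers at most `5 * n + 1` positions at cost `8`, the search has fuel `3 * n - 2` at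
  -- cost `18`, and the two passes over the order cost `35` and `14` per vertex. The total is below
  -- `143 * n`.
  · have t1 : ((bfsOrder adj root).map fun v => (adj v).length + 1).sum =
        ∑ v, ((adj v).length + 1) := by
      rw [← List.sum_toFinset _ hnd]
      congr 1
      ext v
      simp [hmem v]
    have t2 := sum_length_adj hT hadj
    have t3 := offset_length (adj := adj) ls lt
    rw [ho, t1, hLlen, t3, hlen, show scanInit.size = 5 from rfl, show scanBody.size = 7 from rfl,
      show (searchInit r).size = 9 from rfl, show searchBody.size = 17 from rfl,
      show selectBody.size = 34 from rfl, show repBody.size = 13 from rfl]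
    omega
  · refine ⟨?_, ?_, ?_, ?_, ?_, fun v => (hout v).1, ⟨hout0, fun v => (hout v).2⟩, ?_, ?_, ?_⟩
    · exact (f6 1 (by decide)).trans ((f5 1 (by decide)).trans ((f4 1 (by decide)).trans
        ((f3 1 (by decide)).trans n2)))
    · exact (f6 36 (by decide)).trans ((f5 36 (by decide)).trans ((f4 36 (by decide)).trans
        hr3.2.2.2.2.2.1))
    · simp only [List.mem_cons, List.not_mem_nil, or_false, forall_eq_or_imp, forall_eq]
      exact ⟨(f6 20 (by decide)).trans ((f5 20 (by decide)).trans
          (f04 20 (by decide) (by decide) (by decide) (by decide))),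
        (f6 41 (by decide)).trans ((f5 41 (by decide)).trans
          (f04 41 (by decide) (by decide) (by decide) (by decide))),
        (f6 46 (by decide)).trans ((f5 46 (by decide)).trans
          (f04 46 (by decide) (by decide) (by decide) (by decide)))⟩
    · rw [g6 3 (by decide), g5 3 (by decide)]; exact q3
    · rw [g6 7 (by decide)]; exact hS.centers
    · intro a ha i
      have h6 : a ∉ (Prog.loop (.lt 23 1) repBody).arrs := by
        revert ha; revert a; decide
      have h5 : a ∉ (Prog.loop (.lt 20 13) selectBody).arrs := by
        clear h6; revert ha; revert a; decide
      have h0 : a ≠ 0 ∧ a ≠ 2 ∧ a ≠ 3 ∧ a ≠ 4 := by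
        clear h6 h5; revert ha; revert a; decide
      rw [g6 a h6, g5 a h5, g04 a h0.1 h0.2.1 h0.2.2.1 h0.2.2.2]
    · rw [b6, c6, off2 n (by omega)]; exact hLs
    · rw [b6, c6, off2 (n + 1) (by omega)]; exact hLt

theorem reads_of_getElem? {f : ℕ → ℕ} {p : ℕ} {l : List ℕ}
    (h : ∀ (i : ℕ) (x : ℕ), l[i]? = some x → f (p + i) = x) : Reads f p l := by
  induction l generalizing p with
  | nil => trivial
  | cons x l ih =>
    refine ⟨h 0 x rfl, ih fun i y hy => ?_⟩
    rw [add_assoc, add_comm 1]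
    exact h (i + 1) y (by simpa using hy)

theorem hasOutput_encodeMap {rep : Fin n → Fin n} {s : State} {b : ℕ} (h0 : s.reg 0 = n + 1)
    (hb : s.arr 1 0 = b) (h : ∀ v : Fin n, s.arr 1 (v + 1) = rep v) :
    HasOutput s (b :: encodeMap rep) := by
  refine ⟨by simp [h0, encodeMap], hb, reads_of_getElem? fun i x hx => ?_⟩
  obtain ⟨hi, rfl⟩ := List.getElem?_eq_some_iff.1 hx
  have hi' : i < n := by simpa [encodeMap] using hi
  have := h ⟨i, hi'⟩
  rw [show 0 + 1 + i = i + 1 by omega]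
  simpa [encodeMap] using this

theorem eval_compareInit {order : List (Fin n)} {C : Finset (Fin n)} {rep : Fin n → Fin n}
    {ls lt : List (Fin n)} {s : State} (h : HasPartition s order C rep ls lt) :
    (compareInit.eval s).reg 27 = s.arr 2 n + 1 ∧ (compareInit.eval s).reg 28 = ls.length ∧
    (compareInit.eval s).reg 29 = s.arr 2 (n + 1) + 1 ∧ (compareInit.eval s).reg 31 = lt.length ∧
    (compareInit.eval s).reg 0 = n + 1 ∧ (compareInit.eval s).reg 32 = 1 ∧
    (compareInit.eval s).arr = s.arr := by
  simp [compareInit, Prog.eval, h.size, h.source.1, h.target.1]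

theorem encodeMoves_append (m m' : List (Fin n × Fin n)) :
    encodeMoves (m ++ m') = encodeMoves m ++ encodeMoves m' := List.flatMap_append

/-- The chosen tokens depend on the order of the input lists, so they come out of the run; `hmid` is
therefore required for every possible choice. -/
theorem runs_moves {order : List (Fin n)} {C : Finset (Fin n)} {rep : Fin n → Fin n}
    {ls lt : List (Fin n)} {s : State} (h : HasPartition s order C rep ls lt)
    (hlen : ls.length = lt.length) (hls : ls.length ≤ n) (horder : order.length = n) (hn : 0 < n)
    (hrep : ∀ v, rep v ∈ C) (hself : ∀ x ∈ C, rep x = x)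
    (hs : ∀ x ∈ C, ∃ v ∈ ls.toFinset, rep v = x) (ht : ∀ x ∈ C, ∃ v ∈ lt.toFinset, rep v = x)
    (hmid : ∀ toks tokt, IsTok C rep ls.toFinset toks → IsTok C rep lt.toFinset tokt →
      ((List.finRange n).filter
        fun v => v ∈ extra rep ls.toFinset toks ∧ v ∉ extra rep lt.toFinset tokt).length =
      ((List.finRange n).filter
        fun v => v ∈ extra rep lt.toFinset tokt ∧ v ∉ extra rep ls.toFinset toks).length) :
    ∃ toks tokt, IsTok C rep ls.toFinset toks ∧ IsTok C rep lt.toFinset tokt ∧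
      ∃ s', Runs movesProg (compareInit.eval s) (200 * n) s' ∧
        s'.output = 1 :: (encodeMap rep ++ encodeMoves (allMoves rep toks tokt ls.toFinset
          lt.toFinset (order.filter (· ∈ C)) (List.finRange n))) := by
  obtain ⟨c27, c28, c29, c31, c0, c32, ca⟩ := eval_compareInit h
  have cr := (runs_eval compareInit rfl s).frame.reg
  set s₁ := compareInit.eval s
  have z := h.zero
  simp only [List.mem_cons, List.not_mem_nil, or_false, forall_eq_or_imp, forall_eq] at z
  obtain ⟨z20, z41, z46⟩ := z
  have e := h.empty
  simp only [List.mem_cons, List.not_mem_nil, or_false, forall_eq_or_imp, forall_eq] at e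
  obtain ⟨e9, e10, e11, e12⟩ := e
  -- the answer
  have R2 := runs_eval (.store 1 20 32) rfl s₁
  set s₂ := Prog.eval (.store 1 20 32) s₁ with hs₂
  have r2 : s₂.reg = s₁.reg := rfl
  have a2 : ∀ a, a ≠ 1 → s₂.arr a = s.arr a := fun a ha =>
    (R2.frame.arr a (by simpa [Prog.arrs] using ha)).trans (by rw [ca])
  have o2 : ∀ j, s₂.arr 1 j = if j = 0 then 1 else s.arr 1 j := by
    intro j
    have : s₁.reg 20 = 0 := (cr 20 (by decide)).trans z20
    simp [hs₂, Prog.eval, this, c32, ca]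
  -- the tokens
  obtain ⟨s₃, R3, ht1, ht2⟩ := runs_tokens (rep := rep) hlen s₂
    (by rw [r2, c27, a2 0 (by decide)]; exact h.source.2)
    (by rw [r2, c29, a2 0 (by decide)]; exact h.target.2) (by rw [r2, c28])
    (by rw [r2]; exact (cr 20 (by decide)).trans z20) (by rw [r2, c32])
    (by rw [a2 8 (by decide)]; exact h.rep_eq) (by rw [a2 9 (by decide)]; exact e9)
    (by rw [a2 10 (by decide)]; exact e10) (by rw [a2 11 (by decide)]; exact e11)
    (by rw [a2 12 (by decide)]; exact e12)
  obtain ⟨toks, htoks, hb10⟩ := ht1.exists_isTok hs hself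
  obtain ⟨tokt, htokt, hb12⟩ := ht2.exists_isTok ht hself
  have r3 : ∀ x ∉ tokenBody.regs, x ∉ compareInit.regs → s₃.reg x = s.reg x := fun x h1 h2 =>
    (R3.frame.reg x h1).trans ((congrFun r2 x).trans (cr x h2))
  have a3 : ∀ a ∉ tokenBody.arrs, a ≠ 1 → s₃.arr a = s.arr a := fun a h1 h2 =>
    (R3.frame.arr a h1).trans (a2 a h2)
  have out3 : HasOutput s₃ (1 :: encodeMap rep) := by
    refine hasOutput_encodeMap ?_ ?_ fun v => ?_
    · rw [R3.frame.reg 0 (by decide), r2, c0]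
    · rw [R3.frame.arr 1 (by decide), o2, if_pos rfl]
    · rw [R3.frame.arr 1 (by decide), o2, if_neg (by omega)]
      exact h.out.2 v
  -- the moves
  obtain ⟨s₄, R4, out4⟩ := runs_push (C := C) (tok := toks) (q := order) s₃ out3
    ((r3 36 (by decide) (by decide)).trans (h.size'.trans horder.symm))
    ((r3 20 (by decide) (by decide)).trans z20)
    (by rw [a3 3 (by decide) (by decide)]; exact h.reads_order)
    (by rw [a3 7 (by decide) (by decide)]; exact h.centers) hb10
  have r4 := R4.frame.reg
  have a4 := R4.frame.arr
  have R5 := runs_eval (.copy 39 0 ;; .copy 40 0 ;; .succ 40) rfl s₄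
  set s₅ := Prog.eval (.copy 39 0 ;; .copy 40 0 ;; .succ 40) s₄ with hs₅
  have q5 : s₅.reg 39 = s₅.reg 0 ∧ s₅.reg 40 = s₅.reg 0 + 1 ∧ s₅.arr = s₄.arr := by
    simp [hs₅, Prog.eval]
  have r5 := R5.frame.reg
  have out5 := out4
  rw [HasOutput, ← q5.2.2, ← r5 0 (by decide), ← HasOutput] at out5
  obtain ⟨s₆, R6, out6⟩ := runs_middle (C := C) s₅ out5 q5.1 q5.2.1
    ((r5 41 (by decide)).trans ((r4 41 (by decide)).trans
      ((r3 41 (by decide) (by decide)).trans z41)))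
    ((r5 1 (by decide)).trans ((r4 1 (by decide)).trans
      ((r3 1 (by decide) (by decide)).trans h.size))) hrep
    (by rw [q5.2.2, a4 8 (by decide), a3 8 (by decide) (by decide)]; exact h.rep_eq)
    (Ds := ls.toFinset) (by rw [q5.2.2, a4 9 (by decide)]; simpa using ht1.flag)
    (by rw [q5.2.2, a4 10 (by decide)]; exact hb10)
    (Dt := lt.toFinset) (by rw [q5.2.2, a4 11 (by decide)]; simpa using ht2.flag)
    (by rw [q5.2.2, a4 12 (by decide)]; exact hb12) (hmid toks tokt htoks htokt)
  have r6 := R6.frame.reg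
  have a6 := R6.frame.arr
  obtain ⟨s₇, R7, out7⟩ := runs_pull (C := C) (tok := tokt) (q := order) s₆ out6
    ((r6 46 (by decide)).trans ((r5 46 (by decide)).trans ((r4 46 (by decide)).trans
      ((r3 46 (by decide) (by decide)).trans z46))))
    ((r6 1 (by decide)).trans ((r5 1 (by decide)).trans ((r4 1 (by decide)).trans
      ((r3 1 (by decide) (by decide)).trans (h.size.trans horder.symm)))))
    ((r6 20 (by decide)).trans ((r5 20 (by decide)).trans ((r4 20 (by decide)).trans
      ((r3 20 (by decide) (by decide)).trans z20))))
    (by rw [a6 3 (by decide), q5.2.2, a4 3 (by decide), a3 3 (by decide) (by decide)]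
        exact h.reads_order)
    (by rw [a6 7 (by decide), q5.2.2, a4 7 (by decide), a3 7 (by decide) (by decide)]
        exact h.centers)
    (by rw [a6 12 (by decide), q5.2.2, a4 12 (by decide)]; exact hb12)
  -- The four passes cost `30`, `14`, `24` and `14` per vertex or token, and `n` is positive, so
  -- `200 * n` is generous.
  refine ⟨toks, tokt, htoks, htokt, s₇,
    (R2.seq (R3.seq (R4.seq (R5.seq (R6.seq R7))))).mono ?_, ?_⟩
  · rw [horder, show tokenBody.size = 29 from rfl, show pushBody.size = 13 from rfl,
      show middleBody.size = 23 from rfl, show pullBody.size = 13 from rfl]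
    simp only [Prog.size]
    omega
  · rw [out7.output_eq, allMoves, encodeMoves_append, encodeMoves_append]
    simp only [List.cons_append, List.append_assoc]

end

end DrDSR

/-! ### The theorem -/

theorem mainTheorem6 :
    -- every tree has a canonical minimum distance-`r` dominating set with its partition
    (∀ (r : ℕ), 2 ≤ r → ∀ (V : Type*) [Fintype V] (T : SimpleGraph V), T.IsTree →
      ∃ (Dstar : Finset V) (rep : V → V), DrDSR.IsCanonicalPartition T r Dstar rep) ∧
    -- reconfigurability means equality of the sizes
    (∀ (r : ℕ), 2 ≤ r → ∀ (V : Type*) [Fintype V] [DecidableEq V] (T : SimpleGraph V), T.IsTree →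
      ∀ Ds Dt : Finset V, DrDSR.IsDrDS T r Ds → DrDSR.IsDrDS T r Dt →
        (DrDSR.TJReconfigurable T r Ds Dt ↔ Ds.card = Dt.card)) ∧
    -- the linear-time algorithm: it partitions the tree, answers, and writes a sequence if any
    (∃ c : ℕ, ∀ (r : ℕ), 2 ≤ r → ∃ P : DrDSR.Prog,
      ∀ (n : ℕ) (T : SimpleGraph (Fin n)) (adj : Fin n → List (Fin n)),
        T.IsTree → DrDSR.IsAdjacencyList T adj →
        ∃ (Dstar : Finset (Fin n)) (rep : Fin n → Fin n),
          DrDSR.IsCanonicalPartition T r Dstar rep ∧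
          ∀ ls lt : List (Fin n), ls.Nodup → lt.Nodup →
            DrDSR.IsDrDS T r ls.toFinset → DrDSR.IsDrDS T r lt.toFinset →
            (DrDSR.TJReconfigurable T r ls.toFinset lt.toFinset →
              ∃ moves : List (Fin n × Fin n),
                DrDSR.TJSequence T r ls.toFinset moves lt.toFinset ∧
                P.Computes (DrDSR.encodeInstance adj ls lt)
                  (1 :: (DrDSR.encodeMap rep ++ DrDSR.encodeMoves moves)) (c * n)) ∧
            (¬ DrDSR.TJReconfigurable T r ls.toFinset lt.toFinset →
              P.Computes (DrDSR.encodeInstance adj ls lt)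
                (0 :: DrDSR.encodeMap rep) (c * n))) := by
  -- The constant `500` covers twice `200 * n` for the two long stages and `11` steps for the
  -- comparison, since a tree has at least one vertex.
  refine ⟨fun r _ V _ T hT => ?_, fun r _ V _ _ T hT Ds Dt hs ht =>
    DrDSR.tjReconfigurable_iff hT hs ht, 500, fun r _ => ⟨DrDSR.mainProg r, ?_⟩⟩
  · classical
    exact DrDSR.exists_isCanonicalPartition hT r
  intro n T adj hT hadj
  have hn : 0 < n := hT.connected.nonempty.some.pos
  have hadj' : ∀ v w, w ∈ adj v ↔ T.Adj v w := fun v => (hadj v).2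
  -- Everything up to the partition is computed from the root `0` and the adjacency lists, before
  -- the two dominating sets are introduced.
  set root : Fin n := ⟨0, hn⟩
  obtain ⟨dep, rep, hR, hG, hrep⟩ := DrDSR.exists_isRep_bfs hT hadj' root r
  refine ⟨_, rep, hrep.isCanonicalPartition hR hG hT.isAcyclic, fun ls lt nds ndt hs ht => ?_⟩
  have hls : ls.length ≤ n := by simpa using nds.length_le_card
  have hlt : lt.length ≤ n := by simpa using ndt.length_le_card
  obtain ⟨s, hrun, hP⟩ := DrDSR.runs_partition rfl r hT hadj hR hrep hls hlt
  have hrun' := DrDSR.runs_eval DrDSR.compareInit rfl s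
  obtain ⟨c27, c28, c29, c31, c0, c32, ca⟩ := DrDSR.eval_compareInit hP
  have hsize : DrDSR.compareInit.size = 10 := rfl
  rw [hsize] at hrun'
  rw [DrDSR.tjReconfigurable_iff hT hs ht, List.toFinset_card_of_nodup nds,
    List.toFinset_card_of_nodup ndt]
  constructor
  · intro hlen
    have hcard : ls.toFinset.card = lt.toFinset.card := by
      rw [List.toFinset_card_of_nodup nds, List.toFinset_card_of_nodup ndt, hlen]
    obtain ⟨h1, h2⟩ := DrDSR.pairwise_centers hT hadj' root
      (DrDSR.bfsSelect adj root r).centers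
    have horder : (DrDSR.bfsOrder adj root).length = n := by
      simpa [DrDSR.bfsOrder] using DrDSR.length_search (root := root) hT.connected hadj'
    obtain ⟨toks, tokt, htoks, htokt, s', hrun₂, hout⟩ := DrDSR.runs_moves hP hlen hls horder hn
      (hrep.rep_mem hR) hrep.rep_center (fun x => hrep.meets hR hG hs)
      (fun x => hrep.meets hR hG ht) fun toks tokt htoks htokt =>
        DrDSR.length_filter_extra hR hG hrep _ h1 h2 hs ht htoks htokt hcard _
          (List.nodup_finRange n) List.mem_finRange
    refine ⟨_, DrDSR.tjSequence_allMoves hR hG hrep _ h1 h2 hs ht htoks htokt hcard _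
      (List.nodup_finRange n) List.mem_finRange, ?_⟩
    obtain ⟨t, htt, he⟩ := hrun.seq (hrun'.seq
      (DrDSR.Runs.iteTrue (q := .skip) (b := .eq 28 31) (by
        show _ = _
        rw [c28, c31, hlen]) hrun₂))
    exact ⟨t, s', by omega, he, hout⟩
  -- For sets of different sizes nothing more is written: cell `0` of the output array is still
  -- zero, which is the negative answer.
  · intro hlen
    obtain ⟨t, htt, he⟩ := hrun.seq (hrun'.seq
      (DrDSR.Runs.iteFalse (p := DrDSR.movesProg) (b := .eq 28 31) (by
        show ¬ _ = _
        rwa [c28, c31]) (DrDSR.runs_eval .skip rfl _)))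
    refine ⟨t, _, ?_, he, ?_⟩
    · simp only [DrDSR.Prog.size] at htt
      omega
    · exact (DrDSR.hasOutput_encodeMap (rep := rep) c0 (by rw [ca]; exact hP.out.1)
        (by rw [ca]; exact hP.out.2)).output_eq
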